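/- **Proposition 2.2.** Let $4<p<\infty$ and let $q$ be given by $2/p+1/q=1/2$. For $u\in L^2(\mathbb R)$ (complex valued) write $$\Psi_p[u](t,x)=|D_x|^{1/p}e^{-t\partial_x^3}u(x)=\frac1{\sqrt{2\pi}}\int_{\mathbb R}|\xi|^{1/p}e^{it\xi^3+ix\xi}\,\hat u(\xi)\,d\xi ,\qquad \hat u(\xi)=\frac1{\sqrt{2\pi}}\int_{\mathbb R}u(x)e^{-ix\xi}\,dx,$$ understood, for each $t$, as a tempered distribution in $x$, with the convention that its $L^q_x$ norm is $+\infty$ if it is not a function in $L^q(\mathbb R)$. Put $$E_p(u)=\int_{\mathbb R}\left(\int_{\mathbb R}|\Psi_p[u](t,x)|^q\,dx\right)^{p/q}dt,\qquad \mathcal A_p=\sup_{u\in L^2(\mathbb R),\,u\neq0}\frac{E_p(u)}{\|u\|_{L^2}^p}.$$ Let $G$ be the set of all maps $g_{t_0,x_0,\lambda_0}:L^2(\mathbb R)\to L^2(\mathbb R)$, $t_0,x_0\in\mathbb R$, $\lambda_0>0$, given by $$[g_{t_0,x_0,\lambda_0}u](x)=\lambda_0^{1/2}\,(e^{-t_0\partial_x^3}u)(\lambda_0x+x_0).$$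 A sequence $(u_n)\subset L^2(\mathbb R)$ is called *precompact up to symmetries* if there are $(g_n)\subset G$ such that $(g_nu_n)$ is precompact in $L^2(\mathbb R)$. We write $u_n\rightharpoonup_{\rm sym}0$ if $g_nu_n\rightharpoonup0$ weakly in $L^2(\mathbb R)$ for all sequences $(g_n)\subset G$. Finally put $$\mathcal A_p^*=\sup\Big\{\limsup_{n\to\infty}E_p(u_n)\;:\;\|u_n\|_{L^2}=1\text{ for all }n,\ u_n\rightharpoonup_{\rm sym}0\Big\}.$$ Then the following are equivalent: 1. every sequence $(u_n)\subset L^2(\mathbb R)$ with $\|u_n\|_{L^2}=1$ for all $n$ and $E_p(u_n)\to\mathcal A_p$ is precompact up to symmetries; 2. $\mathcal A_p>\mathcal A_p^*$. -/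

import Mathlib

open MeasureTheory Filter Topology FourierTransform
open scoped ENNReal SchwartzMap

noncomputable section

namespace AiryStrichartz

/-- The space `L²(ℝ)` of complex valued functions. -/
abbrev L2 : Type := Lp (α := ℝ) ℂ 2

/-- The symbol `e^{i t η³}` of the Airy propagator `e^{-t ∂ₓ³}`. Mathlib's Fourier transform
is `𝓕 u ξ = ∫ u(x) e^{-2π i x ξ} dx`, so that `∂ₓ` corresponds to `i η` with `η = 2 π ξ`. -/
def airySymbol (t ξ : ℝ) : ℂ := Complex.exp (((t * (2 * Real.pi * ξ) ^ 3 : ℝ) : ℂ) * Complex.I)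

theorem continuous_airySymbol (t : ℝ) : Continuous (airySymbol t) := by
  unfold airySymbol
  fun_prop

theorem norm_airySymbol (t ξ : ℝ) : ‖airySymbol t ξ‖ = 1 := by
  unfold airySymbol
  exact Complex.norm_exp_ofReal_mul_I _

theorem memLp_airySymbol_mul (t : ℝ) (v : L2) :
    MemLp (fun ξ : ℝ => airySymbol t ξ * v ξ) 2 volume := by
  refine (Lp.memLp v).of_le
    ((continuous_airySymbol t).aestronglyMeasurable.mul (Lp.aestronglyMeasurable v)) ?_
  exact Eventually.of_forall fun ξ => by simp [norm_airySymbol]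

/-- The Airy propagator `e^{-t ∂ₓ³}` on `L²(ℝ)`, the Fourier multiplier with symbol `e^{i t η³}`. -/
def airyFlow (t : ℝ) (u : L2) : L2 :=
  𝓕⁻ ((memLp_airySymbol_mul t (𝓕 u)).toLp (fun ξ : ℝ => airySymbol t ξ * (𝓕 u : L2) ξ))

theorem memLp_comp_affine (x₀ : ℝ) {l : ℝ} (hl : 0 < l) (v : L2) :
    MemLp (fun x : ℝ => ((l ^ (1 / 2 : ℝ) : ℝ) : ℂ) * v (l * x + x₀)) 2 volume := by
  refine MemLp.const_mul ?_ _
  have h1 : MemLp (fun y : ℝ => v (y + x₀)) 2 volume :=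
    (Lp.memLp v).comp_measurePreserving (measurePreserving_add_right volume x₀)
  have hmap : Measure.map (fun x : ℝ => l * x) volume = ENNReal.ofReal |l⁻¹| • volume :=
    Real.map_volume_mul_left hl.ne'
  have h2 : MemLp (fun y : ℝ => v (y + x₀)) 2 (Measure.map (fun x : ℝ => l * x) volume) := by
    rw [hmap]
    exact h1.smul_measure ENNReal.ofReal_ne_top
  exact h2.comp_of_map (measurable_const_mul l).aemeasurable

/-- The transformation `(g_{t₀,x₀,l} u)(x) = l^{1/2} (e^{-t₀ ∂ₓ³} u)(l x + x₀)`, for `l > 0`. -/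
def symm (t₀ x₀ : ℝ) {l : ℝ} (hl : 0 < l) (u : L2) : L2 :=
  (memLp_comp_affine x₀ hl (airyFlow t₀ u)).toLp
    (fun x : ℝ => ((l ^ (1 / 2 : ℝ) : ℝ) : ℂ) * (airyFlow t₀ u) (l * x + x₀))

/-- The set `G` of all symmetries, as maps of `L²(ℝ)`. -/
def G : Set (L2 → L2) := {g | ∃ (t₀ x₀ l : ℝ) (hl : 0 < l), g = symm t₀ x₀ hl}

/-- The tempered distribution `Ψ_p[u](t, ·) = |Dₓ|^{1/p} e^{-t ∂ₓ³} u` tested against a Schwartz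
function `φ`. It is the inverse Fourier transform of the function
`ξ ↦ |2πξ|^{1/p} e^{i t (2πξ)³} 𝓕 u ξ`, which is an `L²` function times a factor of polynomial
growth; the integral below always converges absolutely. -/
def psi (p : ℝ) (u : L2) (t : ℝ) (φ : 𝓢(ℝ, ℂ)) : ℂ :=
  ∫ ξ : ℝ, ((|2 * Real.pi * ξ| ^ (1 / p) : ℝ) : ℂ) * airySymbol t ξ * (𝓕 u : L2) ξ *
    (𝓕⁻ φ : 𝓢(ℝ, ℂ)) ξ

/-- The distribution `Ψ_p[u](t, ·)` is the function `f`. -/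
def IsPsi (p : ℝ) (u : L2) (t : ℝ) (f : ℝ → ℂ) : Prop :=
  ∀ φ : 𝓢(ℝ, ℂ), ∫ x : ℝ, f x * φ x = psi p u t φ

/-- The norm `‖Ψ_p[u](t, ·)‖_{L^q_x}`: the `L^q` norm of the function in `L^q(ℝ)` (unique up to
null sets) that represents `Ψ_p[u](t, ·)`, and `∞` if there is none. -/
def psiNorm (p q : ℝ) (u : L2) (t : ℝ) : ℝ≥0∞ :=
  ⨅ (f : ℝ → ℂ) (_ : MemLp f (ENNReal.ofReal q) volume) (_ : IsPsi p u t f),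
    eLpNorm f (ENNReal.ofReal q) volume

/-- The energy `‖Ψ_p[u]‖_{L^p_t L^q_x}^p = ∫ (∫ |Ψ_p[u](t,x)|^q dx)^{p/q} dt`. -/
def energy (p q : ℝ) (u : L2) : ℝ≥0∞ := ∫⁻ t : ℝ, psiNorm p q u t ^ p

/-- The best constant `𝒜_p` in the Airy–Strichartz inequality. -/
def bestConst (p q : ℝ) : ℝ≥0∞ := ⨆ (u : L2) (_ : u ≠ 0), energy p q u / ‖u‖ₑ ^ p

/-- Normalized maximizing sequences for `𝒜_p`. -/
def IsMaximizing (p q : ℝ) (u : ℕ → L2) : Prop :=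
  (∀ n, ‖u n‖ = 1) ∧ Tendsto (fun n => energy p q (u n)) atTop (𝓝 (bestConst p q))

/-- Precompactness up to symmetries: `(gₙ uₙ)` is relatively compact in `L²(ℝ)` for some
`(gₙ) ⊂ G`. -/
def PrecompactUpToSymm (u : ℕ → L2) : Prop :=
  ∃ g : ℕ → L2 → L2, (∀ n, g n ∈ G) ∧ IsCompact (closure (Set.range fun n => g n (u n)))

/-- Weak convergence to zero up to symmetries: `gₙ uₙ ⇀ 0` weakly in `L²(ℝ)` for all
`(gₙ) ⊂ G`. -/
def WeakSymmZero (u : ℕ → L2) : Prop :=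
  ∀ g : ℕ → L2 → L2, (∀ n, g n ∈ G) →
    ∀ w : L2, Tendsto (fun n => inner ℂ w (g n (u n))) atTop (𝓝 0)

/-- The highest energy `𝒜*_p` of normalized sequences converging weakly to zero up to
symmetries. -/
def bestConstStar (p q : ℝ) : ℝ≥0∞ :=
  ⨆ (u : ℕ → L2) (_ : ∀ n, ‖u n‖ = 1) (_ : WeakSymmZero u),
    limsup (fun n => energy p q (u n)) atTop

end AiryStrichartz

end

/-! Suppose `𝒜*_p < 𝒜_p`. A normalized maximizing sequence cannot vanish weakly up to symmetries,
since its energies would then be bounded in the limit by `𝒜*_p`. After applying symmetries, a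
subsequence therefore has a weak limit `v ≠ 0` (`exists_profile`). Write it as `v + rₙ` with `rₙ ⇀
0`. A Brezis–Lieb argument (`exists_subseq_energy_le`) decouples the energies of `v` and `rₙ` up to
a factor `1 + ε`. As the norm is mixed, this holds for the power `α = min 1 (q/p)` of the energy.
Bounding both energies by `𝒜_p ‖·‖^p` and using `‖rₙ‖² → 1 - ‖v‖²` gives `1 ≤ (1 - S)^κ + S^κ` with
`S = ‖v‖²` and `κ = min(p, q)/2 > 1`. Strict convexity forces `S = 1`, so the convergence is strong
(`norm_weakLimit_eq_one`). Every subsequence thus has a further one that converges modulo `G`. Since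
`G` is a group of isometries, symmetries can be chosen for the whole sequence at once
(`IsIsometryGroup.exists_totallyBounded`).

Brezis–Lieb needs pointwise information on `Ψ_p[rₙ]`. This comes from local smoothing
(`tendsto_windowEnergy`): the `L²` norm of `Ψ_p[rₙ](t, ·)` times a Gaussian in `x`, averaged over
`t` with Gaussian weight, tends to zero. High frequencies are uniformly small by a Schur test that
uses the cubic dispersion; low ones vanish by weak convergence and domination.

The Strichartz inequality `𝒜_p < ∞` is never needed as an input. If `𝒜_p = ∞`, small perturbations
of a vanishing sequence already have unbounded energy, so `𝒜*_p = ∞` (`bestConstStar_eq_top`),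
contradicting the strict inequality.

Conversely, if `𝒜_p ≤ 𝒜*_p`, a diagonal choice from near-optimal vanishing sequences yields a
maximizing sequence that vanishes weakly up to symmetries (`exists_maximizing_weakSymmZero`). It is
not precompact up to symmetries, because a strong limit would have norm one and be zero. -/

noncomputable section

namespace AiryStrichartz

/-! ### Weak convergence in Hilbert spaces -/

section Hilbert

variable {H : Type*} [NormedAddCommGroup H] [InnerProductSpace ℂ H]

theorem exists_subseq_tendsto_inner [CompleteSpace H] [TopologicalSpace.SeparableSpace H] {x : ℕ → H} {C : ℝ}
    (hx : ∀ n, ‖x n‖ ≤ C) :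
    ∃ (a : H) (φ : ℕ → ℕ), StrictMono φ ∧
      ∀ w, Tendsto (fun n => inner ℂ w (x (φ n))) atTop (𝓝 (inner ℂ w a)) := by
  have hc := WeakDual.isSeqCompact_closedBall ℂ H 0 C
  obtain ⟨L, -, φ, hφ, hL⟩ := hc (x := fun n =>
    (StrongDual.toWeakDual (InnerProductSpace.toDual ℂ H (x n)) : WeakDual ℂ H)) (fun n => by
      simpa using hx n)
  refine ⟨(InnerProductSpace.toDual ℂ H).symm (WeakDual.toStrongDual L), φ, hφ, fun w => ?_⟩
  have h1 := (WeakDual.eval_continuous (𝕜 := ℂ) (E := H) w).continuousAt.tendsto.comp hL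
  have h2 := (Complex.continuous_conj.tendsto _).comp h1
  refine (h2.congr fun n => ?_).trans (le_of_eq ?_)
  · simp [InnerProductSpace.toDual_apply_apply]
  · congr 1
    rw [← inner_conj_symm, ← InnerProductSpace.toDual_apply_apply]
    simp

/-- Hahn–Banach separation: a point outside a closed convex set is cut off by a half-space, and a
weak limit cannot cross it. -/
theorem mem_of_tendsto_inner [CompleteSpace H] {s : Set H} (hs : Convex ℝ s) (hc : IsClosed s) {x : ℕ → H} {a : H}
    (hx : ∀ n, x n ∈ s)
    (h : ∀ w, Tendsto (fun n => inner ℂ w (x n)) atTop (𝓝 (inner ℂ w a))) : a ∈ s := by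
  by_contra ha
  obtain ⟨f, u, hf, hu⟩ := RCLike.geometric_hahn_banach_closed_point (𝕜 := ℂ) hs hc ha
  have h1 := h ((InnerProductSpace.toDual ℂ H).symm f)
  simp only [InnerProductSpace.toDual_symm_apply] at h1
  have h2 := (Complex.continuous_re.tendsto _).comp h1
  have := le_of_tendsto' h2 (fun n => (hf _ (hx n)).le)
  exact absurd hu (not_lt.2 this)

theorem norm_sub_sq_tendsto_of_tendsto_inner {x : ℕ → H} {a : H} (hx : ∀ n, ‖x n‖ = 1)
    (h : ∀ w, Tendsto (fun n => inner ℂ w (x n)) atTop (𝓝 (inner ℂ w a))) :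
    Tendsto (fun n => ‖x n - a‖ ^ 2) atTop (𝓝 (1 - ‖a‖ ^ 2)) := by
  have h1 : ∀ n, ‖x n - a‖ ^ 2 = 1 - 2 * (inner ℂ a (x n)).re + ‖a‖ ^ 2 := fun n => by
    rw [@norm_sub_sq ℂ, hx n, inner_re_symm]
    simp
  simp_rw [h1]
  have h2 := (Complex.continuous_re.tendsto _).comp (h a)
  have h3 : (inner ℂ a a).re = ‖a‖ ^ 2 := inner_self_eq_norm_sq (𝕜 := ℂ) a
  have := ((h2.const_mul 2).const_sub 1).add_const (‖a‖ ^ 2)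
  refine this.trans (le_of_eq ?_)
  rw [h3]; ring_nf

end Hilbert

/-! ### Compactness modulo a group of isometries -/

section Orbits

variable {X : Type*} [PseudoMetricSpace X]

/-- A set of self-maps that is a group of isometries. -/
structure IsIsometryGroup (S : Set (X → X)) : Prop where
  dist_eq : ∀ g ∈ S, ∀ x y, dist (g x) (g y) = dist x y
  comp_mem : ∀ g ∈ S, ∀ h ∈ S, (fun x => g (h x)) ∈ S
  id_mem : (fun x => x) ∈ S
  exists_inv : ∀ g ∈ S, ∃ h ∈ S, (∀ x, h (g x) = x) ∧ ∀ x, g (h x) = x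

/-- Otherwise a greedy choice gives a subsequence whose orbits are pairwise `ε`-separated. A
convergent choice of representatives would bring two of those orbits within `ε` of each other. -/
theorem IsIsometryGroup.exists_finset_net {S : Set (X → X)} (hS : IsIsometryGroup S) {u : ℕ → X}
    (hu : ∀ φ : ℕ → ℕ, StrictMono φ → ∃ ψ : ℕ → ℕ, StrictMono ψ ∧ ∃ g : ℕ → X → X,
      (∀ n, g n ∈ S) ∧ ∃ x, Tendsto (fun n => g n (u (φ (ψ n)))) atTop (𝓝 x))
    {ε : ℝ} (hε : 0 < ε) :
    ∃ F : Finset ℕ, ∀ n, ∃ m ∈ F, ∃ g ∈ S, dist (u n) (g (u m)) < ε := by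
  by_contra! hF
  obtain ⟨f, -, hf⟩ := exists_seq_of_forall_finset_exists (fun _ : ℕ => True)
    (fun m n => m < n ∧ ∀ g ∈ S, ε ≤ dist (u n) (g (u m))) (fun s _ => by
      -- Adding all indices up to the maximum of `s` forces the new index to be larger: an old index
      -- is at distance zero from itself through the identity.
      obtain ⟨n, hn⟩ := hF (s ∪ Finset.range (s.sup id + 1))
      refine ⟨n, trivial, fun m hm => ⟨?_, hn m (Finset.mem_union_left _ hm)⟩⟩
      by_contra! hle
      have h1 : n ≤ s.sup id := hle.trans (Finset.le_sup (f := id) hm)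
      have h2 := hn n (Finset.mem_union_right _ (Finset.mem_range.2 (Nat.lt_succ_of_le h1)))
        _ hS.id_mem
      simp only [dist_self] at h2
      linarith)
  have hfm : StrictMono f := fun m n hmn => (hf m n hmn).1
  obtain ⟨ψ, hψ, g, hg, x, hx⟩ := hu f hfm
  obtain ⟨N, hN⟩ := Metric.cauchySeq_iff'.1 hx.cauchySeq ε hε
  have h1 := hN (N + 1) (Nat.le_succ N)
  obtain ⟨h, hh, hinv, -⟩ := hS.exists_inv _ (hg (N + 1))
  rw [← hS.dist_eq h hh, hinv] at h1
  exact absurd h1 (not_lt.2 ((hf _ _ (hψ (Nat.lt_succ_self N))).2 _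
    (hS.comp_mem _ hh _ (hg N))))

/-- Sequential precompactness of orbits lifts to total boundedness of representatives. -/
theorem IsIsometryGroup.exists_totallyBounded {S : Set (X → X)} (hS : IsIsometryGroup S)
    {u : ℕ → X}
    (hu : ∀ φ : ℕ → ℕ, StrictMono φ → ∃ ψ : ℕ → ℕ, StrictMono ψ ∧ ∃ g : ℕ → X → X,
      (∀ n, g n ∈ S) ∧ ∃ x, Tendsto (fun n => g n (u (φ (ψ n)))) atTop (𝓝 x)) :
    ∃ g : ℕ → X → X, (∀ n, g n ∈ S) ∧ TotallyBounded (Set.range fun n => g n (u n)) := by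
  classical
  set δ : ℕ → ℝ := fun k => (1 / 2 : ℝ) ^ k with hδ
  have hδ0 : ∀ k, 0 < δ k := fun k => by positivity
  have hδs : ∀ k, δ (k + 1) = δ k / 2 := fun k => by simp only [hδ, pow_succ]; ring
  choose F hF using fun k => hS.exists_finset_net hu (hδ0 k)
  choose f hfF γ hγ hγd using hF
  -- The representative depends only on the pair `(x, m)` and not on the index `n` being
  -- approximated. This keeps the range of each `c k` finite.
  let Γ : ℕ → X → ℕ → X := fun k x m =>
    if h : ∃ g ∈ S, dist x (g (u m)) < 2 * δ k then h.choose (u m) else x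
  let c : ℕ → ℕ → X := fun k => Nat.rec (fun n => u (f 0 n)) (fun k ck n => Γ k (ck n) (f (k + 1) n)) k
  have hc : ∀ k n, c (k + 1) n = Γ k (c k n) (f (k + 1) n) := fun k n => rfl
  have hfin : ∀ k, (Set.range (c k)).Finite := fun k => by
    induction k with
    | zero =>
      refine ((F 0).finite_toSet.image u).subset ?_
      rintro _ ⟨n, rfl⟩
      exact ⟨f 0 n, hfF 0 n, rfl⟩
    | succ k ih =>
      refine (Set.Finite.image2 (Γ k) ih (F (k + 1)).finite_toSet).subset ?_
      rintro _ ⟨n, rfl⟩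
      exact ⟨c k n, ⟨n, rfl⟩, f (k + 1) n, hfF _ n, rfl⟩
  have key : ∀ k n, (∃ g ∈ S, dist (g (u n)) (c k n) < δ k) →
      ∃ g ∈ S, dist (c k n) (g (u (f (k + 1) n))) < 2 * δ k := by
    rintro k n ⟨g, hg, hd⟩
    refine ⟨_, hS.comp_mem g hg _ (hγ (k + 1) n), ?_⟩
    have h1 : dist (g (u n)) (g (γ (k + 1) n (u (f (k + 1) n)))) < δ (k + 1) := by
      rw [hS.dist_eq g hg]
      exact hγd (k + 1) n
    have h2 := dist_triangle_left (c k n) (g (γ (k + 1) n (u (f (k + 1) n)))) (g (u n))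
    have h3 := hδs k
    have h4 := hδ0 k
    linarith
  have horb : ∀ k n, ∃ g ∈ S, dist (g (u n)) (c k n) < δ k := by
    intro k
    induction k with
    | zero =>
      exact fun n => by
        obtain ⟨h, hh, hinv, -⟩ := hS.exists_inv _ (hγ 0 n)
        refine ⟨h, hh, ?_⟩
        have := hγd 0 n
        rwa [← hS.dist_eq h hh, hinv] at this
    | succ k ih =>
      intro n
      have hex := key k n (ih n)
      have hval : c (k + 1) n = hex.choose (u (f (k + 1) n)) := by
        rw [hc]; exact dif_pos hex
      obtain ⟨h, hh, hinv, -⟩ := hS.exists_inv _ (hγ (k + 1) n)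
      refine ⟨_, hS.comp_mem _ hex.choose_spec.1 h hh, ?_⟩
      rw [hval, hS.dist_eq _ hex.choose_spec.1]
      have := hγd (k + 1) n
      rwa [← hS.dist_eq h hh, hinv] at this
  have hstep : ∀ k n, dist (c (k + 1) n) (c k n) < 2 * δ k := by
    intro k n
    have hex := key k n (horb k n)
    have hval : c (k + 1) n = hex.choose (u (f (k + 1) n)) := by
      rw [hc]; exact dif_pos hex
    rw [hval, dist_comm]
    exact hex.choose_spec.2
  -- The geometric series of the steps `2 * δ k`, in a telescoped form suited to induction.
  have htail : ∀ k n i, dist (c (k + i) n) (c k n) ≤ 4 * δ k - 4 * δ (k + i) := by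
    intro k n i
    induction i with
    | zero => simp
    | succ i ih =>
      have h1 := hstep (k + i) n
      have h2 := dist_triangle (c (k + (i + 1)) n) (c (k + i) n) (c k n)
      have h3 := hδs (k + i)
      rw [← add_assoc] at *
      linarith
  choose g hg hgd using fun n => horb n n
  refine ⟨g, hg, Metric.totallyBounded_iff.2 fun ε hε => ?_⟩
  -- The fifth covers a tail of at most `4 * δ k` plus the final error `δ (k + i) ≤ δ k`.
  obtain ⟨k, hk⟩ := exists_pow_lt_of_lt_one (show 0 < ε / 5 by positivity)
    (show (1 / 2 : ℝ) < 1 by norm_num)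
  -- For `n < k` the diagonal representative is only known to be `δ n`-close to its approximant, so
  -- these finitely many points join the net themselves.
  refine ⟨Set.range (c k) ∪ (fun n => g n (u n)) '' (Finset.range k : Set ℕ),
    (hfin k).union ((Finset.range k).finite_toSet.image _), ?_⟩
  rintro _ ⟨n, rfl⟩
  rcases lt_or_ge n k with h | h
  · refine Set.mem_biUnion (Or.inr ⟨n, by simpa using h, rfl⟩) ?_
    simpa using hε
  · refine Set.mem_biUnion (Or.inl ⟨n, rfl⟩) ?_
    obtain ⟨i, rfl⟩ := Nat.exists_eq_add_of_le h
    have h1 := htail k (k + i) i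
    have h2 := hgd (k + i)
    have h3 := dist_triangle (g (k + i) (u (k + i))) (c (k + i) (k + i)) (c k (k + i))
    have h4 : δ (k + i) ≤ δ k := pow_le_pow_of_le_one (by norm_num) (by norm_num) (by omega)
    have h5 := hδ0 (k + i)
    have h6 : δ k < ε / 5 := hk
    simp only [Metric.mem_ball]
    linarith

end Orbits

/-! ### Elementary inequalities for decoupling powers -/

section Inequalities

/-- Convexity of `x ^ q` applied to `a + b = θ (a/θ) + (1 - θ) (b/(1 - θ))` gives the constants
`θ^(1-q)` and `(1 - θ)^(1-q)`; the second tends to `1` as `θ → 0`. -/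
theorem exists_add_rpow_le {q ε : ℝ} (hq : 1 ≤ q) (hε : 0 < ε) :
    ∃ C : ℝ≥0∞, C ≠ ∞ ∧ ∀ a b : ℝ≥0∞,
      (a + b) ^ q ≤ C * a ^ q + ENNReal.ofReal (1 + ε) * b ^ q := by
  have hcont : ContinuousAt (fun θ : ℝ => (1 - θ) * ((1 - θ)⁻¹) ^ q) 0 := by
    refine ContinuousAt.mul (by fun_prop) (ContinuousAt.rpow_const ?_ (Or.inr (by linarith)))
    exact ContinuousAt.inv₀ (by fun_prop) (by norm_num)
  have hev : ∀ᶠ θ in 𝓝 (0 : ℝ), (1 - θ) * ((1 - θ)⁻¹) ^ q < 1 + ε := by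
    refine hcont.eventually_lt continuousAt_const ?_
    simp [hε]
  obtain ⟨θ, ⟨hθ, hθ1⟩, hθ0⟩ := ((hev.and (eventually_lt_nhds one_pos)).filter_mono
    nhdsWithin_le_nhds |>.and (self_mem_nhdsWithin (s := Set.Ioi (0 : ℝ)))).exists
  have hθ0 : 0 < θ := hθ0
  have h1θ : 0 < 1 - θ := by linarith
  set w : ℝ≥0∞ := ENNReal.ofReal θ with hw
  set v : ℝ≥0∞ := ENNReal.ofReal (1 - θ) with hv
  have hw0 : w ≠ 0 := by simpa [hw] using hθ0
  have hv0 : v ≠ 0 := by simpa [hv] using hθ1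
  have hwt : w ≠ ∞ := ENNReal.ofReal_ne_top
  have hvt : v ≠ ∞ := ENNReal.ofReal_ne_top
  refine ⟨w * (w⁻¹) ^ q, ENNReal.mul_ne_top hwt
    (ENNReal.rpow_ne_top_of_nonneg (by linarith) (ENNReal.inv_ne_top.2 hw0)), fun a b => ?_⟩
  have h := ENNReal.rpow_arith_mean_le_arith_mean2_rpow w v (w⁻¹ * a) (v⁻¹ * b)
    (by rw [hw, hv, ← ENNReal.ofReal_add hθ0.le h1θ.le]; simp) hq
  rw [← mul_assoc, ← mul_assoc, ENNReal.mul_inv_cancel hw0 hwt, ENNReal.mul_inv_cancel hv0 hvt,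
    one_mul, one_mul, ENNReal.mul_rpow_of_nonneg _ _ (by linarith),
    ENNReal.mul_rpow_of_nonneg _ _ (by linarith), ← mul_assoc, ← mul_assoc] at h
  refine h.trans (add_le_add_right (mul_le_mul_left ?_ _) _)
  rw [hv, ← ENNReal.ofReal_inv_of_pos h1θ, ENNReal.ofReal_rpow_of_pos (by positivity),
    ← ENNReal.ofReal_mul h1θ.le]
  exact ENNReal.ofReal_le_ofReal hθ.le

/-- Minkowski for `s ≥ 1` and subadditivity of `x ^ s` for `s ≤ 1`, in one form. With `s = p/q` both
cases occur in the range `p > 4`. -/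
theorem lintegral_add_rpow_min_le {α : Type*} [MeasurableSpace α] {μ : Measure α} {s : ℝ}
    (hs : 0 < s) {f g : α → ℝ≥0∞} (hf : AEMeasurable f μ) (hg : AEMeasurable g μ) :
    (∫⁻ x, (f x + g x) ^ s ∂μ) ^ min 1 (1 / s) ≤
      (∫⁻ x, f x ^ s ∂μ) ^ min 1 (1 / s) + (∫⁻ x, g x ^ s ∂μ) ^ min 1 (1 / s) := by
  rcases le_total 1 s with h | h
  · rw [min_eq_right (by rw [div_le_one hs]; exact h)]
    exact ENNReal.lintegral_Lp_add_le hf hg h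
  · rw [min_eq_left (by rw [le_div_iff₀ hs]; linarith)]
    simp only [ENNReal.rpow_one]
    rw [← lintegral_add_left' (hf.pow_const s)]
    exact lintegral_mono fun x => ENNReal.rpow_add_le_add_rpow _ _ hs.le h

end Inequalities

/-! ### The distribution `psi` -/

/-- The symbol `|η|^{1/p}`, `η = 2πξ`. -/
def derivSymbol (p ξ : ℝ) : ℝ := |2 * Real.pi * ξ| ^ (1 / p)

theorem derivSymbol_nonneg (p ξ : ℝ) : 0 ≤ derivSymbol p ξ := by unfold derivSymbol; positivity

theorem continuous_derivSymbol {p : ℝ} (hp : 0 < p) : Continuous (derivSymbol p) := by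
  unfold derivSymbol
  exact Continuous.rpow_const (by fun_prop) fun _ => Or.inr (by positivity)

theorem derivSymbol_le {p : ℝ} (hp : 1 < p) (ξ : ℝ) :
    derivSymbol p ξ ≤ 1 + 2 * Real.pi * |ξ| := by
  have hπ := Real.pi_pos
  unfold derivSymbol
  rw [abs_mul, abs_of_pos (by positivity : 0 < 2 * Real.pi)]
  set y := 2 * Real.pi * |ξ|
  have hy : 0 ≤ y := by positivity
  calc y ^ (1 / p) ≤ (1 + y) ^ (1 / p) := by
        refine Real.rpow_le_rpow hy (by linarith) (by positivity)
    _ ≤ (1 + y) ^ (1 : ℝ) := by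
        refine Real.rpow_le_rpow_of_exponent_le (by linarith) ?_
        rw [div_le_one (by linarith)]; linarith
    _ = 1 + y := Real.rpow_one _

theorem memLp_derivSymbol_mul {p : ℝ} (hp : 1 < p) (φ : 𝓢(ℝ, ℂ)) :
    MemLp (fun ξ : ℝ => (derivSymbol p ξ : ℂ) * φ ξ) 2 volume := by
  have hg : (fun x : ℝ => (x : ℂ)).HasTemperateGrowth := by fun_prop
  have h1 := φ.memLp 2 (μ := volume)
  have h2 := (SchwartzMap.smulLeftCLM ℂ (fun x : ℝ => (x : ℂ)) φ).memLp 2 (μ := volume)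
  refine (h1.norm.add (h2.norm.const_mul (2 * Real.pi))).of_le ?_ (Eventually.of_forall fun ξ => ?_)
  · exact ((Complex.continuous_ofReal.comp (continuous_derivSymbol (by linarith))).mul
      φ.continuous).aestronglyMeasurable
  · rw [SchwartzMap.smulLeftCLM_apply hg]
    have h3 := derivSymbol_le hp ξ
    have h4 := derivSymbol_nonneg p ξ
    have h5 := norm_nonneg (φ ξ)
    have hπ := Real.pi_pos
    simp only [Pi.add_apply, norm_mul, Complex.norm_real, smul_eq_mul, Real.norm_eq_abs, abs_of_nonneg h4]
    rw [abs_of_nonneg (by positivity)]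
    nlinarith [mul_le_mul_of_nonneg_right h3 h5]

/-- The full symbol `|η|^{1/p} e^{itη³}`. -/
def psiSymbol (p t ξ : ℝ) : ℂ := (derivSymbol p ξ : ℂ) * airySymbol t ξ

theorem continuous_psiSymbol {p : ℝ} (hp : 0 < p) :
    Continuous fun z : ℝ × ℝ => psiSymbol p z.1 z.2 := by
  unfold psiSymbol airySymbol
  have := continuous_derivSymbol hp
  fun_prop

theorem norm_psiSymbol (p t ξ : ℝ) : ‖psiSymbol p t ξ‖ = derivSymbol p ξ := by
  rw [psiSymbol, norm_mul, norm_airySymbol, mul_one, Complex.norm_real, Real.norm_eq_abs,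
    abs_of_nonneg (derivSymbol_nonneg p ξ)]

theorem memLp_psiSymbol_mul {p : ℝ} (hp : 1 < p) (t : ℝ) (φ : 𝓢(ℝ, ℂ)) :
    MemLp (fun ξ : ℝ => psiSymbol p t ξ * φ ξ) 2 volume := by
  refine (memLp_derivSymbol_mul hp φ).of_le (Continuous.aestronglyMeasurable ?_)
    (Eventually.of_forall fun ξ => ?_)
  · have := (continuous_psiSymbol (p := p) (by linarith)).comp (continuous_const (y := t) |>.prodMk continuous_id)
    exact this.mul φ.continuous
  · rw [norm_mul, norm_mul, norm_psiSymbol, Complex.norm_real, Real.norm_eq_abs,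
      abs_of_nonneg (derivSymbol_nonneg p ξ)]

theorem psi_eq (p : ℝ) (u : L2) (t : ℝ) (φ : 𝓢(ℝ, ℂ)) :
    psi p u t φ = ∫ ξ : ℝ, (𝓕 u : L2) ξ * (psiSymbol p t ξ * (𝓕⁻ φ : 𝓢(ℝ, ℂ)) ξ) := by
  unfold psi psiSymbol derivSymbol
  congr 1; ext ξ; ring

theorem integrable_psi {p : ℝ} (hp : 1 < p) (v : L2) (t : ℝ) (φ : 𝓢(ℝ, ℂ)) :
    Integrable (fun ξ : ℝ => v ξ * (psiSymbol p t ξ * φ ξ)) :=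
  (Lp.memLp v).integrable_mul (memLp_psiSymbol_mul hp t φ)

theorem psi_add {p : ℝ} (hp : 1 < p) (u v : L2) (t : ℝ) (φ : 𝓢(ℝ, ℂ)) :
    psi p (u + v) t φ = psi p u t φ + psi p v t φ := by
  simp only [psi_eq]
  rw [← integral_add (integrable_psi hp _ t _) (integrable_psi hp _ t _)]
  refine integral_congr_ae ?_
  rw [FourierTransform.fourier_add]
  filter_upwards [Lp.coeFn_add (𝓕 u : L2) (𝓕 v : L2)] with ξ h
  rw [h, Pi.add_apply]; ring

theorem psi_smul (p : ℝ) (c : ℂ) (u : L2) (t : ℝ) (φ : 𝓢(ℝ, ℂ)) :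
    psi p (c • u) t φ = c * psi p u t φ := by
  simp only [psi_eq]
  rw [← integral_const_mul]
  refine integral_congr_ae ?_
  rw [FourierTransform.fourier_smul]
  filter_upwards [Lp.coeFn_smul c (𝓕 u : L2)] with ξ h
  rw [h, Pi.smul_apply, smul_eq_mul]; ring

theorem continuous_psi {p : ℝ} (hp : 1 < p) (u : L2) (φ : 𝓢(ℝ, ℂ)) :
    Continuous fun t => psi p u t φ := by
  simp only [psi_eq]
  refine continuous_of_dominated (bound := fun ξ => ‖(𝓕 u : L2) ξ * (psiSymbol p 0 ξ * (𝓕⁻ φ : 𝓢(ℝ, ℂ)) ξ)‖)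
    (fun t => (integrable_psi hp _ t _).aestronglyMeasurable) (fun t => Eventually.of_forall fun ξ => ?_)
    (integrable_psi hp _ 0 _).norm (Eventually.of_forall fun ξ => ?_)
  · simp [norm_psiSymbol]
  · have := (continuous_psiSymbol (p := p) (by linarith)).comp ((continuous_id (X := ℝ)).prodMk (continuous_const (y := ξ)))
    exact continuous_const.mul (this.mul continuous_const)

/-! ### Representing functions -/

theorem integrable_mul_schwartz {q : ℝ} (hq : 1 < q) {f : ℝ → ℂ}
    (hf : MemLp f (ENNReal.ofReal q) volume) (φ : 𝓢(ℝ, ℂ)) :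
    Integrable fun x => f x * φ x := by
  have := (Real.HolderConjugate.conjExponent hq).ennrealOfReal
  exact hf.integrable_mul (q := ENNReal.ofReal q.conjExponent) (φ.memLp _)

theorem IsPsi.add {p q : ℝ} (hp : 1 < p) (hq : 1 < q) {u v : L2} {t : ℝ} {f g : ℝ → ℂ}
    (hf : MemLp f (ENNReal.ofReal q) volume) (hg : MemLp g (ENNReal.ofReal q) volume)
    (hfu : IsPsi p u t f) (hgv : IsPsi p v t g) : IsPsi p (u + v) t (fun x => f x + g x) := fun φ => by
  rw [psi_add hp, ← hfu, ← hgv, ← integral_add (integrable_mul_schwartz hq hf φ)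
    (integrable_mul_schwartz hq hg φ)]
  simp only [add_mul]

theorem IsPsi.smul {p : ℝ} {u : L2} {t : ℝ} {f : ℝ → ℂ} (c : ℂ) (hfu : IsPsi p u t f) :
    IsPsi p (c • u) t (fun x => c * f x) := fun φ => by
  rw [psi_smul, ← hfu, ← integral_const_mul]
  simp only [mul_assoc]

/-- Uniqueness of the representing function makes the infimum in `psiNorm` either `∞` or the norm of
any one representative. -/
theorem IsPsi.ae_eq {p q : ℝ} (hq : 1 < q) {u : L2} {t : ℝ} {f g : ℝ → ℂ}
    (hf : MemLp f (ENNReal.ofReal q) volume) (hg : MemLp g (ENNReal.ofReal q) volume)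
    (hfu : IsPsi p u t f) (hgu : IsPsi p u t g) : f =ᵐ[volume] g := by
  have h1 : (1 : ℝ≥0∞) ≤ ENNReal.ofReal q := by simpa using hq.le
  refine ae_eq_of_integral_contDiff_smul_eq (hf.locallyIntegrable h1) (hg.locallyIntegrable h1)
    fun ρ hρ hρc => ?_
  have hs : HasCompactSupport fun x : ℝ => (ρ x : ℂ) := hρc.comp_left (g := fun y : ℝ => (y : ℂ)) rfl
  have hc : ContDiff ℝ ((⊤ : ℕ∞) : WithTop ℕ∞) fun x : ℝ => (ρ x : ℂ) := Complex.ofRealCLM.contDiff.comp hρ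
  have h2 := hfu (hs.toSchwartzMap hc)
  have h3 := hgu (hs.toSchwartzMap hc)
  have h4 := h2.trans h3.symm
  simpa [mul_comm, Complex.real_smul] using h4

theorem psiNorm_le {p q : ℝ} {u : L2} {t : ℝ} {f : ℝ → ℂ}
    (hf : MemLp f (ENNReal.ofReal q) volume) (hfu : IsPsi p u t f) :
    psiNorm p q u t ≤ eLpNorm f (ENNReal.ofReal q) volume :=
  iInf_le_of_le f (iInf_le_of_le hf (iInf_le _ hfu))

theorem psiNorm_eq {p q : ℝ} (hq : 1 < q) {u : L2} {t : ℝ} {f : ℝ → ℂ}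
    (hf : MemLp f (ENNReal.ofReal q) volume) (hfu : IsPsi p u t f) :
    psiNorm p q u t = eLpNorm f (ENNReal.ofReal q) volume :=
  le_antisymm (psiNorm_le hf hfu) (le_iInf fun _ => le_iInf fun hg => le_iInf fun hgu =>
    (eLpNorm_congr_ae (hfu.ae_eq hq hf hg hgu)).le)

theorem exists_isPsi {p q : ℝ} (hq : 1 < q) {u : L2} {t : ℝ} (h : psiNorm p q u t ≠ ∞) :
    ∃ f : ℝ → ℂ, MemLp f (ENNReal.ofReal q) volume ∧ IsPsi p u t f ∧
      psiNorm p q u t = eLpNorm f (ENNReal.ofReal q) volume := by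
  by_contra! hne
  refine h (iInf_eq_top.2 fun f => iInf_eq_top.2 fun hf => iInf_eq_top.2 fun hfu => ?_)
  exact absurd (psiNorm_eq hq hf hfu) (hne f hf hfu)

theorem psiNorm_add_le {p q : ℝ} (hp : 1 < p) (hq : 1 < q) (u v : L2) (t : ℝ) :
    psiNorm p q (u + v) t ≤ psiNorm p q u t + psiNorm p q v t := by
  by_cases hu : psiNorm p q u t = ∞
  · simp [hu]
  by_cases hv : psiNorm p q v t = ∞
  · simp [hv]
  obtain ⟨f, hf, hfu, hfn⟩ := exists_isPsi hq hu
  obtain ⟨g, hg, hgv, hgn⟩ := exists_isPsi hq hv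
  rw [hfn, hgn]
  exact (psiNorm_le (hf.add hg) (hfu.add hp hq hf hg hgv)).trans
    (eLpNorm_add_le hf.1 hg.1 (by simpa using hq.le))

theorem psiNorm_zero {p q : ℝ} (t : ℝ) : psiNorm p q 0 t = 0 := by
  refine le_antisymm ((psiNorm_le (f := fun _ => 0) MemLp.zero' fun φ => ?_).trans
    eLpNorm_zero'.le) zero_le
  have := psi_smul p 0 0 t φ
  simp only [zero_smul, zero_mul] at this
  simp [this]

theorem psiNorm_smul_le {p q : ℝ} (hq : 1 < q) (c : ℂ) (u : L2) (t : ℝ) :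
    psiNorm p q (c • u) t ≤ ‖c‖ₑ * psiNorm p q u t := by
  by_cases hc : c = 0
  · simp [hc, psiNorm_zero]
  by_cases hu : psiNorm p q u t = ∞
  · simp [hu, hc]
  obtain ⟨f, hf, hfu, hfn⟩ := exists_isPsi hq hu
  rw [hfn, ← eLpNorm_const_smul]
  exact psiNorm_le (hf.const_mul c) (hfu.smul c)

theorem psiNorm_smul {p q : ℝ} (hq : 1 < q) (c : ℂ) (u : L2) (t : ℝ) :
    psiNorm p q (c • u) t = ‖c‖ₑ * psiNorm p q u t := by
  by_cases hc : c = 0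
  · simp [hc, psiNorm_zero]
  refine le_antisymm (psiNorm_smul_le hq c u t) ?_
  have h := psiNorm_smul_le (p := p) hq c⁻¹ (c • u) t
  rw [inv_smul_smul₀ hc, enorm_inv hc] at h
  have hc0 : ‖c‖ₑ ≠ 0 := by simpa using hc
  calc ‖c‖ₑ * psiNorm p q u t ≤ ‖c‖ₑ * (‖c‖ₑ⁻¹ * psiNorm p q (c • u) t) := by gcongr
    _ = psiNorm p q (c • u) t := by
      rw [← mul_assoc, ENNReal.mul_inv_cancel hc0 enorm_ne_top, one_mul]

/-! ### Lower semicontinuity in time -/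

/-- The weight `1 + x²`. -/
def polyWeight (x : ℝ) : ℝ := 1 + x ^ 2

theorem polyWeight_pos (x : ℝ) : 0 < polyWeight x := by unfold polyWeight; positivity

theorem memLp_inv_polyWeight {r : ℝ} (hr : 1 ≤ r) :
    MemLp (fun x : ℝ => (((polyWeight x)⁻¹ : ℝ) : ℂ)) (ENNReal.ofReal r) volume := by
  have hc : Continuous fun x : ℝ => (polyWeight x)⁻¹ := by
    unfold polyWeight
    exact Continuous.inv₀ (by fun_prop) fun x => by positivity
  have hm : AEStronglyMeasurable (fun x : ℝ => (((polyWeight x)⁻¹ : ℝ) : ℂ)) volume :=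
    (Complex.continuous_ofReal.comp hc).aestronglyMeasurable
  rw [← integrable_norm_rpow_iff hm (by simpa using by linarith) ENNReal.ofReal_ne_top]
  rw [ENNReal.toReal_ofReal (by linarith)]
  refine integrable_inv_one_add_sq.mono' (hm.norm.aemeasurable.pow_const r).aestronglyMeasurable
    (Eventually.of_forall fun x => ?_)
  have h0 := polyWeight_pos x
  have h1 : (polyWeight x)⁻¹ ≤ 1 := inv_le_one_of_one_le₀ (by unfold polyWeight; nlinarith [sq_nonneg x])
  have h2 : 0 < (polyWeight x)⁻¹ := inv_pos.2 h0
  rw [Complex.norm_real, Real.norm_of_nonneg h2.le, Real.norm_of_nonneg (by positivity)]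
  calc (polyWeight x)⁻¹ ^ r ≤ (polyWeight x)⁻¹ ^ (1 : ℝ) :=
        Real.rpow_le_rpow_of_exponent_ge h2 h1 hr
    _ = (1 + x ^ 2)⁻¹ := Real.rpow_one _

theorem exists_holderTriple_two {q : ℝ} (hq : 2 < q) :
    ∃ r : ℝ, 1 ≤ r ∧ ENNReal.HolderTriple (ENNReal.ofReal r) (ENNReal.ofReal q) 2 := by
  have h : (2 * q / (q - 2)).HolderTriple q 2 := by
    refine ⟨?_, by have := sub_pos.2 hq; positivity, by linarith⟩
    have := sub_pos.2 hq
    field_simp; ring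
  refine ⟨_, ?_, by simpa using h.ennrealOfReal⟩
  rw [le_div_iff₀ (by linarith)]; linarith

/-- The weight moves `L^q` functions into `L²` by Hölder, so that Hilbert space weak compactness can
replace that of `L^q`. -/
theorem exists_memLp_two_bound {q : ℝ} (hq : 2 < q) :
    ∃ C : ℝ≥0∞, C ≠ ∞ ∧ ∀ f : ℝ → ℂ, MemLp f (ENNReal.ofReal q) volume →
      MemLp (fun x => (((polyWeight x)⁻¹ : ℝ) : ℂ) * f x) 2 volume ∧
      eLpNorm (fun x => (((polyWeight x)⁻¹ : ℝ) : ℂ) * f x) 2 volume ≤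
        C * eLpNorm f (ENNReal.ofReal q) volume := by
  obtain ⟨r, hr, hrq⟩ := exists_holderTriple_two hq
  have hw := memLp_inv_polyWeight hr
  refine ⟨_, hw.eLpNorm_ne_top, fun f hf => ⟨hf.mul' hw, ?_⟩⟩
  have := eLpNorm_smul_le_mul_eLpNorm (p := ENNReal.ofReal r) (q := ENNReal.ofReal q) (r := 2)
    hf.1 hw.1
  exact this

/-- The `L²` functions `g` with `‖(1 + x²) g‖_q ≤ c`. -/
def weightedBall (q : ℝ) (c : ℝ≥0∞) : Set L2 :=
  {g | eLpNorm (fun x => (polyWeight x : ℂ) * g x) (ENNReal.ofReal q) volume ≤ c}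

theorem aestronglyMeasurable_polyWeight_mul (g : L2) :
    AEStronglyMeasurable (fun x => (polyWeight x : ℂ) * g x) volume := by
  have : Continuous fun x : ℝ => (polyWeight x : ℂ) := by unfold polyWeight; fun_prop
  exact this.aestronglyMeasurable.mul (Lp.aestronglyMeasurable g)

theorem convex_weightedBall {q : ℝ} (hq : 1 < q) (c : ℝ≥0∞) : Convex ℝ (weightedBall q c) := by
  intro f hf g hg a b ha hb hab
  have h1 : (fun x => (polyWeight x : ℂ) * (a • f + b • g : L2) x) =ᵐ[volume]
      a • (fun x => (polyWeight x : ℂ) * f x) + b • fun x => (polyWeight x : ℂ) * g x := by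
    filter_upwards [Lp.coeFn_add (a • f) (b • g), Lp.coeFn_smul a f, Lp.coeFn_smul b g] with x h1 h2 h3
    rw [h1, Pi.add_apply, h2, h3]
    simp [Complex.real_smul]; ring
  simp only [weightedBall, Set.mem_ofPred_eq] at *
  rw [eLpNorm_congr_ae h1]
  refine (eLpNorm_add_le ((aestronglyMeasurable_polyWeight_mul f).const_smul a)
    ((aestronglyMeasurable_polyWeight_mul g).const_smul b) (by simpa using hq.le)).trans ?_
  rw [eLpNorm_const_smul, eLpNorm_const_smul]
  calc _ ≤ ‖a‖ₑ * c + ‖b‖ₑ * c := by gcongr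
    _ = c := by
      rw [← add_mul, Real.enorm_of_nonneg ha, Real.enorm_of_nonneg hb, ← ENNReal.ofReal_add ha hb,
        hab, ENNReal.ofReal_one, one_mul]

theorem isClosed_weightedBall {q : ℝ} (c : ℝ≥0∞) : IsClosed (weightedBall q c) := by
  refine IsSeqClosed.isClosed fun g a hg ha => ?_
  obtain ⟨φ, -, hφ⟩ := (tendstoInMeasure_of_tendsto_Lp ha).exists_seq_tendsto_ae
  refine (Lp.eLpNorm_lim_le_liminf_eLpNorm (f := fun n x => (polyWeight x : ℂ) * g (φ n) x)
    (fun n => aestronglyMeasurable_polyWeight_mul _) _ ?_).trans ?_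
  · filter_upwards [hφ] with x hx using hx.const_mul _
  · exact liminf_le_of_frequently_le' (Frequently.of_forall fun n => hg (φ n))

theorem integral_polyWeight {f : ℝ → ℂ} {g : L2} (φ : 𝓢(ℝ, ℂ)) (ψ : 𝓢(ℝ, ℂ))
    (hψ : ∀ x, ψ x = starRingEnd ℂ ((polyWeight x : ℂ) * φ x))
    (hfg : g =ᵐ[volume] fun x => (((polyWeight x)⁻¹ : ℝ) : ℂ) * f x) :
    ∫ x, f x * φ x = inner ℂ (ψ.toLp 2 volume) g := by
  rw [L2.inner_def]
  refine integral_congr_ae ?_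
  filter_upwards [hfg, ψ.coeFn_toLp 2 volume] with x h1 h2
  have : (polyWeight x : ℂ) ≠ 0 := by exact_mod_cast (polyWeight_pos x).ne'
  rw [h1, h2, hψ, RCLike.inner_apply, Complex.conj_conj]
  push_cast
  field_simp

theorem exists_weighted_conj (φ : 𝓢(ℝ, ℂ)) :
    ∃ ψ : 𝓢(ℝ, ℂ), ∀ x, ψ x = starRingEnd ℂ ((polyWeight x : ℂ) * φ x) := by
  have hg : (fun x : ℝ => (polyWeight x : ℂ)).HasTemperateGrowth := by
    unfold polyWeight; push_cast; fun_prop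
  refine ⟨SchwartzMap.postcompCLM (𝕜 := ℝ) (Complex.conjCLE : ℂ →L[ℝ] ℂ)
    (SchwartzMap.smulLeftCLM ℂ (fun x : ℝ => (polyWeight x : ℂ)) φ), fun x => ?_⟩
  simp [SchwartzMap.smulLeftCLM_apply hg]

instance separableSpace_L2 : TopologicalSpace.SeparableSpace L2 := by
  have : Fact ((2 : ℝ≥0∞) ≠ ∞) := ⟨by norm_num⟩
  infer_instance

/-- Supplies the measurability in time needed to handle `energy`. Along times `τ n → t` with bounded
norms, the weighted representatives have a weak limit in `L²`. It stays in the weakly closed ball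
`weightedBall`, and it represents `Ψ_p[u](t, ·)` because `psi` is continuous in time. -/
theorem lowerSemicontinuous_psiNorm {p q : ℝ} (hp : 1 < p) (hq : 2 < q) (u : L2) :
    LowerSemicontinuous (psiNorm p q u) := by
  have hq1 : 1 < q := by linarith
  rw [lowerSemicontinuous_iff_isClosed_preimage]
  intro c
  by_cases hc : c = ∞
  · simp [hc]
  refine IsSeqClosed.isClosed fun τ t hτ ht => ?_
  simp only [Set.mem_preimage, Set.mem_Iic] at hτ ⊢
  choose f hf hfu hfn using fun n => exists_isPsi hq1 (ne_top_of_le_ne_top hc (hτ n))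
  obtain ⟨C, hC, hCf⟩ := exists_memLp_two_bound hq
  have hg := fun n => (hCf (f n) (hf n)).1
  set g : ℕ → L2 := fun n => (hg n).toLp _ with hgdef
  have hgae : ∀ n, g n =ᵐ[volume] fun x => (((polyWeight x)⁻¹ : ℝ) : ℂ) * f n x :=
    fun n => (hg n).coeFn_toLp
  have hgb : ∀ n, ‖g n‖ ≤ (C * c).toReal := fun n => by
    rw [hgdef, Lp.norm_toLp]
    refine ENNReal.toReal_mono (ENNReal.mul_ne_top hC hc) ((hCf (f n) (hf n)).2.trans ?_)
    gcongr
    exact (hfn n).symm.le.trans (hτ n)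
  obtain ⟨a, σ, hσ, ha⟩ := exists_subseq_tendsto_inner hgb
  have hmem : ∀ n, g n ∈ weightedBall q c := fun n => by
    have : (fun x => (polyWeight x : ℂ) * g n x) =ᵐ[volume] f n := by
      filter_upwards [hgae n] with x hx
      have : (polyWeight x : ℂ) ≠ 0 := by exact_mod_cast (polyWeight_pos x).ne'
      rw [hx]; push_cast; field_simp
    rw [weightedBall, Set.mem_ofPred_eq, eLpNorm_congr_ae this, ← hfn n]
    exact hτ n
  have haB := mem_of_tendsto_inner (convex_weightedBall hq1 c) (isClosed_weightedBall c)
    (fun n => hmem (σ n)) ha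
  refine (psiNorm_le (f := fun x => (polyWeight x : ℂ) * a x)
    ⟨aestronglyMeasurable_polyWeight_mul a, lt_of_le_of_lt haB (lt_top_iff_ne_top.2 hc)⟩
    fun φ => ?_).trans haB
  obtain ⟨ψ, hψ⟩ := exists_weighted_conj φ
  rw [integral_polyWeight (g := a) φ ψ hψ (Eventually.of_forall fun x => ?_)]
  · refine tendsto_nhds_unique (ha (ψ.toLp 2 volume)) ?_
    have h1 := ((continuous_psi hp u φ).tendsto t).comp (ht.comp hσ.tendsto_atTop)
    refine h1.congr fun n => ?_
    rw [← integral_polyWeight φ ψ hψ (hgae (σ n))]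
    exact (hfu _ φ).symm
  · have : (polyWeight x : ℂ) ≠ 0 := by exact_mod_cast (polyWeight_pos x).ne'
    push_cast; field_simp

theorem measurable_psiNorm {p q : ℝ} (hp : 1 < p) (hq : 2 < q) (u : L2) :
    Measurable (psiNorm p q u) := (lowerSemicontinuous_psiNorm hp hq u).measurable

/-! ### The energy -/

theorem energy_smul {p q : ℝ} (hp : 1 < p) (hq : 2 < q) (c : ℂ) (u : L2) :
    energy p q (c • u) = ‖c‖ₑ ^ p * energy p q u := by
  unfold energy
  simp only [psiNorm_smul (by linarith : 1 < q), ENNReal.mul_rpow_of_nonneg _ _ (by linarith : 0 ≤ p)]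
  exact lintegral_const_mul _ ((measurable_psiNorm hp hq u).pow_const p)

theorem energy_add_le {p q : ℝ} (hp : 1 < p) (hq : 2 < q) (u v : L2) :
    energy p q (u + v) ^ (1 / p) ≤ energy p q u ^ (1 / p) + energy p q v ^ (1 / p) := by
  refine le_trans ?_ (ENNReal.lintegral_Lp_add_le (μ := volume) (measurable_psiNorm hp hq u).aemeasurable
    (measurable_psiNorm hp hq v).aemeasurable hp.le)
  unfold energy
  gcongr with t
  exact psiNorm_add_le hp (by linarith) u v t

theorem energy_le {p q : ℝ} (hp : 0 < p) (u : L2) :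
    energy p q u ≤ bestConst p q * ‖u‖ₑ ^ p := by
  by_cases hu : u = 0
  · simp [hu, energy, psiNorm_zero, hp]
  · have h : energy p q u / ‖u‖ₑ ^ p ≤ bestConst p q := le_iSup₂_of_le u hu le_rfl
    have h0 : ‖u‖ₑ ^ p ≠ 0 := by
      simp [ENNReal.rpow_eq_zero_iff, hu, hp]
    rwa [ENNReal.div_le_iff h0 (ENNReal.rpow_ne_top_of_nonneg hp.le enorm_ne_top)] at h

/-! ### Affine changes of variables -/

theorem measurableEmbedding_affine (x₀ : ℝ) {l : ℝ} (hl : 0 < l) :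
    MeasurableEmbedding fun x : ℝ => l * x + x₀ :=
  (affineHomeomorph l x₀ hl.ne').measurableEmbedding

theorem map_affine_volume (x₀ : ℝ) {l : ℝ} (hl : 0 < l) :
    Measure.map (fun x : ℝ => l * x + x₀) volume = ENNReal.ofReal l⁻¹ • volume := by
  have h := Real.map_volume_mul_left hl.ne'
  rw [abs_of_pos (inv_pos.2 hl)] at h
  have h2 : (fun x : ℝ => l * x + x₀) = (fun x => x + x₀) ∘ fun x => l * x := rfl
  rw [h2, ← Measure.map_map (measurable_add_const x₀) (measurable_const_mul l), h,
    Measure.map_smul, (measurePreserving_add_right volume x₀).map_eq]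

theorem quasiMeasurePreserving_affine (x₀ : ℝ) {l : ℝ} (hl : 0 < l) :
    Measure.QuasiMeasurePreserving (fun x : ℝ => l * x + x₀) volume volume :=
  ⟨(measurableEmbedding_affine x₀ hl).measurable, by
    rw [map_affine_volume x₀ hl]; exact Measure.smul_absolutelyContinuous⟩

theorem ae_comp_div {P : ℝ → Prop} {l : ℝ} (hl : 0 < l) (h : ∀ᵐ ξ : ℝ, P ξ) :
    ∀ᵐ ξ : ℝ, P (ξ / l) := by
  have := (quasiMeasurePreserving_affine 0 (inv_pos.2 hl)).ae h
  filter_upwards [this] with ξ hξ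
  simpa [div_eq_inv_mul] using hξ

theorem lintegral_comp_affine (x₀ : ℝ) {l : ℝ} (hl : 0 < l) (f : ℝ → ℝ≥0∞) :
    ∫⁻ x, f (l * x + x₀) = ENNReal.ofReal l⁻¹ * ∫⁻ x, f x := by
  rw [← (measurableEmbedding_affine x₀ hl).lintegral_map, map_affine_volume x₀ hl,
    lintegral_smul_measure, smul_eq_mul]

theorem integral_comp_affine (x₀ : ℝ) {l : ℝ} (hl : 0 < l) (f : ℝ → ℂ) :
    ∫ x, f (l * x + x₀) = (l⁻¹ : ℝ) * ∫ x, f x := by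
  rw [← (measurableEmbedding_affine x₀ hl).integral_map, map_affine_volume x₀ hl,
    integral_smul_measure, ENNReal.toReal_ofReal (inv_pos.2 hl).le, Complex.real_smul]

theorem eLpNorm_comp_affine (x₀ : ℝ) {l : ℝ} (hl : 0 < l) {q : ℝ} (hq : 0 < q) (f : ℝ → ℂ) :
    eLpNorm (fun x => f (l * x + x₀)) (ENNReal.ofReal q) volume =
      ENNReal.ofReal l⁻¹ ^ (1 / q) * eLpNorm f (ENNReal.ofReal q) volume := by
  have h := (measurableEmbedding_affine x₀ hl).eLpNorm_map_measure (g := f) (p := ENNReal.ofReal q) (μ := volume)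
  rw [map_affine_volume x₀ hl, eLpNorm_smul_measure_of_ne_top ENNReal.ofReal_ne_top] at h
  rw [show (fun x => f (l * x + x₀)) = f ∘ fun x => l * x + x₀ from rfl, ← h, smul_eq_mul]
  congr 2
  rw [ENNReal.toReal_div, ENNReal.toReal_ofReal hq.le, ENNReal.toReal_one]

theorem memLp_comp_affine_of_memLp (x₀ : ℝ) {l : ℝ} (hl : 0 < l) {q : ℝ} (hq : 0 < q) {f : ℝ → ℂ}
    (hf : MemLp f (ENNReal.ofReal q) volume) :
    MemLp (fun x => f (l * x + x₀)) (ENNReal.ofReal q) volume := by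
  refine ⟨hf.1.comp_quasiMeasurePreserving (quasiMeasurePreserving_affine x₀ hl), ?_⟩
  rw [eLpNorm_comp_affine x₀ hl hq]
  exact ENNReal.mul_lt_top (ENNReal.rpow_lt_top_of_nonneg (by positivity) ENNReal.ofReal_ne_top) hf.2

/-- The Schwartz function `y ↦ l⁻¹ φ((y - x₀)/l)`. -/
def affineSchwartz (x₀ : ℝ) {l : ℝ} (hl : 0 < l) (φ : 𝓢(ℝ, ℂ)) : 𝓢(ℝ, ℂ) :=
  ((l⁻¹ : ℝ) : ℂ) • SchwartzMap.compCLMOfAntilipschitz ℂ (K := l.toNNReal)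
    (g := fun y : ℝ => l⁻¹ * (y - x₀)) (by fun_prop)
    (by
      refine AntilipschitzWith.of_le_mul_dist fun x y => le_of_eq ?_
      rw [Real.coe_toNNReal _ hl.le, Real.dist_eq, Real.dist_eq,
        show l⁻¹ * (x - x₀) - l⁻¹ * (y - x₀) = l⁻¹ * (x - y) by ring, abs_mul,
        abs_of_pos (inv_pos.2 hl), mul_inv_cancel_left₀ hl.ne']) φ

theorem affineSchwartz_apply (x₀ : ℝ) {l : ℝ} (hl : 0 < l) (φ : 𝓢(ℝ, ℂ)) (y : ℝ) :
    affineSchwartz x₀ hl φ y = ((l⁻¹ : ℝ) : ℂ) * φ (l⁻¹ * (y - x₀)) := rfl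

theorem integral_affineSchwartz_mul (x₀ : ℝ) {l : ℝ} (hl : 0 < l) (φ : 𝓢(ℝ, ℂ)) (f : ℝ → ℂ) :
    ∫ y, f y * affineSchwartz x₀ hl φ y = ∫ x, f (l * x + x₀) * φ x := by
  have h := integral_comp_affine x₀ hl (fun y => f y * φ (l⁻¹ * (y - x₀)))
  have h2 : ∀ x, l⁻¹ * (l * x + x₀ - x₀) = x := fun x => by field_simp; ring
  simp only [h2] at h
  rw [h, ← integral_const_mul]
  congr 1; ext y
  rw [affineSchwartz_apply]; ring

theorem fourierInv_affineSchwartz (x₀ : ℝ) {l : ℝ} (hl : 0 < l) (φ : 𝓢(ℝ, ℂ)) (η : ℝ) :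
    (𝓕⁻ (affineSchwartz x₀ hl φ) : 𝓢(ℝ, ℂ)) η =
      Complex.exp ((2 * Real.pi * x₀ * η : ℝ) * Complex.I) * (𝓕⁻ φ : 𝓢(ℝ, ℂ)) (l * η) := by
  rw [SchwartzMap.fourierInv_coe, SchwartzMap.fourierInv_coe, Real.fourierInv_eq',
    Real.fourierInv_eq']
  simp only [smul_eq_mul]
  rw [integral_affineSchwartz_mul, ← integral_const_mul]
  congr 1; ext x
  rw [← mul_assoc, ← Complex.exp_add]
  congr 2
  simp only [RCLike.inner_apply, conj_trivial]
  push_cast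
  ring

theorem integral_fourier_mul (v : L2) (φ : 𝓢(ℝ, ℂ)) :
    ∫ ξ, (𝓕 v : L2) ξ * φ ξ = ∫ x, v x * (𝓕 φ : 𝓢(ℝ, ℂ)) x := by
  have h := congrArg (fun T => T φ) (Lp.fourier_toTemperedDistribution_eq v)
  simp only [TemperedDistribution.fourier_apply, Lp.toTemperedDistribution_apply, smul_eq_mul] at h
  simp only [mul_comm _ (φ _), mul_comm _ ((𝓕 φ : 𝓢(ℝ, ℂ)) _)]
  exact h.symm

theorem ae_eq_of_integral_schwartz {f g : ℝ → ℂ} (hf : MemLp f 2 volume) (hg : MemLp g 2 volume)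
    (h : ∀ φ : 𝓢(ℝ, ℂ), ∫ x, f x * φ x = ∫ x, g x * φ x) : f =ᵐ[volume] g := by
  refine ae_eq_of_integral_contDiff_smul_eq (hf.locallyIntegrable (by norm_num))
    (hg.locallyIntegrable (by norm_num)) fun ρ hρ hρc => ?_
  have hs : HasCompactSupport fun x : ℝ => (ρ x : ℂ) := hρc.comp_left (g := fun y : ℝ => (y : ℂ)) rfl
  have hc : ContDiff ℝ ((⊤ : ℕ∞) : WithTop ℕ∞) fun x : ℝ => (ρ x : ℂ) :=
    Complex.ofRealCLM.contDiff.comp hρ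
  have h2 := h (hs.toSchwartzMap hc)
  simpa [mul_comm, Complex.real_smul] using h2

/-! ### The symmetries on the Fourier side -/

/-- The affine part `v ↦ l^{1/2} v(l x + x₀)` of a symmetry. -/
def affineAct (x₀ : ℝ) {l : ℝ} (hl : 0 < l) (v : L2) : L2 :=
  (memLp_comp_affine x₀ hl v).toLp (fun x : ℝ => ((l ^ (1 / 2 : ℝ) : ℝ) : ℂ) * v (l * x + x₀))

theorem symm_eq (t₀ x₀ : ℝ) {l : ℝ} (hl : 0 < l) (u : L2) :
    symm t₀ x₀ hl u = affineAct x₀ hl (airyFlow t₀ u) := rfl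

theorem fourier_airyFlow (t : ℝ) (u : L2) :
    (𝓕 (airyFlow t u) : L2) =ᵐ[volume] fun ξ => airySymbol t ξ * (𝓕 u : L2) ξ := by
  unfold airyFlow
  rw [FourierTransform.fourier_fourierInv_eq]
  exact MemLp.coeFn_toLp _

/-- The unimodular factor of a symmetry on the Fourier side. -/
def phase (t₀ x₀ ξ : ℝ) : ℂ := Complex.exp ((2 * Real.pi * x₀ * ξ : ℝ) * Complex.I) * airySymbol t₀ ξ

theorem norm_phase (t₀ x₀ ξ : ℝ) : ‖phase t₀ x₀ ξ‖ = 1 := by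
  rw [phase, norm_mul, norm_airySymbol, Complex.norm_exp_ofReal_mul_I, one_mul]

theorem phase_zero (ξ : ℝ) : phase 0 0 ξ = 1 := by simp [phase, airySymbol]

/-- The cocycle identity behind the group law of `G`: dilation by `l` scales times by `l ^ 3` and
translations by `l`. -/
theorem phase_mul (t₀ x₀ t₁ x₁ ξ : ℝ) {l : ℝ} (hl : 0 < l) :
    phase t₀ x₀ ξ * phase t₁ x₁ (ξ / l) = phase (t₀ * l ^ 3 + t₁) (x₀ * l + x₁) (ξ / l) := by
  unfold phase airySymbol
  rw [← Complex.exp_add, ← Complex.exp_add, ← Complex.exp_add, ← Complex.exp_add]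
  congr 1
  simp only [← add_mul]
  congr 1
  norm_cast
  field_simp
  ring

/-- Proved by duality: the affine map and the Fourier transform are both moved onto a Schwartz test
function, where they are explicit. -/
theorem fourier_affineAct (x₀ : ℝ) {l : ℝ} (hl : 0 < l) (v : L2) :
    (𝓕 (affineAct x₀ hl v) : L2) =ᵐ[volume] fun ξ =>
      ((l ^ (-1 / 2 : ℝ) : ℝ) : ℂ) * Complex.exp ((2 * Real.pi * x₀ * (ξ / l) : ℝ) * Complex.I) *
        (𝓕 v : L2) (ξ / l) := by
  have hl' := inv_pos.2 hl
  have hR : MemLp (fun ξ : ℝ => (𝓕 v : L2) (ξ / l)) 2 volume := by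
    have := memLp_comp_affine_of_memLp 0 hl' two_pos (f := (𝓕 v : L2)) (by simpa using Lp.memLp (𝓕 v : L2))
    simpa [div_eq_inv_mul] using this
  have hE : Continuous fun ξ : ℝ => Complex.exp ((2 * Real.pi * x₀ * (ξ / l) : ℝ) * Complex.I) := by
    fun_prop
  have hR2 : MemLp (fun ξ : ℝ => ((l ^ (-1 / 2 : ℝ) : ℝ) : ℂ) *
      Complex.exp ((2 * Real.pi * x₀ * (ξ / l) : ℝ) * Complex.I) * (𝓕 v : L2) (ξ / l)) 2 volume := by
    have h1 : MemLp (fun ξ : ℝ => Complex.exp ((2 * Real.pi * x₀ * (ξ / l) : ℝ) * Complex.I) * (𝓕 v : L2) (ξ / l)) 2 volume := by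
      refine hR.of_le (hE.aestronglyMeasurable.mul hR.1) (Eventually.of_forall fun ξ => ?_)
      rw [norm_mul, Complex.norm_exp_ofReal_mul_I, one_mul]
    simpa only [mul_assoc] using h1.const_mul ((l ^ (-1 / 2 : ℝ) : ℝ) : ℂ)
  refine ae_eq_of_integral_schwartz (Lp.memLp _) hR2 fun φ => ?_
  set χ := affineSchwartz x₀ hl (𝓕 φ : 𝓢(ℝ, ℂ)) with hχ
  have h1 : ∫ ξ, (𝓕 (affineAct x₀ hl v) : L2) ξ * φ ξ =
      ((l ^ (1 / 2 : ℝ) : ℝ) : ℂ) * ∫ y, v y * χ y := by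
    rw [integral_fourier_mul, hχ, integral_affineSchwartz_mul, ← integral_const_mul]
    refine integral_congr_ae ?_
    filter_upwards [(memLp_comp_affine x₀ hl v).coeFn_toLp] with x hx
    rw [affineAct, hx, mul_assoc]
  have h2 : ∫ y, v y * χ y = ∫ η, (𝓕 v : L2) η * (𝓕⁻ χ : 𝓢(ℝ, ℂ)) η := by
    rw [integral_fourier_mul, FourierTransform.fourier_fourierInv_eq]
  have h3 := integral_comp_affine 0 hl' (fun η => (𝓕 v : L2) η * (𝓕⁻ χ : 𝓢(ℝ, ℂ)) η)
  rw [h1, h2]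
  have h4 : ((l ^ (1 / 2 : ℝ) : ℝ) : ℂ) = ((l ^ (-1 / 2 : ℝ) : ℝ) : ℂ) * ((l⁻¹⁻¹ : ℝ) : ℂ) := by
    rw [inv_inv, ← Complex.ofReal_mul]
    congr 1
    nth_rw 3 [← Real.rpow_one l]
    rw [← Real.rpow_add hl]; congr 1; norm_num
  rw [h4, mul_assoc, ← h3, ← integral_const_mul]
  congr 1; ext ξ
  have h5 : l⁻¹ * ξ + 0 = ξ / l := by rw [add_zero, div_eq_inv_mul]
  rw [h5, hχ, fourierInv_affineSchwartz, FourierTransform.fourierInv_fourier_eq,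
    mul_div_cancel₀ _ hl.ne']
  ring

theorem fourier_symm (t₀ x₀ : ℝ) {l : ℝ} (hl : 0 < l) (u : L2) :
    (𝓕 (symm t₀ x₀ hl u) : L2) =ᵐ[volume] fun ξ =>
      ((l ^ (-1 / 2 : ℝ) : ℝ) : ℂ) * (phase t₀ x₀ (ξ / l) * (𝓕 u : L2) (ξ / l)) := by
  rw [symm_eq]
  filter_upwards [fourier_affineAct x₀ hl (airyFlow t₀ u),
    ae_comp_div hl (fourier_airyFlow t₀ u)] with ξ h1 h2
  rw [h1, h2, phase]; ring

theorem L2_ext_fourier {u v : L2} (h : (𝓕 u : L2) =ᵐ[volume] (𝓕 v : L2)) : u = v := by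
  have := Lp.ext h
  rw [← FourierTransform.fourierInv_fourier_eq (F := L2) u, this,
    FourierTransform.fourierInv_fourier_eq]

theorem symm_add (t₀ x₀ : ℝ) {l : ℝ} (hl : 0 < l) (u v : L2) :
    symm t₀ x₀ hl (u + v) = symm t₀ x₀ hl u + symm t₀ x₀ hl v := by
  refine L2_ext_fourier ?_
  rw [FourierTransform.fourier_add]
  have h := Lp.coeFn_add (𝓕 u : L2) (𝓕 v : L2)
  rw [← FourierTransform.fourier_add] at h
  filter_upwards [fourier_symm t₀ x₀ hl u, fourier_symm t₀ x₀ hl v, fourier_symm t₀ x₀ hl (u + v),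
    ae_comp_div hl h, Lp.coeFn_add (𝓕 (symm t₀ x₀ hl u) : L2) (𝓕 (symm t₀ x₀ hl v) : L2)]
    with ξ h1 h2 h3 h4 h5
  rw [h5, Pi.add_apply, h1, h2, h3, h4, Pi.add_apply]; ring

theorem symm_smul (t₀ x₀ : ℝ) {l : ℝ} (hl : 0 < l) (c : ℂ) (u : L2) :
    symm t₀ x₀ hl (c • u) = c • symm t₀ x₀ hl u := by
  refine L2_ext_fourier ?_
  rw [FourierTransform.fourier_smul]
  have h := Lp.coeFn_smul c (𝓕 u : L2)
  rw [← FourierTransform.fourier_smul] at h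
  filter_upwards [fourier_symm t₀ x₀ hl u, fourier_symm t₀ x₀ hl (c • u),
    ae_comp_div hl h, Lp.coeFn_smul c (𝓕 (symm t₀ x₀ hl u) : L2)]
    with ξ h1 h3 h4 h5
  rw [h5, Pi.smul_apply, h1, h3, h4, Pi.smul_apply, smul_eq_mul, smul_eq_mul]; ring

theorem symm_symm (t₀ x₀ t₁ x₁ : ℝ) {l m : ℝ} (hl : 0 < l) (hm : 0 < m) (u : L2) :
    symm t₀ x₀ hl (symm t₁ x₁ hm u) =
      symm (t₀ * m ^ 3 + t₁) (x₀ * m + x₁) (mul_pos hl hm) u := by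
  refine L2_ext_fourier ?_
  filter_upwards [fourier_symm t₀ x₀ hl (symm t₁ x₁ hm u),
    ae_comp_div hl (fourier_symm t₁ x₁ hm u),
    fourier_symm (t₀ * m ^ 3 + t₁) (x₀ * m + x₁) (mul_pos hl hm) u] with ξ h1 h2 h3
  rw [h1, h2, h3, ← div_div, ← phase_mul _ _ _ _ _ hm, Real.mul_rpow hl.le hm.le]
  push_cast; ring

theorem symm_zero (u : L2) : symm 0 0 one_pos u = u := by
  refine L2_ext_fourier ?_
  filter_upwards [fourier_symm 0 0 one_pos u] with ξ h
  rw [h]; simp [phase_zero]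

theorem enorm_fourier_symm (t₀ x₀ : ℝ) {l : ℝ} (hl : 0 < l) (u : L2) :
    ∀ᵐ ξ, ‖(𝓕 (symm t₀ x₀ hl u) : L2) ξ‖ₑ =
      ENNReal.ofReal (l ^ (-1 / 2 : ℝ)) * ‖(𝓕 u : L2) (ξ / l)‖ₑ := by
  filter_upwards [fourier_symm t₀ x₀ hl u] with ξ h
  rw [h, enorm_mul, enorm_mul, ← ofReal_norm (phase _ _ _), norm_phase, ENNReal.ofReal_one, one_mul,
    ← ofReal_norm, Complex.norm_real, Real.norm_of_nonneg (by positivity)]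

theorem norm_symm (t₀ x₀ : ℝ) {l : ℝ} (hl : 0 < l) (u : L2) : ‖symm t₀ x₀ hl u‖ = ‖u‖ := by
  rw [← Lp.norm_fourier_eq (symm t₀ x₀ hl u), ← Lp.norm_fourier_eq u, Lp.norm_def, Lp.norm_def]
  congr 1
  have h1 : eLpNorm (𝓕 (symm t₀ x₀ hl u) : L2) 2 volume =
      eLpNorm (fun ξ => ((l ^ (-1 / 2 : ℝ) : ℝ) : ℂ) • (𝓕 u : L2) (l⁻¹ * ξ + 0)) 2 volume := by
    refine eLpNorm_congr_enorm_ae ?_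
    filter_upwards [enorm_fourier_symm t₀ x₀ hl u] with ξ h
    rw [h, add_zero, ← div_eq_inv_mul, smul_eq_mul, enorm_mul, ← ofReal_norm (Complex.ofReal _), Complex.norm_real,
      Real.norm_of_nonneg (by positivity)]
  have h2 := eLpNorm_comp_affine 0 (inv_pos.2 hl) two_pos (𝓕 u : L2)
  rw [show ENNReal.ofReal 2 = 2 by simp] at h2
  rw [h1]
  have h3 := eLpNorm_const_smul ((l ^ (-1 / 2 : ℝ) : ℝ) : ℂ) (fun ξ => (𝓕 u : L2) (l⁻¹ * ξ + 0)) 2 volume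
  rw [show (fun ξ => ((l ^ (-1 / 2 : ℝ) : ℝ) : ℂ) • (𝓕 u : L2) (l⁻¹ * ξ + 0)) = ((l ^ (-1 / 2 : ℝ) : ℝ) : ℂ) • (fun ξ => (𝓕 u : L2) (l⁻¹ * ξ + 0)) from rfl, h3, h2, ← mul_assoc, inv_inv, ← ofReal_norm, Complex.norm_real,
    Real.norm_of_nonneg (by positivity), ENNReal.ofReal_rpow_of_pos hl, ← ENNReal.ofReal_mul (by positivity),
    ← Real.rpow_add hl]
  norm_num

theorem isIsometryGroup_G : IsIsometryGroup G where
  dist_eq := by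
    rintro _ ⟨t, x, l, hl, rfl⟩ u v
    have h : symm t x hl u - symm t x hl v = symm t x hl (u - v) := by
      rw [sub_eq_add_neg u v, ← neg_one_smul ℂ v, symm_add, symm_smul, neg_one_smul, sub_eq_add_neg]
    rw [dist_eq_norm, dist_eq_norm, h, norm_symm]
  comp_mem := by
    rintro _ ⟨t, x, l, hl, rfl⟩ _ ⟨s, y, m, hm, rfl⟩
    exact ⟨_, _, _, mul_pos hl hm, funext fun u => symm_symm t x s y hl hm u⟩
  id_mem := ⟨0, 0, 1, one_pos, funext fun u => (symm_zero u).symm⟩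
  exists_inv := by
    rintro _ ⟨t, x, l, hl, rfl⟩
    -- The parameters solve `t₀ * l ^ 3 + t = 0`, `x₀ * l + x = 0` and `l₀ * l = 1` in the
    -- composition law `symm_symm`.
    refine ⟨_, ⟨-t / l ^ 3, -x / l, l⁻¹, inv_pos.2 hl, rfl⟩, fun u => ?_, fun u => ?_⟩
    · rw [symm_symm]
      conv_rhs => rw [← symm_zero u]
      congr 1 <;> field_simp <;> simp
    · rw [symm_symm]
      conv_rhs => rw [← symm_zero u]
      congr 1 <;> field_simp <;> simp

/-! ### Invariance of the energy -/

theorem derivSymbol_mul (p ξ : ℝ) {l : ℝ} (hl : 0 < l) :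
    derivSymbol p (l * ξ) = l ^ (1 / p) * derivSymbol p ξ := by
  unfold derivSymbol
  rw [← Real.mul_rpow hl.le (abs_nonneg _)]
  nth_rw 2 [← abs_of_pos hl]
  rw [← abs_mul]
  congr 2; ring

theorem psiSymbol_mul (p t t₀ ξ : ℝ) {l : ℝ} (hl : 0 < l) :
    psiSymbol p t (l * ξ) * airySymbol t₀ ξ =
      ((l ^ (1 / p) : ℝ) : ℂ) * psiSymbol p (l ^ 3 * t + t₀) ξ := by
  unfold psiSymbol
  rw [derivSymbol_mul p ξ hl]
  have : airySymbol t (l * ξ) * airySymbol t₀ ξ = airySymbol (l ^ 3 * t + t₀) ξ := by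
    unfold airySymbol
    rw [← Complex.exp_add]
    congr 1
    push_cast; ring
  rw [← this]; push_cast; ring

theorem psi_symm (p t₀ x₀ : ℝ) {l : ℝ} (hl : 0 < l) (u : L2) (t : ℝ) (φ : 𝓢(ℝ, ℂ)) :
    psi p (symm t₀ x₀ hl u) t φ =
      ((l ^ (1 / 2 + 1 / p) : ℝ) : ℂ) * psi p u (l ^ 3 * t + t₀) (affineSchwartz x₀ hl φ) := by
  have hl' := inv_pos.2 hl
  rw [psi_eq, psi_eq, Real.rpow_add hl, ← integral_const_mul]
  have h := integral_comp_affine 0 hl' (fun η => ((l ^ (1 / 2 : ℝ) * l ^ (1 / p) : ℝ) : ℂ) *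
    ((𝓕 u : L2) η * (psiSymbol p (l ^ 3 * t + t₀) η * (𝓕⁻ (affineSchwartz x₀ hl φ) : 𝓢(ℝ, ℂ)) η)))
  have h0 : ((l⁻¹ : ℝ) : ℂ) * ((l⁻¹⁻¹ : ℝ) : ℂ) = 1 := by
    norm_cast; field_simp
  rw [← one_mul (∫ x, _ * (_ * (psiSymbol p (l ^ 3 * t + t₀) _ * _))), ← h0, mul_assoc, ← h, ← integral_const_mul]
  refine integral_congr_ae ?_
  filter_upwards [fourier_symm t₀ x₀ hl u] with ξ hξ
  have h5 : l⁻¹ * ξ + 0 = ξ / l := by rw [add_zero, div_eq_inv_mul]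
  have h6 := psiSymbol_mul p t t₀ (ξ / l) hl
  have h7 : ((l ^ (-1 / 2 : ℝ) : ℝ) : ℂ) = ((l⁻¹ : ℝ) : ℂ) * ((l ^ (1 / 2 : ℝ) : ℝ) : ℂ) := by
    rw [← Complex.ofReal_mul]
    congr 1
    rw [← Real.rpow_neg_one, ← Real.rpow_add hl]; congr 1; norm_num
  rw [mul_div_cancel₀ _ hl.ne'] at h6
  rw [hξ, h5, fourierInv_affineSchwartz, mul_div_cancel₀ _ hl.ne', phase, h7]
  push_cast at h6 ⊢
  linear_combination ((l : ℂ)⁻¹ * ((l ^ (1 / 2 : ℝ) : ℝ) : ℂ) *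
    Complex.exp (2 * Real.pi * x₀ * (ξ / l) * Complex.I) * (𝓕 u : L2) (ξ / l) *
    (𝓕⁻ φ : 𝓢(ℝ, ℂ)) ξ) * h6

theorem IsPsi.symm {p t₀ x₀ l : ℝ} (hl : 0 < l) {u : L2} {t : ℝ} {f : ℝ → ℂ}
    (hf : IsPsi p u (l ^ 3 * t + t₀) f) :
    IsPsi p (symm t₀ x₀ hl u) t (fun x => ((l ^ (1 / 2 + 1 / p) : ℝ) : ℂ) * f (l * x + x₀)) :=
  fun φ => by
    rw [psi_symm, ← hf, integral_affineSchwartz_mul, ← integral_const_mul]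
    simp only [mul_assoc]

theorem psiNorm_symm_le {p q : ℝ} (hq : 1 < q) (t₀ x₀ : ℝ) {l : ℝ} (hl : 0 < l) (u : L2) (t : ℝ) :
    psiNorm p q (symm t₀ x₀ hl u) t ≤
      ENNReal.ofReal (l ^ (1 / 2 + 1 / p - 1 / q)) * psiNorm p q u (l ^ 3 * t + t₀) := by
  by_cases hu : psiNorm p q u (l ^ 3 * t + t₀) = ∞
  · rw [hu, ENNReal.mul_top]
    · exact le_top
    · simpa using by positivity
  obtain ⟨f, hf, hfu, hfn⟩ := exists_isPsi hq hu
  refine (psiNorm_le ((memLp_comp_affine_of_memLp x₀ hl (by linarith) hf).const_mul _)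
    (hfu.symm hl)).trans (le_of_eq ?_)
  have h3 := eLpNorm_const_smul ((l ^ (1 / 2 + 1 / p) : ℝ) : ℂ) (fun x => f (l * x + x₀))
    (ENNReal.ofReal q) volume
  refine h3.trans ?_
  rw [eLpNorm_comp_affine x₀ hl (by linarith), hfn, ← mul_assoc, ← ofReal_norm, Complex.norm_real,
    Real.norm_of_nonneg (by positivity), ENNReal.ofReal_rpow_of_pos (inv_pos.2 hl),
    ← ENNReal.ofReal_mul (by positivity), Real.inv_rpow hl.le, ← Real.rpow_neg hl.le,
    ← Real.rpow_add hl, sub_eq_add_neg]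

/-- Scaling admissibility: by `2/p + 1/q = 1/2`, the factor `l ^ (1/2 + 1/p - 1/q)` raised to the
power `p` is `l ^ 3`, which cancels the Jacobian of `t ↦ l ^ 3 * t + t₀`. The reverse bound follows
from inverses in `G`. -/
theorem energy_symm_le {p q : ℝ} (hp : 1 < p) (hq : 2 < q) (hpq : 2 / p + 1 / q = 1 / 2)
    (t₀ x₀ : ℝ) {l : ℝ} (hl : 0 < l) (u : L2) :
    energy p q (symm t₀ x₀ hl u) ≤ energy p q u := by
  unfold energy
  have hp0 : p ≠ 0 := by linarith
  have h := lintegral_comp_affine t₀ (pow_pos hl 3) (fun t => psiNorm p q u t ^ p)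
  calc ∫⁻ t, psiNorm p q (symm t₀ x₀ hl u) t ^ p
      ≤ ∫⁻ t, ENNReal.ofReal (l ^ (3 : ℝ)) * psiNorm p q u (l ^ 3 * t + t₀) ^ p := by
        refine lintegral_mono fun t => ?_
        refine (ENNReal.rpow_le_rpow (psiNorm_symm_le (by linarith) t₀ x₀ hl u t)
          (by linarith)).trans (le_of_eq ?_)
        rw [ENNReal.mul_rpow_of_nonneg _ _ (by linarith), ENNReal.ofReal_rpow_of_pos (by positivity),
          ← Real.rpow_mul hl.le]
        congr 3
        have : 1 / q = 1 / 2 - 2 / p := by linarith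
        rw [this]; field_simp; ring
    _ = ∫⁻ t, psiNorm p q u t ^ p := by
        rw [lintegral_const_mul' _ _ ENNReal.ofReal_ne_top, h, ← mul_assoc,
          ← ENNReal.ofReal_mul (by positivity)]
        norm_cast
        rw [mul_inv_cancel₀ (by positivity), ENNReal.ofReal_one, one_mul]

theorem energy_of_mem_G {p q : ℝ} (hp : 1 < p) (hq : 2 < q) (hpq : 2 / p + 1 / q = 1 / 2)
    {g : L2 → L2} (hg : g ∈ G) (u : L2) : energy p q (g u) = energy p q u := by
  have key : ∀ h ∈ G, ∀ v, energy p q (h v) ≤ energy p q v := by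
    rintro _ ⟨t, x, l, hl, rfl⟩ v
    exact energy_symm_le hp hq hpq t x hl v
  obtain ⟨h, hh, hinv, -⟩ := isIsometryGroup_G.exists_inv g hg
  refine le_antisymm (key g hg u) ?_
  have := key h hh (g u)
  rwa [hinv] at this

theorem norm_of_mem_G {g : L2 → L2} (hg : g ∈ G) (u : L2) : ‖g u‖ = ‖u‖ := by
  obtain ⟨t, x, l, hl, rfl⟩ := hg
  exact norm_symm t x hl u

theorem add_of_mem_G {g : L2 → L2} (hg : g ∈ G) (u v : L2) : g (u + v) = g u + g v := by
  obtain ⟨t, x, l, hl, rfl⟩ := hg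
  exact symm_add t x hl u v

/-! ### Weak convergence to zero up to symmetries -/

/-- Choosing a worst symmetry for each `n` turns convergence along all sequences in `G` into
convergence uniform over `G`, the form that diagonal arguments need. -/
theorem weakSymmZero_iff {u : ℕ → L2} :
    WeakSymmZero u ↔ ∀ w : L2, ∀ ε > 0, ∀ᶠ n in atTop, ∀ g ∈ G, ‖inner ℂ w (g (u n))‖ < ε := by
  classical
  constructor
  · intro h w ε hε
    by_contra hcon
    have hcon' : ∃ᶠ n in atTop, ∃ g ∈ G, ε ≤ ‖inner ℂ w (g (u n))‖ := by
      refine (Filter.not_eventually.1 hcon).mono fun n hn => ?_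
      simpa using hn
    let g : ℕ → L2 → L2 := fun n =>
      if hn : ∃ g ∈ G, ε ≤ ‖inner ℂ w (g (u n))‖ then hn.choose else fun x => x
    have hg : ∀ n, g n ∈ G := fun n => by
      by_cases hn : ∃ g ∈ G, ε ≤ ‖inner ℂ w (g (u n))‖
      · simp only [g, dif_pos hn]; exact hn.choose_spec.1
      · simp only [g, dif_neg hn]; exact isIsometryGroup_G.id_mem
    have h1 := (h g hg w).norm
    rw [norm_zero] at h1
    obtain ⟨n, hn, hlt⟩ := (hcon'.and_eventually (h1.eventually_lt_const hε)).exists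
    simp only [g, dif_pos hn] at hlt
    exact absurd hlt (not_lt.2 hn.choose_spec.2)
  · intro h g hg w
    rw [tendsto_zero_iff_norm_tendsto_zero, Metric.tendsto_nhds]
    intro ε hε
    filter_upwards [h w ε hε] with n hn
    simpa using hn _ (hg n)

/-- The frequency bump `1_{[n, n+1]}`. -/
def freqBump (n : ℕ) : L2 :=
  𝓕⁻ (indicatorConstLp 2 (measurableSet_Icc (a := (n : ℝ)) (b := n + 1)) (by simp) (1 : ℂ) : L2)

theorem norm_freqBump (n : ℕ) : ‖freqBump n‖ = 1 := by
  rw [← Lp.norm_fourier_eq, freqBump, FourierTransform.fourier_fourierInv_eq, norm_indicatorConstLp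
    (by norm_num) (by norm_num)]
  simp

theorem fourier_freqBump (n : ℕ) :
    (𝓕 (freqBump n) : L2) =ᵐ[volume] (Set.Icc (n : ℝ) (n + 1)).indicator fun _ => (1 : ℂ) := by
  rw [freqBump, FourierTransform.fourier_fourierInv_eq]
  exact indicatorConstLp_coeFn

theorem norm_inner_le_of_ae_eq_zero {v w : L2} {S : Set ℝ} (hS : MeasurableSet S)
    (hv : ∀ᵐ ξ, ξ ∉ S → v ξ = 0) :
    ‖inner ℂ w v‖ ≤ (eLpNorm (S.indicator w) 2 volume).toReal * ‖v‖ := by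
  have hm : MemLp (S.indicator w) 2 volume := (Lp.memLp w).indicator hS
  have h : inner ℂ w v = inner ℂ (hm.toLp _) v := by
    rw [L2.inner_def, L2.inner_def]
    refine integral_congr_ae ?_
    filter_upwards [hv, hm.coeFn_toLp] with ξ h1 h2
    by_cases hξ : ξ ∈ S
    · rw [h2, Set.indicator_of_mem hξ]
    · rw [h1 hξ, inner_zero_right, inner_zero_right]
  rw [h, ← Lp.norm_toLp _ hm]
  exact norm_inner_le_norm _ _

/-- Two ways for a set to miss the mass of `w`: small measure (absolute continuity) or a position
far to the right (approximation by compact support). -/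
theorem exists_small_indicator (w : L2) {ε : ℝ} (hε : 0 < ε) :
    ∃ δ > 0, ∃ K : ℝ, ∀ S : Set ℝ, MeasurableSet S →
      (volume S ≤ ENNReal.ofReal δ ∨ S ⊆ Set.Ici K) →
      eLpNorm (S.indicator w) 2 volume ≤ ENNReal.ofReal ε := by
  obtain ⟨δ, hδ, h1⟩ := (Lp.memLp w).eLpNorm_indicator_le (by norm_num) (by norm_num) hε
  obtain ⟨g, hgc, hg, -, hgm⟩ := (Lp.memLp w).exists_hasCompactSupport_eLpNorm_sub_le
    (by norm_num) (ε := ENNReal.ofReal ε) (by simpa using hε)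
  obtain ⟨K, hK⟩ := hgc.isCompact.bddAbove
  refine ⟨δ, hδ, K + 1, fun S hS hor => ?_⟩
  rcases hor with h | h
  · exact h1 S hS h
  · have : S.indicator (w : ℝ → ℂ) = S.indicator ((w : ℝ → ℂ) - g) := by
      ext ξ
      by_cases hξ : ξ ∈ S
      · have h2 : K + 1 ≤ ξ := h hξ
        have h3 : g ξ = 0 := by
          by_contra hne
          have := hK (subset_tsupport g hne)
          linarith
        simp [Set.indicator_of_mem hξ, h3]
      · simp [Set.indicator_of_notMem hξ]
    rw [this]
    exact (eLpNorm_indicator_le _).trans hg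

/-- A symmetry moves the Fourier support to `[l n, l (n + 1)]`. If `l ≤ δ` this interval is short;
if `l > δ` it lies beyond `n δ ≥ K`. Either way it carries little of `𝓕 w`, uniformly in the
symmetry. -/
theorem weakSymmZero_freqBump : WeakSymmZero freqBump := by
  rw [weakSymmZero_iff]
  intro w ε hε
  obtain ⟨δ, hδ, K, hS⟩ := exists_small_indicator (𝓕 w : L2) (half_pos hε)
  filter_upwards [eventually_ge_atTop ⌈K / δ⌉₊] with n hn
  rintro _ ⟨t, x, l, hl, rfl⟩
  set S := Set.Icc (l * n) (l * (n + 1))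
  have hz : ∀ᵐ ξ, ξ ∉ S → (𝓕 (symm t x hl (freqBump n)) : L2) ξ = 0 := by
    filter_upwards [fourier_symm t x hl (freqBump n), ae_comp_div hl (fourier_freqBump n)]
      with ξ h1 h2 hξ
    rw [h1, h2, Set.indicator_of_notMem, mul_zero, mul_zero]
    rintro ⟨h3, h4⟩
    rw [le_div_iff₀ hl] at h3
    rw [div_le_iff₀ hl] at h4
    exact hξ ⟨by linarith, by linarith⟩
  have hn' : K ≤ n * δ := by
    rw [← div_le_iff₀ hδ]
    exact Nat.ceil_le.1 hn
  have hsmall := hS S measurableSet_Icc (by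
    rcases le_or_gt l δ with h | h
    · left
      rw [Real.volume_Icc]
      exact ENNReal.ofReal_le_ofReal (by linarith)
    · right
      intro ξ hξ
      have : (n : ℝ) * δ ≤ l * n := by
        rw [mul_comm]; exact mul_le_mul_of_nonneg_right h.le (Nat.cast_nonneg n)
      exact (hn'.trans this).trans hξ.1)
  have h3 := norm_inner_le_of_ae_eq_zero (w := (𝓕 w : L2)) measurableSet_Icc hz
  rw [Lp.inner_fourier_eq, Lp.norm_fourier_eq, norm_symm, norm_freqBump, mul_one] at h3
  have h4 := ENNReal.toReal_mono ENNReal.ofReal_ne_top hsmall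
  rw [ENNReal.toReal_ofReal (half_pos hε).le] at h4
  linarith

/-! ### The Gaussian as a Schwartz function -/

theorem exists_abs_pow_mul_gaussian_le (m : ℕ) :
    ∃ C : ℝ, ∀ x : ℝ, |x| ^ m * Real.exp (-(x ^ 2 / 2)) ≤ C := by
  -- The factorial bounds `(x²)^m` by the `m`-th term of the series of `exp (x²/2)`; the `1` comes
  -- from `|x|^m ≤ 1 + (x²)^m`.
  refine ⟨1 + 2 ^ m * m.factorial, fun x => ?_⟩
  have h1 := Real.pow_div_factorial_le_exp (x ^ 2 / 2) (by positivity) m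
  have hf : (0 : ℝ) < m.factorial := by positivity
  rw [div_le_iff₀ hf, div_pow, div_le_iff₀ (by positivity)] at h1
  have h2 : |x| ^ m ≤ 1 + (x ^ 2) ^ m := by
    rw [← sq_abs, ← pow_mul, mul_comm 2 m, pow_mul]
    nlinarith [sq_nonneg (|x| ^ m - 1), sq_nonneg (|x| ^ m)]
  have h3 : 1 ≤ Real.exp (x ^ 2 / 2) := Real.one_le_exp (by positivity)
  rw [Real.exp_neg, ← div_eq_mul_inv, div_le_iff₀ (Real.exp_pos _)]
  nlinarith

theorem exists_abs_pow_mul_polynomial_mul_gaussian_le (k : ℕ) (P : Polynomial ℤ) :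
    ∃ C : ℝ, ∀ x : ℝ, |x| ^ k * (|Polynomial.aeval x P| * Real.exp (-(x ^ 2 / 2))) ≤ C := by
  induction P using Polynomial.induction_on' with
  | add P Q hP hQ =>
    obtain ⟨C, hC⟩ := hP
    obtain ⟨D, hD⟩ := hQ
    refine ⟨C + D, fun x => le_trans ?_ (add_le_add (hC x) (hD x))⟩
    rw [map_add, ← mul_add, ← add_mul]
    gcongr
    exact abs_add_le _ _
  | monomial n a =>
    obtain ⟨C, hC⟩ := exists_abs_pow_mul_gaussian_le (k + n)
    refine ⟨|(a : ℝ)| * C, fun x => le_trans (le_of_eq ?_)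
      (mul_le_mul_of_nonneg_left (hC x) (abs_nonneg _))⟩
    rw [Polynomial.aeval_monomial, abs_mul, abs_pow, pow_add]
    simp only [algebraMap_int_eq, eq_intCast]
    ring

/-- The Gaussian `e^{-x²/2}` as a real Schwartz function. -/
def realGaussian : 𝓢(ℝ, ℝ) where
  toFun x := Real.exp (-(x ^ 2 / 2))
  smooth' := by fun_prop
  decay' k n := by
    obtain ⟨C, hC⟩ := exists_abs_pow_mul_polynomial_mul_gaussian_le k (Polynomial.hermite n)
    refine ⟨C, fun x => le_trans (le_of_eq ?_) (hC x)⟩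
    rw [norm_iteratedFDeriv_eq_norm_iteratedDeriv, iteratedDeriv_eq_iterate,
      Polynomial.deriv_gaussian_eq_hermite_mul_gaussian, norm_mul, norm_mul, norm_pow]
    simp

/-- The Gaussian `e^{-x²/2}` as a complex Schwartz function. -/
def gaussian : 𝓢(ℝ, ℂ) := SchwartzMap.postcompCLM (𝕜 := ℝ) Complex.ofRealCLM realGaussian

theorem gaussian_ne_zero (x : ℝ) : gaussian x ≠ 0 := by
  have h : gaussian x = (Real.exp (-(x ^ 2 / 2)) : ℂ) := rfl
  rw [h]; exact_mod_cast (Real.exp_pos _).ne'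

/-- The inverse Fourier transform of the Gaussian. -/
def gaussianInv : 𝓢(ℝ, ℂ) := 𝓕⁻ gaussian

/-! ### The windowed Fourier transform of `psi` -/

/-- The Fourier transform of `Ψ_p[u](t, ·)` times a Gaussian, where `v = 𝓕 u`. -/
def window (p : ℝ) (v : ℝ → ℂ) (t ζ : ℝ) : ℂ :=
  ∫ ξ, v ξ * (psiSymbol p t ξ * gaussianInv (ξ - ζ))

theorem memLp_window_kernel {p : ℝ} (hp : 1 < p) (t ζ : ℝ) :
    MemLp (fun ξ => psiSymbol p t ξ * gaussianInv (ξ - ζ)) 2 volume :=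
  memLp_psiSymbol_mul hp t (gaussianInv.compSubConstCLM ℂ ζ)

theorem integrable_window {p : ℝ} (hp : 1 < p) {v : ℝ → ℂ} (hv : MemLp v 2 volume) (t ζ : ℝ) :
    Integrable fun ξ => v ξ * (psiSymbol p t ξ * gaussianInv (ξ - ζ)) :=
  hv.integrable_mul (memLp_window_kernel hp t ζ)

theorem stronglyMeasurable_window_integrand {p : ℝ} (hp : 1 < p) {v : ℝ → ℂ} (hv : StronglyMeasurable v) :
    StronglyMeasurable fun z : (ℝ × ℝ) × ℝ =>
      v z.2 * (psiSymbol p z.1.1 z.2 * gaussianInv (z.2 - z.1.2)) := by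
  refine (hv.comp_measurable measurable_snd).mul (Continuous.stronglyMeasurable ?_)
  have h1 := (continuous_psiSymbol (p := p) (by linarith)).comp
    ((continuous_fst.comp continuous_fst).prodMk continuous_snd : Continuous fun z : (ℝ × ℝ) × ℝ => (z.1.1, z.2))
  exact h1.mul (gaussianInv.continuous.comp (by fun_prop))

theorem stronglyMeasurable_window {p : ℝ} (hp : 1 < p) {v : ℝ → ℂ} (hv : StronglyMeasurable v) :
    StronglyMeasurable fun z : ℝ × ℝ => window p v z.1 z.2 :=
  StronglyMeasurable.integral_prod_right (stronglyMeasurable_window_integrand hp hv)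

/-- At most linear growth in `ζ`, from `|η|^(1/p) ≤ 1 + 2π|ξ|` and `|ξ| ≤ |ξ - ζ| + |ζ|`. This
justifies Fubini against a Schwartz function of `ζ`. -/
theorem exists_window_bound {p : ℝ} (hp : 1 < p) (v : L2) :
    ∃ C : ℝ, 0 ≤ C ∧ ∀ t ζ, ∫ ξ, ‖v ξ * (psiSymbol p t ξ * gaussianInv (ξ - ζ))‖ ≤ C * (1 + |ζ|) := by
  have hπ := Real.pi_pos
  have hg : (fun x : ℝ => (x : ℂ)).HasTemperateGrowth := by fun_prop
  have hk1 : ∀ x, SchwartzMap.smulLeftCLM ℂ (fun x : ℝ => (x : ℂ)) gaussianInv x = x * gaussianInv x :=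
    fun x => by rw [SchwartzMap.smulLeftCLM_apply hg]; simp
  have hL : ∀ (φ : 𝓢(ℝ, ℂ)) (ζ : ℝ), Integrable (fun ξ => ‖v ξ‖ * ‖φ (ξ - ζ)‖) ∧
      ∫ ξ, ‖v ξ‖ * ‖φ (ξ - ζ)‖ ≤ ‖v‖ ^ 2 + ∫ ξ, ‖φ ξ‖ ^ 2 := by
    intro φ ζ
    have h1 : Integrable fun ξ => ‖v ξ‖ ^ 2 := (Lp.memLp v).integrable_norm_pow (by norm_num)
    have h2 : Integrable fun ξ => ‖φ ξ‖ ^ 2 := (φ.memLp 2).integrable_norm_pow (by norm_num)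
    have h3 := h2.comp_sub_right ζ
    refine ⟨((Lp.memLp v).norm.integrable_mul
      ((φ.compSubConstCLM ℂ ζ).memLp 2 (μ := volume)).norm), ?_⟩
    have h4 : ‖v‖ ^ 2 = ∫ ξ, ‖v ξ‖ ^ 2 := by
      have := L2.inner_def (𝕜 := ℂ) v v
      rw [inner_self_eq_norm_sq_to_K] at this
      simp only [inner_self_eq_norm_sq_to_K] at this
      exact_mod_cast this
    rw [h4, ← integral_sub_right_eq_self (fun ξ => ‖φ ξ‖ ^ 2) ζ, ← integral_add h1 h3]
    refine integral_mono_of_nonneg (Eventually.of_forall fun ξ => by positivity) (h1.add h3)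
      (Eventually.of_forall fun ξ => ?_)
    nlinarith [sq_nonneg (‖v ξ‖ - ‖φ (ξ - ζ)‖), sq_nonneg (‖v ξ‖), sq_nonneg (‖φ (ξ - ζ)‖)]
  set A := ‖v‖ ^ 2 + ∫ ξ, ‖gaussianInv ξ‖ ^ 2
  set B := ‖v‖ ^ 2 + ∫ ξ, ‖SchwartzMap.smulLeftCLM ℂ (fun x : ℝ => (x : ℂ)) gaussianInv ξ‖ ^ 2
  have hA : 0 ≤ A := add_nonneg (by positivity) (integral_nonneg fun _ => by positivity)
  have hB : 0 ≤ B := add_nonneg (by positivity) (integral_nonneg fun _ => by positivity)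
  refine ⟨(1 + 2 * Real.pi) * A + 2 * Real.pi * B, by positivity, fun t ζ => ?_⟩
  obtain ⟨i0, b0⟩ := hL gaussianInv ζ
  obtain ⟨i1, b1⟩ := hL (SchwartzMap.smulLeftCLM ℂ (fun x : ℝ => (x : ℂ)) gaussianInv) ζ
  have hle : ∫ ξ, ‖v ξ * (psiSymbol p t ξ * gaussianInv (ξ - ζ))‖ ≤
      ∫ ξ, ((1 + 2 * Real.pi * |ζ|) * (‖v ξ‖ * ‖gaussianInv (ξ - ζ)‖) + 2 * Real.pi *
        (‖v ξ‖ * ‖SchwartzMap.smulLeftCLM ℂ (fun x : ℝ => (x : ℂ)) gaussianInv (ξ - ζ)‖)) := by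
    refine integral_mono_of_nonneg (Eventually.of_forall fun ξ => norm_nonneg _)
      ((i0.const_mul _).add (i1.const_mul _)) (Eventually.of_forall fun ξ => ?_)
    beta_reduce
    rw [hk1, norm_mul, norm_mul, norm_mul, norm_psiSymbol, Complex.norm_real, Real.norm_eq_abs]
    have h5 := derivSymbol_le hp ξ
    have h6 : |ξ| ≤ |ξ - ζ| + |ζ| := by simpa using abs_add_le (ξ - ζ) ζ
    have h7 : derivSymbol p ξ ≤ 1 + 2 * Real.pi * |ζ| + 2 * Real.pi * |ξ - ζ| := by nlinarith
    have h8 := mul_le_mul_of_nonneg_right h7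
      (mul_nonneg (norm_nonneg (v ξ)) (norm_nonneg (gaussianInv (ξ - ζ))))
    linarith
  refine hle.trans ?_
  rw [integral_add (i0.const_mul _) (i1.const_mul _), integral_const_mul, integral_const_mul]
  have h9 := mul_le_mul_of_nonneg_left b0 (show 0 ≤ 1 + 2 * Real.pi * |ζ| by positivity)
  have h10 := mul_le_mul_of_nonneg_left b1 (show 0 ≤ 2 * Real.pi by positivity)
  refine (add_le_add h9 h10).trans ?_
  have h11 : 0 ≤ |ζ| := abs_nonneg ζ
  have h12 : 0 ≤ Real.pi * B * |ζ| := by positivity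
  have h13 : 0 ≤ Real.pi * A := by positivity
  have h14 : 0 ≤ A * |ζ| := by positivity
  change (1 + 2 * Real.pi * |ζ|) * A + 2 * Real.pi * B ≤ _
  nlinarith

/-- Multiplication by the Gaussian is convolution with `gaussianInv` on the Fourier side; this
identifies `window` as a distributional Fourier transform before any function represents `psi`. -/
theorem psi_fourier_convolution {p : ℝ} (hp : 1 < p) (u : L2) (t : ℝ) (χ : 𝓢(ℝ, ℂ)) :
    psi p u t (𝓕 (SchwartzMap.convolution (ContinuousLinearMap.mul ℂ ℂ) χ gaussianInv)) =
      ∫ ζ, window p (𝓕 u : L2) t ζ * χ ζ := by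
  rw [psi_eq, FourierTransform.fourierInv_fourier_eq]
  have h1 : ∀ ξ, (𝓕 u : L2) ξ * (psiSymbol p t ξ *
      SchwartzMap.convolution (ContinuousLinearMap.mul ℂ ℂ) χ gaussianInv ξ) =
      ∫ ζ, (𝓕 u : L2) ξ * (psiSymbol p t ξ * gaussianInv (ξ - ζ)) * χ ζ := fun ξ => by
    rw [SchwartzMap.convolution_apply, convolution_def, ← mul_assoc, ← integral_const_mul]
    congr 1; ext ζ
    simp only [ContinuousLinearMap.mul_apply']
    ring
  simp_rw [h1]
  have hm := (stronglyMeasurable_window_integrand hp (Lp.stronglyMeasurable (𝓕 u : L2))).comp_measurable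
    (g := fun z : ℝ × ℝ => ((t, z.2), z.1)) (by fun_prop)
  have hm2 : StronglyMeasurable fun z : ℝ × ℝ =>
      (𝓕 u : L2) z.1 * (psiSymbol p t z.1 * gaussianInv (z.1 - z.2)) * χ z.2 :=
    hm.mul (χ.continuous.comp continuous_snd).stronglyMeasurable
  have hint : Integrable (Function.uncurry fun ξ ζ =>
      (𝓕 u : L2) ξ * (psiSymbol p t ξ * gaussianInv (ξ - ζ)) * χ ζ) (volume.prod volume) := by
    refine (integrable_prod_iff' (f := Function.uncurry fun ξ ζ =>
      (𝓕 u : L2) ξ * (psiSymbol p t ξ * gaussianInv (ξ - ζ)) * χ ζ) hm2.aestronglyMeasurable).2 ?_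
    refine ⟨Eventually.of_forall fun ζ => (integrable_window hp (Lp.memLp (𝓕 u : L2)) t ζ).mul_const (χ ζ), ?_⟩
    obtain ⟨C, hC, hb⟩ := exists_window_bound hp (𝓕 u : L2)
    have hg : (fun x : ℝ => (x : ℂ)).HasTemperateGrowth := by fun_prop
    have i1 := χ.integrable (μ := volume)
    have i2 := (SchwartzMap.smulLeftCLM ℂ (fun x : ℝ => (x : ℂ)) χ).integrable (μ := volume)
    refine ((i1.norm.add i2.norm).const_mul C).mono' ?_ (Eventually.of_forall fun ζ => ?_)
    · exact hm2.norm.integral_prod_left.aestronglyMeasurable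
    · simp only [Function.uncurry, norm_mul _ (χ ζ), integral_mul_const, Pi.add_apply]
      rw [SchwartzMap.smulLeftCLM_apply_apply hg, smul_eq_mul, norm_mul (ζ : ℂ) (χ ζ),
        Complex.norm_real, Real.norm_eq_abs ζ, Real.norm_of_nonneg
          (mul_nonneg (integral_nonneg fun _ => norm_nonneg _) (norm_nonneg _))]
      have := mul_le_mul_of_nonneg_right (hb t ζ) (norm_nonneg (χ ζ))
      linarith
  rw [integral_integral_swap hint]
  simp only [integral_mul_const]
  rfl

/-- Plancherel. Only the upper bound is needed, so the case where the window is not in `L²` is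
trivial. -/
theorem eLpNorm_gaussian_mul_le {p q : ℝ} (hp : 1 < p) (hq : 2 < q) {u : L2} {t : ℝ} {f : ℝ → ℂ}
    (hf : MemLp f (ENNReal.ofReal q) volume) (hfu : IsPsi p u t f) :
    eLpNorm (fun x => gaussian x * f x) 2 volume ≤ eLpNorm (window p (𝓕 u : L2) t) 2 volume := by
  have hmeas : AEStronglyMeasurable (window p (𝓕 u : L2) t) volume :=
    ((stronglyMeasurable_window hp (Lp.stronglyMeasurable (𝓕 u : L2))).comp_measurable
      (measurable_const (a := t) |>.prodMk measurable_id)).aestronglyMeasurable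
  by_cases hfin : eLpNorm (window p (𝓕 u : L2) t) 2 volume = ∞
  · rw [hfin]; exact le_top
  have hW : MemLp (window p (𝓕 u : L2) t) 2 volume := ⟨hmeas, lt_top_iff_ne_top.2 hfin⟩
  obtain ⟨r, hr, hrq⟩ := exists_holderTriple_two hq
  have hF : MemLp (fun x => gaussian x * f x) 2 volume := hf.mul' (gaussian.memLp (ENNReal.ofReal r))
  set V : L2 := hW.toLp _ with hV
  have hae : (fun x => gaussian x * f x) =ᵐ[volume] (𝓕⁻ V : L2) := by
    refine ae_eq_of_integral_schwartz hF (Lp.memLp _) fun φ => ?_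
    have h1 := integral_fourier_mul (𝓕⁻ V : L2) (𝓕⁻ φ : 𝓢(ℝ, ℂ))
    rw [FourierTransform.fourier_fourierInv_eq, FourierTransform.fourier_fourierInv_eq] at h1
    rw [← h1]
    have h2 := hfu (𝓕 (SchwartzMap.convolution (ContinuousLinearMap.mul ℂ ℂ) (𝓕⁻ φ : 𝓢(ℝ, ℂ)) gaussianInv))
    rw [psi_fourier_convolution hp] at h2
    have h3 : ∫ ξ, V ξ * (𝓕⁻ φ : 𝓢(ℝ, ℂ)) ξ =
        ∫ ζ, window p (𝓕 u : L2) t ζ * (𝓕⁻ φ : 𝓢(ℝ, ℂ)) ζ := by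
      refine integral_congr_ae ?_
      filter_upwards [hW.coeFn_toLp] with ζ hζ
      rw [hV, hζ]
    rw [h3, ← h2]
    congr 1; ext x
    rw [SchwartzMap.fourier_convolution, SchwartzMap.pairing_apply, gaussianInv,
      FourierTransform.fourier_fourierInv_eq, FourierTransform.fourier_fourierInv_eq]
    simp only [ContinuousLinearMap.mul_apply']
    ring
  rw [eLpNorm_congr_ae hae, ← eLpNorm_congr_ae hW.coeFn_toLp]
  have h4 : ‖(𝓕⁻ V : L2)‖ = ‖V‖ := by
    rw [← Lp.norm_fourier_eq, FourierTransform.fourier_fourierInv_eq]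
  rw [Lp.norm_def, Lp.norm_def, ENNReal.toReal_eq_toReal_iff' (Lp.eLpNorm_ne_top _)
    (Lp.eLpNorm_ne_top _)] at h4
  exact h4.le

/-! ### Local compactness -/

theorem ennreal_mul_le_sq_add_sq (x y : ℝ≥0∞) : x * y ≤ x ^ 2 + y ^ 2 := by
  rcases le_total x y with h | h
  · exact le_add_left (by rw [sq]; gcongr)
  · exact le_add_right (by rw [sq]; gcongr)

theorem ennreal_add_sq_le (x y : ℝ≥0∞) : (x + y) ^ 2 ≤ 4 * (x ^ 2 + y ^ 2) := by
  rcases le_total x y with h | h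
  · calc (x + y) ^ 2 ≤ (y + y) ^ 2 := by gcongr
      _ = 4 * y ^ 2 := by ring
      _ ≤ _ := by gcongr; exact le_add_self
  · calc (x + y) ^ 2 ≤ (x + x) ^ 2 := by gcongr
      _ = 4 * x ^ 2 := by ring
      _ ≤ _ := by gcongr; exact le_self_add

theorem eLpNorm_two_sq (f : ℝ → ℂ) :
    eLpNorm f 2 volume ^ 2 = ∫⁻ x, ‖f x‖ₑ ^ 2 := by
  rw [eLpNorm_eq_lintegral_rpow_enorm_toReal (by norm_num) (by norm_num)]
  rw [← ENNReal.rpow_natCast, ← ENNReal.rpow_mul]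
  simp

theorem enorm_L2_sq (v : L2) : ‖v‖ₑ ^ 2 = ∫⁻ x, ‖v x‖ₑ ^ 2 := by
  rw [Lp.enorm_def, eLpNorm_two_sq]

theorem measurable_enorm_gaussianInv {α : Type*} [MeasurableSpace α] {f : α → ℝ}
    (hf : Measurable f) : Measurable fun x => ‖gaussianInv (f x)‖ₑ :=
  (gaussianInv.continuous.measurable.comp hf).enorm

/-- The standard Gaussian probability measure in time. -/
abbrev timeMeasure : Measure ℝ := ProbabilityTheory.gaussianReal 0 1

theorem integral_exp_timeMeasure (s : ℝ) :
    ∫ t : ℝ, Complex.exp ((t * s : ℝ) * Complex.I) ∂timeMeasure = (Real.exp (-(s ^ 2 / 2)) : ℂ) := by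
  have h := ProbabilityTheory.charFun_gaussianReal (μ := 0) (v := 1) s
  rw [charFun_apply_real] at h
  simp only [mul_comm _ s, Complex.ofReal_mul]
  rw [h]
  push_cast
  congr 1
  ring

/-- Expanding the square gives a double integral with phase `t (θ ξ - θ η)`. Averaging over Gaussian
time turns the phase into the characteristic function of the normal law. -/
theorem lintegral_oscillatory_le {a : ℝ → ℂ} (ha : StronglyMeasurable a) (hai : Integrable a)
    {θ : ℝ → ℝ} (hθ : Measurable θ) :
    ∫⁻ t, ‖∫ ξ, a ξ * Complex.exp ((t * θ ξ : ℝ) * Complex.I)‖ₑ ^ 2 ∂timeMeasure ≤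
      ∫⁻ z : ℝ × ℝ, ‖a z.1‖ₑ * ‖a z.2‖ₑ * ENNReal.ofReal (Real.exp (-((θ z.1 - θ z.2) ^ 2 / 2)))
        ∂(volume.prod volume) := by
  set A : ℝ → ℂ := fun t => ∫ ξ, a ξ * Complex.exp ((t * θ ξ : ℝ) * Complex.I) with hA
  set b : ℝ × ℝ → ℂ := fun z => a z.1 * starRingEnd ℂ (a z.2) with hb
  have hbi : Integrable b (volume.prod volume) :=
    hai.mul_prod ((Complex.conjCLE : ℂ →L[ℝ] ℂ).integrable_comp hai)
  set F : ℝ → ℝ × ℝ → ℂ := fun t z =>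
    b z * Complex.exp ((t * (θ z.1 - θ z.2) : ℝ) * Complex.I) with hF
  have hAm : StronglyMeasurable A := by
    refine StronglyMeasurable.integral_prod_right' (f := fun z : ℝ × ℝ =>
      a z.2 * Complex.exp ((z.1 * θ z.2 : ℝ) * Complex.I)) ?_
    refine (ha.comp_measurable measurable_snd).mul (Measurable.stronglyMeasurable ?_)
    fun_prop
  have hAb : ∀ t, ‖A t‖ ≤ ∫ ξ, ‖a ξ‖ := fun t => by
    refine (norm_integral_le_integral_norm _).trans (le_of_eq ?_)
    simp only [norm_mul, Complex.norm_exp_ofReal_mul_I, mul_one]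
  have hAA : ∀ t, ((‖A t‖ ^ 2 : ℝ) : ℂ) = ∫ z, F t z ∂(volume.prod volume) := fun t => by
    have h1 : A t * starRingEnd ℂ (A t) = ((‖A t‖ ^ 2 : ℝ) : ℂ) := by
      rw [Complex.mul_conj, Complex.normSq_eq_norm_sq]
    rw [← h1, hA]
    simp only
    rw [← integral_conj, ← integral_prod_mul]
    congr 1; ext z
    rw [hF, hb]
    simp only [map_mul, ← Complex.exp_conj, Complex.conj_I, Complex.conj_ofReal]
    rw [show ((t * (θ z.1 - θ z.2) : ℝ) : ℂ) * Complex.I =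
      ((t * θ z.1 : ℝ) : ℂ) * Complex.I + ((t * θ z.2 : ℝ) : ℂ) * -Complex.I by push_cast; ring,
      Complex.exp_add]
    ring
  have hFi : Integrable (Function.uncurry F) (timeMeasure.prod (volume.prod volume)) := by
    refine ((integrable_const (1 : ℝ)).mul_prod hbi.norm).mono' ?_ (Eventually.of_forall fun y => ?_)
    · have hbm : StronglyMeasurable b := (ha.comp_measurable measurable_fst).mul
        (Complex.continuous_conj.comp_stronglyMeasurable (ha.comp_measurable measurable_snd))
      refine StronglyMeasurable.aestronglyMeasurable ?_
      refine (hbm.comp_measurable measurable_snd).mul (Measurable.stronglyMeasurable ?_)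
      fun_prop
    · simp only [Function.uncurry, hF, norm_mul, Complex.norm_exp_ofReal_mul_I, mul_one, one_mul]
      exact le_rfl
  have hint : Integrable (fun t => ‖A t‖ ^ 2) timeMeasure := by
    refine Integrable.of_bound (hAm.norm.pow 2).aestronglyMeasurable ((∫ ξ, ‖a ξ‖) ^ 2)
      (Eventually.of_forall fun t => ?_)
    rw [Real.norm_of_nonneg (by positivity)]
    exact pow_le_pow_left₀ (norm_nonneg _) (hAb t) 2
  have h1 : ∫⁻ t, ‖A t‖ₑ ^ 2 ∂timeMeasure = ‖∫ t, ((‖A t‖ ^ 2 : ℝ) : ℂ) ∂timeMeasure‖ₑ := by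
    rw [integral_complex_ofReal, ← ofReal_norm, Complex.norm_real,
      Real.norm_of_nonneg (integral_nonneg fun _ => by positivity),
      ofReal_integral_eq_lintegral_ofReal hint (Eventually.of_forall fun _ => by positivity)]
    refine lintegral_congr fun t => ?_
    rw [ENNReal.ofReal_pow (norm_nonneg _), ofReal_norm]
  rw [h1]
  simp_rw [hAA]
  rw [integral_integral_swap hFi]
  refine (enorm_integral_le_lintegral_enorm _).trans (lintegral_mono fun z => ?_)
  rw [hF]
  simp only
  rw [integral_const_mul, integral_exp_timeMeasure, enorm_mul, hb]
  simp only
  rw [enorm_mul, ← ofReal_norm (starRingEnd ℂ (a z.2)), RCLike.norm_conj, ofReal_norm,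
    ← ofReal_norm (Complex.ofReal _), Complex.norm_real, Real.norm_of_nonneg (Real.exp_pos _).le]

/-- The smoothing effect. Since `x³ - y³ = (x - y) Q` with `Q ≥ ρ²` even for opposite signs, the
only resonance is `x = y`. The Gaussian decay in `(x - y) Q` pays for a factor `√Q` at the price of
the integrable singularity `|x - y|^(-1/2)`, while the symbols cost only `Q ^ a` with `a < 1/2`. The
surplus is the negative power of `ρ`. -/
theorem cubic_kernel_le {a ρ x y : ℝ} (ha0 : 0 < a) (ha : a < 1 / 2) (hρ : 1 ≤ ρ) (hx : ρ ≤ |x|)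
    (hy : ρ ≤ |y|) (hxy : x ≠ y) :
    |x| ^ a * |y| ^ a * Real.exp (-((x ^ 3 - y ^ 3) ^ 2 / 2)) ≤
      ρ ^ (2 * a - 1) * ((√|x - y|)⁻¹ * Real.exp (-((x - y) ^ 2 / 4))) := by
  set Q := x ^ 2 + x * y + y ^ 2 with hQ
  set d := |x - y| with hd
  have hd0 : 0 < d := abs_pos.2 (sub_ne_zero.2 hxy)
  have hx2 : ρ ^ 2 ≤ x ^ 2 := by rw [← sq_abs x]; exact pow_le_pow_left₀ (by linarith) hx 2
  have hy2 : ρ ^ 2 ≤ y ^ 2 := by rw [← sq_abs y]; exact pow_le_pow_left₀ (by linarith) hy 2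
  have hQρ : ρ ^ 2 ≤ Q := by nlinarith [sq_nonneg (x + y)]
  have hQ1 : 1 ≤ Q := by nlinarith
  have hxyQ : |x| * |y| ≤ Q := by
    rw [← abs_mul]
    exact abs_le.2 ⟨by nlinarith [sq_nonneg (x + y)], by nlinarith [sq_nonneg x, sq_nonneg y]⟩
  have h1 : |x| ^ a * |y| ^ a ≤ ρ ^ (2 * a - 1) * √Q := by
    rw [← Real.mul_rpow (abs_nonneg _) (abs_nonneg _)]
    calc (|x| * |y|) ^ a ≤ Q ^ a := Real.rpow_le_rpow (by positivity) hxyQ ha0.le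
      _ = Q ^ (a - 1 / 2) * √Q := by
        rw [Real.sqrt_eq_rpow, ← Real.rpow_add (by linarith)]; congr 1; ring
      _ ≤ (ρ ^ 2) ^ (a - 1 / 2) * √Q := by
        refine mul_le_mul_of_nonneg_right ?_ (Real.sqrt_nonneg _)
        exact Real.rpow_le_rpow_of_nonpos (by positivity) hQρ (by linarith)
      _ = ρ ^ (2 * a - 1) * √Q := by
        rw [← Real.rpow_natCast ρ 2, ← Real.rpow_mul (by linarith)]
        congr 2; push_cast; ring
  set s := d * Q with hs
  have hs0 : 0 < s := by positivity
  have h2 : (x ^ 3 - y ^ 3) ^ 2 = s ^ 2 := by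
    rw [hs, mul_pow, hd, sq_abs, hQ]; ring
  have h3 : √s ≤ Real.exp (s ^ 2 / 4) := by
    rw [Real.sqrt_le_left (Real.exp_pos _).le, ← Real.exp_nat_mul]
    have := Real.add_one_le_exp ((2 : ℕ) * (s ^ 2 / 4))
    push_cast at this ⊢
    nlinarith [sq_nonneg (s - 1)]
  have h4 : √Q = (√d)⁻¹ * √s := by
    rw [hs, Real.sqrt_mul hd0.le, inv_mul_cancel_left₀ (Real.sqrt_pos.2 hd0).ne']
  have h5 : √s * Real.exp (-(s ^ 2 / 2)) ≤ Real.exp (-((x - y) ^ 2 / 4)) := by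
    calc √s * Real.exp (-(s ^ 2 / 2)) ≤ Real.exp (s ^ 2 / 4) * Real.exp (-(s ^ 2 / 2)) := by gcongr
      _ = Real.exp (-(s ^ 2 / 4)) := by rw [← Real.exp_add]; congr 1; ring
      _ ≤ Real.exp (-((x - y) ^ 2 / 4)) := by
        refine Real.exp_le_exp.2 ?_
        have : (x - y) ^ 2 ≤ s ^ 2 := by
          rw [← sq_abs (x - y)]
          exact pow_le_pow_left₀ (abs_nonneg _) (le_mul_of_one_le_right hd0.le hQ1) 2
        linarith
  have hρ0 : 0 ≤ ρ ^ (2 * a - 1) := by positivity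
  calc |x| ^ a * |y| ^ a * Real.exp (-((x ^ 3 - y ^ 3) ^ 2 / 2))
      ≤ ρ ^ (2 * a - 1) * √Q * Real.exp (-(s ^ 2 / 2)) := by rw [h2]; gcongr
    _ = ρ ^ (2 * a - 1) * ((√d)⁻¹ * (√s * Real.exp (-(s ^ 2 / 2)))) := by rw [h4]; ring
    _ ≤ _ := by gcongr

/-- The dominating kernel `|η|^{-1/2} e^{-η²/4}`, `η = 2πs`. -/
def schurKernel (s : ℝ) : ℝ := (√|2 * Real.pi * s|)⁻¹ * Real.exp (-((2 * Real.pi * s) ^ 2 / 4))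

theorem lintegral_schurKernel_ne_top : ∫⁻ s, ENNReal.ofReal (schurKernel s) ≠ ∞ := by
  have hπ := Real.pi_gt_three
  have hg := integrable_rpow_mul_exp_neg_mul_sq (b := 1) one_pos (s := -1 / 2) (by norm_num)
  set g : ℝ → ℝ := fun x => x ^ (-1 / 2 : ℝ) * Real.exp (-1 * x ^ 2)
  have hi : Integrable fun x => |g x| + |g (-x)| := hg.abs.add (hg.comp_neg.abs)
  have hpos : ∀ x : ℝ, 0 < x → schurKernel x ≤ |g x| := fun x hx => by
    refine le_trans ?_ (le_abs_self _)
    unfold schurKernel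
    rw [abs_of_pos (by positivity)]
    refine mul_le_mul ?_ ?_ (Real.exp_pos _).le (by positivity)
    · rw [neg_div, Real.rpow_neg hx.le, ← Real.sqrt_eq_rpow]
      refine inv_anti₀ (Real.sqrt_pos.2 hx) (Real.sqrt_le_sqrt ?_)
      nlinarith
    · refine Real.exp_le_exp.2 ?_
      have h1 : 1 ≤ Real.pi ^ 2 := by nlinarith
      nlinarith [mul_le_mul_of_nonneg_right h1 (sq_nonneg x)]
  have hle : ∀ x : ℝ, schurKernel x ≤ |g x| + |g (-x)| := fun x => by
    rcases lt_trichotomy x 0 with h | h | h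
    · have h1 := hpos (-x) (by linarith)
      have h2 : schurKernel (-x) = schurKernel x := by
        unfold schurKernel
        rw [mul_neg, abs_neg, neg_sq]
      have := abs_nonneg (g x)
      linarith
    · have : schurKernel x = 0 := by unfold schurKernel; simp [h]
      rw [this]; positivity
    · have := abs_nonneg (g (-x))
      have := hpos x h
      linarith
  refine ne_top_of_le_ne_top ?_ (lintegral_mono fun x => ENNReal.ofReal_le_ofReal (hle x))
  exact (hi.lintegral_lt_top).ne

/-- The time-averaged kernel on high frequencies. -/
def highKernel (p : ℝ) (ξ η : ℝ) : ℝ≥0∞ :=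
  ENNReal.ofReal (derivSymbol p ξ * derivSymbol p η *
    Real.exp (-(((2 * Real.pi * ξ) ^ 3 - (2 * Real.pi * η) ^ 3) ^ 2 / 2)))

theorem measurable_highKernel {p : ℝ} (hp : 0 < p) :
    Measurable fun z : ℝ × ℝ => highKernel p z.1 z.2 := by
  have := continuous_derivSymbol hp
  unfold highKernel
  fun_prop

theorem highKernel_comm (p ξ η : ℝ) : highKernel p ξ η = highKernel p η ξ := by
  unfold highKernel
  congr 1
  rw [mul_comm (derivSymbol p ξ), ← neg_sub ((2 * Real.pi * η) ^ 3), neg_sq]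

/-- The high frequencies `|ξ| > R`. -/
def highFreq (R : ℝ) : Set ℝ := {ξ | R < |ξ|}

theorem measurableSet_highFreq (R : ℝ) : MeasurableSet (highFreq R) :=
  measurableSet_lt measurable_const (by fun_prop)

/-- On `|ξ| > R` the kernel is at most `(2πR)^(2/p - 1)` times an integrable convolution kernel, and
the exponent is negative because `p > 2`. -/
theorem exists_schur_bound {p : ℝ} (hp : 2 < p) {ε : ℝ≥0∞} (hε : ε ≠ 0) :
    ∃ R : ℝ, ∀ ξ ∈ highFreq R, ∫⁻ η in highFreq R, highKernel p ξ η ≤ ε := by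
  have hπ := Real.pi_pos
  set K := ∫⁻ s, ENNReal.ofReal (schurKernel s) with hK
  have hKt : K ≠ ∞ := lintegral_schurKernel_ne_top
  have hlim : Tendsto (fun R : ℝ => ENNReal.ofReal ((2 * Real.pi * R) ^ (2 * (1 / p) - 1)) * K) atTop (𝓝 0) := by
    have h0 : 0 < 1 - 2 * (1 / p) := by
      rw [mul_one_div, sub_pos, div_lt_one (by linarith)]; exact hp
    have h1 := (tendsto_rpow_neg_atTop h0).comp
      (tendsto_id.const_mul_atTop (show 0 < 2 * Real.pi by positivity))
    have h2 := ENNReal.tendsto_ofReal h1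
    rw [ENNReal.ofReal_zero] at h2
    have h3 := ENNReal.Tendsto.mul_const h2 (Or.inr hKt)
    rw [zero_mul] at h3
    refine h3.congr fun R => ?_
    simp [neg_sub]
  obtain ⟨R, hR, hR1⟩ := ((hlim.eventually_le_const (pos_iff_ne_zero.2 hε)).and
    (eventually_ge_atTop 1)).exists
  refine ⟨R, fun ξ hξ => ?_⟩
  refine le_trans ?_ hR
  have hρ : 1 ≤ 2 * Real.pi * R := by nlinarith [Real.pi_gt_three]
  have habs : ∀ η ∈ highFreq R, 2 * Real.pi * R ≤ |2 * Real.pi * η| := fun η hη => by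
    rw [abs_mul, abs_of_pos (by positivity : 0 < 2 * Real.pi)]
    have : R < |η| := hη
    gcongr
  calc ∫⁻ η in highFreq R, highKernel p ξ η
      ≤ ∫⁻ η in highFreq R, ENNReal.ofReal ((2 * Real.pi * R) ^ (2 * (1 / p) - 1)) *
          ENNReal.ofReal (schurKernel (ξ - η)) := by
        refine lintegral_mono_ae ?_
        filter_upwards [ae_restrict_mem (measurableSet_highFreq R),
          ae_restrict_of_ae (Measure.ae_ne volume ξ)] with η hη hne
        rw [← ENNReal.ofReal_mul (by positivity)]
        refine ENNReal.ofReal_le_ofReal ?_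
        have := cubic_kernel_le (a := 1 / p) (by positivity)
          (one_div_lt_one_div_of_lt two_pos hp) hρ (habs ξ hξ) (habs η hη)
          (fun h => hne (mul_left_cancel₀ (by positivity) h).symm)
        unfold schurKernel derivSymbol
        rwa [mul_sub (2 * Real.pi) ξ η]
    _ ≤ ∫⁻ η, ENNReal.ofReal ((2 * Real.pi * R) ^ (2 * (1 / p) - 1)) *
          ENNReal.ofReal (schurKernel (ξ - η)) := setLIntegral_le_lintegral _ _
    _ = _ := by
        rw [lintegral_const_mul' _ _ ENNReal.ofReal_ne_top,
          lintegral_sub_left_eq_self (fun s => ENNReal.ofReal (schurKernel s)) ξ]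

/-- The squared `L²` norm of the windowed transform with Gaussian weight in time. -/
def windowEnergy (p : ℝ) (v : ℝ → ℂ) : ℝ≥0∞ :=
  ∫⁻ t, ∫⁻ ζ, ‖window p v t ζ‖ₑ ^ 2 ∂volume ∂timeMeasure

theorem windowEnergy_eq_swap {p : ℝ} (hp : 1 < p) {v : ℝ → ℂ} (hv : StronglyMeasurable v) :
    windowEnergy p v = ∫⁻ ζ, ∫⁻ t, ‖window p v t ζ‖ₑ ^ 2 ∂timeMeasure :=
  lintegral_lintegral_swap
    ((stronglyMeasurable_window hp hv).enorm.pow_const 2).aemeasurable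

theorem lintegral_gaussianInv_translate (c : ℝ) :
    ∫⁻ ζ, ‖gaussianInv (c - ζ)‖ₑ ^ 2 = eLpNorm gaussianInv 2 volume ^ 2 := by
  rw [eLpNorm_two_sq, lintegral_sub_left_eq_self (fun s => ‖gaussianInv s‖ₑ ^ 2) c]

/-- Schur test for a symmetric kernel; the factor `2` comes from the crude bound `xy ≤ x² + y²`. -/
theorem lintegral_schur_le {N : ℝ → ℝ → ℝ≥0∞} (hN : Measurable fun z : ℝ × ℝ => N z.1 z.2)
    (hsymm : ∀ ξ η, N ξ η = N η ξ) {S : Set ℝ} (hS : MeasurableSet S) {ε : ℝ≥0∞}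
    (hε : ∀ ξ ∈ S, ∫⁻ η in S, N ξ η ≤ ε) {b : ℝ → ℝ≥0∞} (hb : Measurable b) :
    ∫⁻ z in S ×ˢ S, b z.1 * b z.2 * N z.1 z.2 ∂(volume.prod volume) ≤ 2 * ε * ∫⁻ ξ, b ξ ^ 2 := by
  set μ : Measure ℝ := volume.restrict S with hμ
  have hb1 : Measurable fun z : ℝ × ℝ => b z.1 := hb.comp measurable_fst
  have hb2 : Measurable fun z : ℝ × ℝ => b z.2 := hb.comp measurable_snd
  have hm1 : Measurable fun z : ℝ × ℝ => b z.1 ^ 2 * N z.1 z.2 := (hb1.pow_const 2).mul hN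
  have hm2 : Measurable fun z : ℝ × ℝ => b z.2 ^ 2 * N z.1 z.2 := (hb2.pow_const 2).mul hN
  have key : ∫⁻ ξ, ∫⁻ η, b ξ ^ 2 * N ξ η ∂μ ∂μ ≤ ε * ∫⁻ ξ, b ξ ^ 2 := by
    rw [← lintegral_const_mul _ (hb.pow_const 2)]
    refine le_trans (lintegral_mono_ae ?_) (setLIntegral_le_lintegral S _)
    filter_upwards [ae_restrict_mem hS] with ξ hξ
    have h5 : Measurable fun η => N ξ η := hN.comp (measurable_const (a := ξ) |>.prodMk measurable_id)
    rw [lintegral_const_mul _ h5, mul_comm]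
    gcongr
    exact hε ξ hξ
  rw [← Measure.prod_restrict, ← hμ]
  calc ∫⁻ z, b z.1 * b z.2 * N z.1 z.2 ∂(μ.prod μ)
      ≤ ∫⁻ z, (b z.1 ^ 2 * N z.1 z.2 + b z.2 ^ 2 * N z.1 z.2) ∂(μ.prod μ) := by
        refine lintegral_mono fun z => ?_
        rw [← add_mul]
        gcongr
        exact ennreal_mul_le_sq_add_sq _ _
    _ = ∫⁻ ξ, ∫⁻ η, b ξ ^ 2 * N ξ η ∂μ ∂μ + ∫⁻ ξ, ∫⁻ η, b ξ ^ 2 * N ξ η ∂μ ∂μ := by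
        rw [lintegral_add_left hm1, lintegral_prod _ hm1.aemeasurable,
          lintegral_prod_symm _ hm2.aemeasurable]
        congr 1
        refine lintegral_congr fun ξ => lintegral_congr fun η => ?_
        rw [hsymm]
    _ ≤ (ε * ∫⁻ ξ, b ξ ^ 2) + ε * ∫⁻ ξ, b ξ ^ 2 := add_le_add key key
    _ = 2 * ε * ∫⁻ ξ, b ξ ^ 2 := by ring

theorem lintegral_window_high_le {p : ℝ} (hp : 1 < p) {R : ℝ} {ε : ℝ≥0∞}
    (hε : ∀ ξ ∈ highFreq R, ∫⁻ η in highFreq R, highKernel p ξ η ≤ ε) {v : ℝ → ℂ}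
    (hv : StronglyMeasurable v) (hv2 : MemLp v 2 volume) (ζ : ℝ) :
    ∫⁻ t, ‖window p ((highFreq R).indicator v) t ζ‖ₑ ^ 2 ∂timeMeasure ≤
      2 * ε * ∫⁻ ξ, ‖v ξ‖ₑ ^ 2 * ‖gaussianInv (ξ - ζ)‖ₑ ^ 2 := by
  have hS := measurableSet_highFreq R
  set S := highFreq R
  set a : ℝ → ℂ := fun ξ => S.indicator v ξ * ((derivSymbol p ξ : ℂ) * gaussianInv (ξ - ζ)) with ha
  have hk : Continuous fun ξ => (derivSymbol p ξ : ℂ) * gaussianInv (ξ - ζ) := by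
    have := continuous_derivSymbol (p := p) (by linarith)
    have := gaussianInv.continuous
    fun_prop
  have ham : StronglyMeasurable a := (hv.indicator hS).mul hk.stronglyMeasurable
  have hai : Integrable a := (hv2.indicator hS).integrable_mul
    (memLp_derivSymbol_mul hp (gaussianInv.compSubConstCLM ℂ ζ))
  have h1 : ∀ t, window p (S.indicator v) t ζ =
      ∫ ξ, a ξ * Complex.exp ((t * (2 * Real.pi * ξ) ^ 3 : ℝ) * Complex.I) := fun t => by
    unfold window psiSymbol airySymbol
    congr 1; ext ξ
    rw [ha]; ring
  simp_rw [h1]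
  refine (lintegral_oscillatory_le ham hai (θ := fun ξ => (2 * Real.pi * ξ) ^ 3) (by fun_prop)).trans ?_
  set b : ℝ → ℝ≥0∞ := fun ξ => ‖v ξ‖ₑ * ‖gaussianInv (ξ - ζ)‖ₑ with hb
  have hbm : Measurable b := by
    exact hv.enorm.mul (measurable_enorm_gaussianInv (measurable_id.sub_const ζ))
  have h2 : ∀ z : ℝ × ℝ, ‖a z.1‖ₑ * ‖a z.2‖ₑ *
      ENNReal.ofReal (Real.exp (-(((2 * Real.pi * z.1) ^ 3 - (2 * Real.pi * z.2) ^ 3) ^ 2 / 2))) ≤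
      (S ×ˢ S).indicator (fun z => b z.1 * b z.2 * highKernel p z.1 z.2) z := by
    rintro ⟨ξ, η⟩
    by_cases hξ : ξ ∈ S
    · by_cases hη : η ∈ S
      · rw [Set.indicator_of_mem (Set.mk_mem_prod hξ hη)]
        have h3 : ∀ x, x ∈ S → ‖a x‖ₑ = b x * ENNReal.ofReal (derivSymbol p x) := fun x hx => by
          rw [ha, hb]
          simp only [Set.indicator_of_mem hx, enorm_mul]
          rw [← ofReal_norm (Complex.ofReal _), Complex.norm_real,
            Real.norm_of_nonneg (derivSymbol_nonneg p x)]
          ring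
        simp only [h3 ξ hξ, h3 η hη]
        unfold highKernel
        rw [ENNReal.ofReal_mul (mul_nonneg (derivSymbol_nonneg p ξ) (derivSymbol_nonneg p η)),
          ENNReal.ofReal_mul (derivSymbol_nonneg p ξ)]
        exact le_of_eq (by ring)
      · simp [ha, Set.indicator_of_notMem hη]
    · simp [ha, Set.indicator_of_notMem hξ]
  refine (lintegral_mono h2).trans ?_
  rw [lintegral_indicator (hS.prod hS)]
  refine (lintegral_schur_le (measurable_highKernel (by linarith)) (highKernel_comm p) hS hε hbm).trans ?_
  simp only [hb, mul_pow]
  exact le_rfl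

theorem windowEnergy_high_le {p : ℝ} (hp : 1 < p) {R : ℝ} {ε : ℝ≥0∞}
    (hε : ∀ ξ ∈ highFreq R, ∫⁻ η in highFreq R, highKernel p ξ η ≤ ε) (v : L2) :
    windowEnergy p ((highFreq R).indicator v) ≤
      2 * ε * (‖v‖ₑ ^ 2 * eLpNorm gaussianInv 2 volume ^ 2) := by
  have hv := Lp.stronglyMeasurable v
  have hm : Measurable fun z : ℝ × ℝ => ‖v z.2‖ₑ ^ 2 * ‖gaussianInv (z.2 - z.1)‖ₑ ^ 2 := by
    exact ((hv.enorm.comp measurable_snd).pow_const 2).mul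
      ((measurable_enorm_gaussianInv (measurable_snd.sub measurable_fst)).pow_const 2)
  rw [windowEnergy_eq_swap hp (hv.indicator (measurableSet_highFreq R))]
  refine (lintegral_mono fun ζ => lintegral_window_high_le hp hε hv (Lp.memLp v) ζ).trans ?_
  rw [lintegral_const_mul _ hm.lintegral_prod_right']
  gcongr
  rw [lintegral_lintegral_swap (f := fun ζ ξ => ‖v ξ‖ₑ ^ 2 * ‖gaussianInv (ξ - ζ)‖ₑ ^ 2) hm.aemeasurable]
  simp_rw [lintegral_const_mul' _ _ (ENNReal.pow_ne_top enorm_ne_top), lintegral_gaussianInv_translate]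
  rw [lintegral_mul_const _ (hv.enorm.pow_const 2), enorm_L2_sq]

/-- At bounded frequency each window value is an inner product of `v n` with a fixed `L²` function,
so it tends to zero pointwise in `(t, ζ)`. The symbol is bounded there, and the bound `B` is
integrable because the frequency set has finite measure. -/
theorem tendsto_windowEnergy_low {p : ℝ} (hp : 1 < p) (R : ℝ) {v : ℕ → L2} {M : ℝ}
    (hM : ∀ n, ‖v n‖ ≤ M) (hv : ∀ w, Tendsto (fun n => inner ℂ w (v n)) atTop (𝓝 0)) :
    Tendsto (fun n => windowEnergy p ((highFreq R)ᶜ.indicator (v n))) atTop (𝓝 0) := by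
  have hπ := Real.pi_pos
  have hS := (measurableSet_highFreq R).compl
  set S := (highFreq R)ᶜ with hSdef
  have hSabs : ∀ ξ ∈ S, |ξ| ≤ R := fun ξ hξ => not_lt.1 hξ
  set k : ℝ → ℝ → ℝ → ℂ := fun t ζ => S.indicator fun ξ => starRingEnd ℂ (psiSymbol p t ξ * gaussianInv (ξ - ζ))
    with hk
  have hkm : ∀ t ζ, MemLp (k t ζ) 2 volume := fun t ζ =>
    MemLp.indicator hS ((memLp_window_kernel hp t ζ).star)
  have hinner : ∀ n t ζ, window p (S.indicator (v n)) t ζ = inner ℂ ((hkm t ζ).toLp _) (v n) := by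
    intro n t ζ
    rw [L2.inner_def]
    unfold window
    refine integral_congr_ae ?_
    filter_upwards [(hkm t ζ).coeFn_toLp] with ξ hξ
    rw [hξ]
    by_cases h : ξ ∈ S
    · simp only [hk, Set.indicator_of_mem h, RCLike.inner_apply, Complex.conj_conj]
    · simp [hk, Set.indicator_of_notMem h]
  set C : ℝ := 1 + 2 * Real.pi * R
  set B : ℝ × ℝ → ℝ≥0∞ := fun z => ENNReal.ofReal M ^ 2 *
    (ENNReal.ofReal C ^ 2 * ∫⁻ ξ in S, ‖gaussianInv (ξ - z.2)‖ₑ ^ 2) with hB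
  have hbound : ∀ n z, ‖window p (S.indicator (v n)) z.1 z.2‖ₑ ^ 2 ≤ B z := by
    rintro n ⟨t, ζ⟩
    rw [hinner, hB]
    have h1 : ‖inner ℂ ((hkm t ζ).toLp _) (v n)‖ₑ ≤ ‖v n‖ₑ * eLpNorm (k t ζ) 2 volume := by
      have h2 : ‖(hkm t ζ).toLp _‖ₑ = eLpNorm (k t ζ) 2 volume := Lp.enorm_toLp _
      rw [← h2, mul_comm, ← ofReal_norm, ← ofReal_norm, ← ofReal_norm, ← ENNReal.ofReal_mul (norm_nonneg _)]
      exact ENNReal.ofReal_le_ofReal (norm_inner_le_norm _ _)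
    refine (pow_le_pow_left' h1 2).trans ?_
    have h3 : ‖v n‖ₑ ≤ ENNReal.ofReal M := by
      rw [← ofReal_norm]; exact ENNReal.ofReal_le_ofReal (hM n)
    rw [mul_pow, eLpNorm_two_sq]
    beta_reduce
    rw [← lintegral_const_mul' (ENNReal.ofReal C ^ 2) _ (by finiteness), ← lintegral_indicator hS]
    refine mul_le_mul' (pow_le_pow_left' h3 2) (lintegral_mono fun ξ => ?_)
    by_cases h : ξ ∈ S
    · simp only [hk, Set.indicator_of_mem h]
      rw [← mul_pow, ← ofReal_norm, RCLike.norm_conj, norm_mul, norm_psiSymbol,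
        ENNReal.ofReal_mul (derivSymbol_nonneg p ξ), ofReal_norm]
      gcongr
      refine (derivSymbol_le hp ξ).trans ?_
      have := hSabs ξ h
      simp only [C]
      gcongr
    · simp [hk, Set.indicator_of_notMem h]
  have hgm : Measurable fun z : ℝ × ℝ => ‖gaussianInv (z.2 - z.1)‖ₑ ^ 2 := by
    exact (measurable_enorm_gaussianInv (measurable_snd.sub measurable_fst)).pow_const 2
  have hBfin : ∫⁻ z, B z ∂(timeMeasure.prod volume) ≠ ∞ := by
    have hvol : volume S ≠ ∞ := by
      refine ne_top_of_le_ne_top ?_ (measure_mono (t := Set.Icc (-R) R) fun ξ hξ =>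
        abs_le.1 (hSabs ξ hξ))
      simp
    have hm := hgm.lintegral_prod_right' (ν := volume.restrict S)
    have hBm : Measurable B := by
      rw [hB]
      exact ((hm.comp measurable_snd).const_mul _).const_mul _
    rw [lintegral_prod _ hBm.aemeasurable]
    simp only [hB]
    simp_rw [lintegral_const_mul' _ _ (show ENNReal.ofReal M ^ 2 ≠ ∞ by finiteness),
      lintegral_const_mul' _ _ (show ENNReal.ofReal C ^ 2 ≠ ∞ by finiteness)]
    rw [lintegral_lintegral_swap (f := fun ζ ξ => ‖gaussianInv (ξ - ζ)‖ₑ ^ 2) hgm.aemeasurable]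
    simp_rw [lintegral_gaussianInv_translate]
    rw [lintegral_const, lintegral_const, Measure.restrict_apply_univ, measure_univ, mul_one]
    have := (gaussianInv.memLp 2 (μ := volume)).eLpNorm_ne_top
    finiteness
  have hmeas : ∀ n, Measurable fun z : ℝ × ℝ => ‖window p (S.indicator (v n)) z.1 z.2‖ₑ ^ 2 := fun n =>
    (stronglyMeasurable_window hp ((Lp.stronglyMeasurable (v n)).indicator hS)).enorm.pow_const 2
  have hlim := tendsto_lintegral_of_dominated_convergence (μ := timeMeasure.prod volume) B hmeas
    (fun n => Eventually.of_forall (hbound n)) hBfin (f := fun _ => 0) (Eventually.of_forall fun z => by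
      simp_rw [hinner]
      have h4 := (hv ((hkm z.1 z.2).toLp _)).enorm
      rw [enorm_zero] at h4
      simpa using ENNReal.Tendsto.pow (n := 2) h4)
  rw [lintegral_zero] at hlim
  refine hlim.congr fun n => ?_
  rw [windowEnergy, lintegral_prod _ (hmeas n).aemeasurable]

theorem window_indicator_add {p : ℝ} (hp : 1 < p) {v : ℝ → ℂ} (hv : MemLp v 2 volume) {S : Set ℝ}
    (hS : MeasurableSet S) (t ζ : ℝ) :
    window p v t ζ = window p (S.indicator v) t ζ + window p (Sᶜ.indicator v) t ζ := by
  unfold window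
  rw [← integral_add (integrable_window hp (hv.indicator hS) t ζ)
    (integrable_window hp (hv.indicator hS.compl) t ζ)]
  congr 1; ext ξ
  by_cases h : ξ ∈ S
  · simp [h]
  · simp [h]

theorem lintegral_le_four_mul_add {α : Type*} [MeasurableSpace α] {μ : Measure α}
    {f g h : α → ℝ≥0∞} (hg : Measurable g) (hle : ∀ x, f x ≤ 4 * (g x + h x)) :
    ∫⁻ x, f x ∂μ ≤ 4 * ((∫⁻ x, g x ∂μ) + ∫⁻ x, h x ∂μ) := by
  rw [← lintegral_add_left hg, ← lintegral_const_mul' _ _ ENNReal.ofNat_ne_top]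
  exact lintegral_mono hle

theorem windowEnergy_le_add {p : ℝ} (hp : 1 < p) (v : L2) {S : Set ℝ} (hS : MeasurableSet S) :
    windowEnergy p v ≤ 4 * (windowEnergy p (S.indicator v) + windowEnergy p (Sᶜ.indicator v)) := by
  have hm : Measurable fun z : ℝ × ℝ => ‖window p (S.indicator v) z.1 z.2‖ₑ ^ 2 :=
    (stronglyMeasurable_window hp ((Lp.stronglyMeasurable v).indicator hS)).enorm.pow_const 2
  have hm' : Measurable fun t => ∫⁻ ζ, ‖window p (S.indicator v) t ζ‖ₑ ^ 2 :=
    hm.lintegral_prod_right'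
  have hpt : ∀ t ζ, ‖window p v t ζ‖ₑ ^ 2 ≤
      4 * (‖window p (S.indicator v) t ζ‖ₑ ^ 2 + ‖window p (Sᶜ.indicator v) t ζ‖ₑ ^ 2) := fun t ζ => by
    have h6 : ‖window p v t ζ‖ₑ ≤
        ‖window p (S.indicator v) t ζ‖ₑ + ‖window p (Sᶜ.indicator v) t ζ‖ₑ := by
      rw [window_indicator_add hp (Lp.memLp v) hS t ζ]; exact enorm_add_le _ _
    exact (pow_le_pow_left' h6 2).trans (ennreal_add_sq_le _ _)
  have hmt : ∀ t, Measurable fun ζ => ‖window p (S.indicator v) t ζ‖ₑ ^ 2 := fun t => by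
    have h := (stronglyMeasurable_window hp ((Lp.stronglyMeasurable v).indicator hS)).measurable.comp
      (measurable_prodMk_left (x := t))
    exact h.enorm.pow_const 2
  exact lintegral_le_four_mul_add hm' fun t => lintegral_le_four_mul_add
    (hmt t) (hpt t)

theorem tendsto_windowEnergy {p : ℝ} (hp : 2 < p) {v : ℕ → L2} {M : ℝ}
    (hM : ∀ n, ‖v n‖ ≤ M) (hv : ∀ w, Tendsto (fun n => inner ℂ w (v n)) atTop (𝓝 0)) :
    Tendsto (fun n => windowEnergy p (v n)) atTop (𝓝 0) := by
  have hp1 : 1 < p := by linarith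
  set D : ℝ≥0∞ := ENNReal.ofReal M ^ 2 * eLpNorm gaussianInv 2 volume ^ 2 with hD
  have hDt : D ≠ ∞ := by
    have := (gaussianInv.memLp 2 (μ := volume)).eLpNorm_ne_top
    rw [hD]
    finiteness
  rw [ENNReal.tendsto_nhds_zero]
  intro ε hε
  -- The two summands are the Schur bound for high frequencies and the eventual bound for low ones;
  -- `4` is the cost of splitting a square.
  obtain ⟨δ, hδ, hδD⟩ : ∃ δ : ℝ≥0∞, δ ≠ 0 ∧ 4 * (2 * δ * D + δ) ≤ ε := by
    have h1 : Tendsto (fun δ : ℝ≥0∞ => 4 * (2 * δ * D + δ)) (𝓝 0) (𝓝 (4 * (2 * 0 * D + 0))) := by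
      refine ENNReal.Tendsto.const_mul (Tendsto.add ?_ tendsto_id) (Or.inr (by norm_num))
      exact ENNReal.Tendsto.mul_const (ENNReal.Tendsto.const_mul tendsto_id (Or.inr (by norm_num))) (Or.inr hDt)
    simp only [mul_zero, zero_mul, add_zero] at h1
    obtain ⟨δ, h2, h3⟩ := (((h1.eventually_le_const hε).filter_mono
      (nhdsWithin_le_nhds (s := Set.Ioi (0 : ℝ≥0∞)))).and self_mem_nhdsWithin).exists
    exact ⟨δ, (show (0 : ℝ≥0∞) < δ from h3).ne', h2⟩
  obtain ⟨R, hR⟩ := exists_schur_bound hp hδ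
  filter_upwards [ENNReal.tendsto_nhds_zero.1 (tendsto_windowEnergy_low hp1 R hM hv) δ
    (pos_iff_ne_zero.2 hδ)] with n hn
  refine (windowEnergy_le_add hp1 (v n) (measurableSet_highFreq R)).trans (le_trans ?_ hδD)
  gcongr
  refine (windowEnergy_high_le hp1 hR (v n)).trans ?_
  rw [hD]
  gcongr
  rw [← ofReal_norm]; exact ENNReal.ofReal_le_ofReal (hM n)

/-- Energies bounded by `2^(-n)` are summable, which gives convergence at almost every time for the
Gaussian measure, hence for Lebesgue measure. -/
theorem exists_subseq_window_tendsto {p : ℝ} (hp : 2 < p) {r : ℕ → L2} {M : ℝ}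
    (hM : ∀ n, ‖r n‖ ≤ M) (hr : ∀ w, Tendsto (fun n => inner ℂ w (r n)) atTop (𝓝 0)) :
    ∃ σ : ℕ → ℕ, StrictMono σ ∧ ∀ᵐ t : ℝ,
      Tendsto (fun n => eLpNorm (window p (𝓕 (r (σ n)) : L2) t) 2 volume) atTop (𝓝 0) := by
  have h1 := tendsto_windowEnergy hp (v := fun n => 𝓕 (r n)) (M := M)
    (fun n => by rw [Lp.norm_fourier_eq]; exact hM n) (fun w => by
      refine (hr (𝓕⁻ w)).congr fun n => ?_
      rw [← Lp.inner_fourier_eq, FourierTransform.fourier_fourierInv_eq])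
  obtain ⟨σ, hσ, hb⟩ := extraction_forall_of_eventually' (P := fun k n =>
    windowEnergy p (𝓕 (r n) : L2) ≤ (2⁻¹ : ℝ≥0∞) ^ k) (fun k => by
      exact eventually_atTop.1 <| ENNReal.tendsto_nhds_zero.1 h1 ((2⁻¹ : ℝ≥0∞) ^ k) (ENNReal.pow_pos (by simp) k))
  refine ⟨σ, hσ, ?_⟩
  have hp1 : 1 < p := by linarith
  have hmeas : ∀ n, Measurable fun t => ∫⁻ ζ, ‖window p (𝓕 (r (σ n)) : L2) t ζ‖ₑ ^ 2 := fun n =>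
    ((stronglyMeasurable_window hp1 (Lp.stronglyMeasurable _)).enorm.pow_const 2).lintegral_prod_right'
  have hsum : ∫⁻ t, ∑' n, ∫⁻ ζ, ‖window p (𝓕 (r (σ n)) : L2) t ζ‖ₑ ^ 2 ∂volume ∂timeMeasure ≠ ∞ := by
    rw [lintegral_tsum fun n => (hmeas n).aemeasurable]
    refine ne_top_of_le_ne_top ?_ (ENNReal.tsum_le_tsum hb)
    rw [ENNReal.tsum_geometric]
    simp
  have hae := ae_lt_top (Measurable.tsum hmeas) hsum
  have hae' := ProbabilityTheory.gaussianReal_absolutelyContinuous' 0 (v := 1) one_ne_zero |>.ae_le hae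
  filter_upwards [hae'] with t ht
  have h2 := ENNReal.tendsto_atTop_zero_of_tsum_ne_top ht.ne
  have h3 := h2.ennrpow_const (1 / 2)
  rw [ENNReal.zero_rpow_of_pos (by norm_num)] at h3
  refine h3.congr fun n => ?_
  rw [← eLpNorm_two_sq, ← ENNReal.rpow_natCast, ← ENNReal.rpow_mul]
  simp

/-! ### A Brezis–Lieb inequality for the energy -/

theorem eLpNorm_rpow_eq {q : ℝ} (hq : 0 < q) (f : ℝ → ℂ) :
    eLpNorm f (ENNReal.ofReal q) volume ^ q = ∫⁻ x, ‖f x‖ₑ ^ q := by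
  rw [eLpNorm_eq_lintegral_rpow_enorm_toReal (by simpa using hq) ENNReal.ofReal_ne_top,
    ENNReal.toReal_ofReal hq.le, ← ENNReal.rpow_mul, one_div, inv_mul_cancel₀ hq.ne', ENNReal.rpow_one]

/-- One-sided Brezis–Lieb: the truncated defect is dominated by `C ‖f‖^q` through `hCD`, and
vanishes wherever `g n x → 0`. Since the Gaussian has no zeros, convergence of `gaussian * g n` in
`L²` yields this almost everywhere along subsequences. -/
theorem lintegral_defect_tendsto {q : ℝ} (hq : 1 < q) {C D : ℝ≥0∞} (hC : C ≠ ∞) (hD : D ≠ ∞)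
    (hCD : ∀ a b : ℝ≥0∞, (a + b) ^ q ≤ C * a ^ q + D * b ^ q) {f : ℝ → ℂ} {g : ℕ → ℝ → ℂ}
    (hf : MemLp f (ENNReal.ofReal q) volume) (hg : ∀ n, AEStronglyMeasurable (g n) volume)
    (hlim : Tendsto (fun n => eLpNorm (fun x => gaussian x * g n x) 2 volume) atTop (𝓝 0)) :
    Tendsto (fun n => ∫⁻ x, (‖f x + g n x‖ₑ ^ q - (D * ‖g n x‖ₑ ^ q + ‖f x‖ₑ ^ q))) atTop (𝓝 0) := by
  have hq0 : 0 < q := by linarith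
  refine tendsto_of_subseq_tendsto fun ns hns => ?_
  have hgm : ∀ n, AEStronglyMeasurable (fun x => gaussian x * g n x) volume := fun n =>
    gaussian.continuous.aestronglyMeasurable.mul (hg n)
  have hm : TendstoInMeasure volume (fun n x => gaussian x * g (ns n) x) atTop (fun _ => (0 : ℂ)) := by
    refine tendstoInMeasure_of_tendsto_eLpNorm (p := 2) (by norm_num) (fun n => hgm (ns n))
      aestronglyMeasurable_const ?_
    refine (hlim.comp hns).congr fun n => ?_
    refine eLpNorm_congr_ae (Eventually.of_forall fun x => ?_)
    simp
  obtain ⟨ms, -, hms⟩ := hm.exists_seq_tendsto_ae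
  refine ⟨ms, ?_⟩
  have h0 : ∫⁻ _ : ℝ, (0 : ℝ≥0∞) = 0 := lintegral_zero
  rw [← h0]
  have hfq : ∫⁻ x, C * ‖f x‖ₑ ^ q ≠ ∞ := by
    rw [lintegral_const_mul' _ _ hC, ← eLpNorm_rpow_eq hq0]
    exact ENNReal.mul_ne_top hC (ENNReal.rpow_ne_top_of_nonneg hq0.le hf.2.ne)
  refine tendsto_lintegral_of_dominated_convergence' (fun x => C * ‖f x‖ₑ ^ q) (fun n => ?_)
    (fun n => Eventually.of_forall fun x => ?_) hfq ?_
  · have h1 := ((hf.1.add (hg (ns (ms n)))).enorm.pow_const q)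
    have h2 := ((hg (ns (ms n))).enorm.pow_const q).const_mul D
    exact h1.sub (h2.add (hf.1.enorm.pow_const q))
  · rw [tsub_le_iff_right]
    refine (ENNReal.rpow_le_rpow (enorm_add_le _ _) hq0.le).trans ((hCD _ _).trans ?_)
    rw [← add_assoc]
    exact le_self_add
  · filter_upwards [hms] with x hx
    have h1 : Tendsto (fun n => g (ns (ms n)) x) atTop (𝓝 0) := by
      have h2 := hx.const_mul (gaussian x)⁻¹
      rw [mul_zero] at h2
      refine h2.congr fun n => ?_
      rw [inv_mul_cancel_left₀ (gaussian_ne_zero x)]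
    have h3 : Tendsto (fun n => ‖f x + g (ns (ms n)) x‖ₑ ^ q) atTop (𝓝 (‖f x‖ₑ ^ q)) := by
      have := (h1.const_add (f x)).enorm.ennrpow_const q
      rwa [add_zero] at this
    have h4 : Tendsto (fun n => D * ‖g (ns (ms n)) x‖ₑ ^ q + ‖f x‖ₑ ^ q) atTop (𝓝 (‖f x‖ₑ ^ q)) := by
      have h5 := h1.enorm.ennrpow_const q
      rw [enorm_zero, ENNReal.zero_rpow_of_pos hq0] at h5
      have := (ENNReal.Tendsto.const_mul h5 (Or.inr hD)).add_const (‖f x‖ₑ ^ q)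
      rwa [mul_zero, zero_add] at this
    have h6 := ENNReal.Tendsto.sub h3 h4 (Or.inl (ENNReal.rpow_ne_top_of_nonneg hq0.le enorm_ne_top))
    rwa [tsub_self] at h6

theorem psiNorm_defect_tendsto {p q : ℝ} (hp : 1 < p) (hq : 2 < q) {C D : ℝ≥0∞} (hC : C ≠ ∞)
    (hD : D ≠ ∞) (hCD : ∀ a b : ℝ≥0∞, (a + b) ^ q ≤ C * a ^ q + D * b ^ q) {v : L2} {r : ℕ → L2}
    {t : ℝ} (hv : psiNorm p q v t ≠ ∞) (hr : ∀ n, psiNorm p q (r n) t ≠ ∞)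
    (hlim : Tendsto (fun n => eLpNorm (window p (𝓕 (r n) : L2) t) 2 volume) atTop (𝓝 0)) :
    Tendsto (fun n => psiNorm p q (v + r n) t ^ q -
      (D * psiNorm p q (r n) t ^ q + psiNorm p q v t ^ q)) atTop (𝓝 0) := by
  have hq0 : 0 < q := by linarith
  have hq1 : 1 < q := by linarith
  obtain ⟨f, hf, hfv, hfn⟩ := exists_isPsi hq1 hv
  choose g hg hgr hgn using fun n => exists_isPsi hq1 (hr n)
  have h1 := lintegral_defect_tendsto hq1 hC hD hCD hf (fun n => (hg n).1)
    (tendsto_of_tendsto_of_tendsto_of_le_of_le tendsto_const_nhds hlim (fun _ => zero_le)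
      (fun n => eLpNorm_gaussian_mul_le hp hq (hg n) (hgr n)))
  refine tendsto_of_tendsto_of_tendsto_of_le_of_le tendsto_const_nhds h1 (fun _ => zero_le) fun n => ?_
  rw [tsub_le_iff_right, hfn, hgn, eLpNorm_rpow_eq hq0, eLpNorm_rpow_eq hq0,
    psiNorm_eq hq1 (hf.add (hg n)) (hfv.add hp hq1 hf (hg n) (hgr n)), eLpNorm_rpow_eq hq0,
    ← lintegral_const_mul' _ _ hD]
  rw [← lintegral_add_right' _ (hf.1.enorm.pow_const q)]
  have hm : AEMeasurable (fun x => D * ‖g n x‖ₑ ^ q + ‖f x‖ₑ ^ q) volume :=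
    (((hg n).1.enorm.pow_const q).const_mul D).add (hf.1.enorm.pow_const q)
  rw [← lintegral_add_right' _ hm]
  refine lintegral_mono fun x => ?_
  exact le_tsub_add

/-! ### Decoupling in time and the consequences for a weak limit -/

theorem energy_ne_top {p q : ℝ} (hp : 0 < p) (hA : bestConst p q ≠ ∞) (u : L2) :
    energy p q u ≠ ∞ :=
  ne_top_of_le_ne_top (ENNReal.mul_ne_top hA (ENNReal.rpow_ne_top_of_nonneg hp.le enorm_ne_top))
    (energy_le hp u)

theorem ae_psiNorm_ne_top {p q : ℝ} (hp : 1 < p) (hq : 2 < q) (hA : bestConst p q ≠ ∞) (u : L2) :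
    ∀ᵐ t, psiNorm p q u t ≠ ∞ := by
  have h := ae_lt_top ((measurable_psiNorm hp hq u).pow_const p) (energy_ne_top (by linarith) hA u)
  filter_upwards [h] with t ht hinf
  rw [hinf, ENNReal.top_rpow_of_pos (by linarith)] at ht
  exact lt_irrefl _ ht

/-- The Brezis–Lieb scheme repeated in time: the spatial defect `W n t` tends to zero for almost
every `t`, and `W n t ^ (p/q)` is dominated by a multiple of `psiNorm p q v t ^ p`, integrable since
the energy of `v` is finite. -/
theorem exists_subseq_energy_le {p q : ℝ} (hp : 2 < p) (hq : 2 < q) (hA : bestConst p q ≠ ∞)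
    {ε : ℝ} (hε : 0 < ε) (v : L2) {r : ℕ → L2} {M : ℝ} (hM : ∀ n, ‖r n‖ ≤ M)
    (hr : ∀ w, Tendsto (fun n => inner ℂ w (r n)) atTop (𝓝 0)) :
    ∃ σ : ℕ → ℕ, StrictMono σ ∧ ∃ w : ℕ → ℝ≥0∞, Tendsto w atTop (𝓝 0) ∧ ∀ n,
      energy p q (v + r (σ n)) ^ min 1 (1 / (p / q)) ≤
        ((ENNReal.ofReal (1 + ε) ^ (p / q) * energy p q (r (σ n))) ^ min 1 (1 / (p / q)) +
          energy p q v ^ min 1 (1 / (p / q))) + w n := by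
  have hp1 : 1 < p := by linarith
  have hq0 : 0 < q := by linarith
  have hs : 0 < p / q := by positivity
  obtain ⟨C, hC, hCD⟩ := exists_add_rpow_le (q := q) (by linarith) hε
  set D := ENNReal.ofReal (1 + ε) with hDdef
  have hD : D ≠ ∞ := ENNReal.ofReal_ne_top
  obtain ⟨σ, hσ, hlim⟩ := exists_subseq_window_tendsto hp hM hr
  set W : ℕ → ℝ → ℝ≥0∞ := fun n t => psiNorm p q (v + r (σ n)) t ^ q -
      (D * psiNorm p q (r (σ n)) t ^ q + psiNorm p q v t ^ q) with hW
  have hmv := (measurable_psiNorm hp1 hq v).pow_const q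
  have hmr := fun n => ((measurable_psiNorm hp1 hq (r n)).pow_const q).const_mul D
  have hWm : ∀ n, Measurable (W n) := fun n =>
    ((measurable_psiNorm hp1 hq (v + r (σ n))).pow_const q).sub ((hmr (σ n)).add hmv)
  have hqs : ∀ x : ℝ≥0∞, (x ^ q) ^ (p / q) = x ^ p := fun x => by
    rw [← ENNReal.rpow_mul, mul_div_cancel₀ _ hq0.ne']
  have hWlim : Tendsto (fun n => ∫⁻ t, W n t ^ (p / q)) atTop (𝓝 0) := by
    have h0 : ∫⁻ _ : ℝ, (0 : ℝ≥0∞) = 0 := lintegral_zero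
    rw [← h0]
    refine tendsto_lintegral_of_dominated_convergence (fun t => C ^ (p / q) * psiNorm p q v t ^ p)
      (fun n => (hWm n).pow_const _) (fun n => Eventually.of_forall fun t => ?_) ?_ ?_
    · beta_reduce
      rw [← hqs, ← ENNReal.mul_rpow_of_nonneg _ _ hs.le]
      refine ENNReal.rpow_le_rpow ?_ hs.le
      rw [hW]
      beta_reduce
      rw [tsub_le_iff_right]
      refine (ENNReal.rpow_le_rpow (psiNorm_add_le hp1 (by linarith) v _ t) hq0.le).trans
        ((hCD _ _).trans ?_)
      rw [← add_assoc]
      exact le_self_add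
    · rw [lintegral_const_mul' _ _ (ENNReal.rpow_ne_top_of_nonneg hs.le hC)]
      exact ENNReal.mul_ne_top (ENNReal.rpow_ne_top_of_nonneg hs.le hC)
        (energy_ne_top (by linarith) hA v)
    · filter_upwards [hlim, ae_psiNorm_ne_top hp1 hq hA v,
        ae_all_iff.2 fun n => ae_psiNorm_ne_top hp1 hq hA (r (σ n))] with t h1 h2 h3
      have h4 := (psiNorm_defect_tendsto hp1 hq hC hD hCD h2 h3 h1).ennrpow_const (p / q)
      rwa [ENNReal.zero_rpow_of_pos hs] at h4
  have hα : 0 < min 1 (1 / (p / q)) := lt_min one_pos (by positivity)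
  refine ⟨σ, hσ, fun n => (∫⁻ t, W n t ^ (p / q)) ^ min 1 (1 / (p / q)), ?_, fun n => ?_⟩
  · have := hWlim.ennrpow_const (min 1 (1 / (p / q)))
    rwa [ENNReal.zero_rpow_of_pos hα] at this
  · have h1 : energy p q (v + r (σ n)) ≤ ∫⁻ t, (D * psiNorm p q (r (σ n)) t ^ q +
        psiNorm p q v t ^ q + W n t) ^ (p / q) := by
      unfold energy
      refine lintegral_mono fun t => ?_
      beta_reduce
      rw [← hqs]
      exact ENNReal.rpow_le_rpow le_add_tsub hs.le
    refine (ENNReal.rpow_le_rpow h1 hα.le).trans ?_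
    refine (lintegral_add_rpow_min_le hs ((hmr (σ n)).add hmv).aemeasurable
      (hWm n).aemeasurable).trans ?_
    refine add_le_add ?_ le_rfl
    refine (lintegral_add_rpow_min_le hs (hmr (σ n)).aemeasurable hmv.aemeasurable).trans
      (le_of_eq ?_)
    congr 2
    · unfold energy
      rw [← lintegral_const_mul' _ _ (ENNReal.rpow_ne_top_of_nonneg hs.le hD)]
      refine lintegral_congr fun t => ?_
      rw [ENNReal.mul_rpow_of_nonneg _ _ hs.le, hqs]
    · unfold energy
      exact lintegral_congr fun t => hqs _

theorem eq_one_of_one_le_rpow_add {S κ : ℝ} (hκ : 1 < κ) (hS0 : 0 < S) (hS1 : S ≤ 1)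
    (h : 1 ≤ (1 - S) ^ κ + S ^ κ) : S = 1 := by
  by_contra hne
  have hS : S < 1 := lt_of_le_of_ne hS1 hne
  have h1 := Real.rpow_lt_rpow_of_exponent_gt hS0 hS hκ
  have h2 := Real.rpow_lt_rpow_of_exponent_gt (show 0 < 1 - S by linarith) (by linarith) hκ
  rw [Real.rpow_one] at h1 h2
  linarith

/-- If mass were split between `v` and the remainder, the decoupled energies could not add up to
`𝒜_p`: after division by `𝒜_p ^ α` the two masses enter with a power `κ > 1`. -/
theorem norm_weakLimit_eq_one {p q : ℝ} (hp : 2 < p) (hq : 2 < q) (hA : bestConst p q ≠ ∞)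
    (hA0 : bestConst p q ≠ 0) {U : ℕ → L2} (hU : IsMaximizing p q U) {v : L2} (hv : v ≠ 0)
    (hw : ∀ w, Tendsto (fun n => inner ℂ w (U n)) atTop (𝓝 (inner ℂ w v))) : ‖v‖ = 1 := by
  obtain ⟨hU1, hUE⟩ := hU
  have hp0 : 0 < p := by linarith
  have hq0 : 0 < q := by linarith
  set A := bestConst p q
  set s := p / q with hsdef
  have hs : 0 < s := by positivity
  set α := min 1 (1 / s) with hαdef
  have hα : 0 < α := lt_min one_pos (by positivity)
  have hnorm := norm_sub_sq_tendsto_of_tendsto_inner hU1 hw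
  have hS1 : ‖v‖ ^ 2 ≤ 1 := by
    have := ge_of_tendsto' hnorm fun n => sq_nonneg ‖U n - v‖
    linarith
  have hnorm' : Tendsto (fun n => ‖U n - v‖) atTop (𝓝 √(1 - ‖v‖ ^ 2)) := by
    refine (hnorm.sqrt).congr fun n => Real.sqrt_sq (norm_nonneg _)
  set ρ := √(1 - ‖v‖ ^ 2) with hρ
  have hr : ∀ w, Tendsto (fun n => inner ℂ w (U n - v)) atTop (𝓝 0) := fun w => by
    have := (hw w).sub_const (inner ℂ w v)
    rw [sub_self] at this
    refine this.congr fun n => (inner_sub_right _ _ _).symm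
  have hM : ∀ n, ‖U n - v‖ ≤ 1 + ‖v‖ := fun n => by
    have := norm_sub_le (U n) v
    rwa [hU1 n] at this
  have hAα0 : A ^ α ≠ 0 := by simp [ENNReal.rpow_eq_zero_iff, hA0, hA]
  have hAαt : A ^ α ≠ ∞ := ENNReal.rpow_ne_top_of_nonneg hα.le hA
  have key : ∀ ε > 0, 1 ≤ (1 + ε) ^ (s * α) * ρ ^ (p * α) + ‖v‖ ^ (p * α) := by
    intro ε hε
    obtain ⟨σ, hσ, w, hw0, hle⟩ := exists_subseq_energy_le hp hq hA hε v hM hr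
    set D := ENNReal.ofReal (1 + ε)
    have hDs : D ^ s ≠ ∞ := ENNReal.rpow_ne_top_of_nonneg hs.le ENNReal.ofReal_ne_top
    have hl1 : Tendsto (fun n => energy p q (U (σ n)) ^ α) atTop (𝓝 (A ^ α)) :=
      (hUE.comp hσ.tendsto_atTop).ennrpow_const α
    have hl2 : Tendsto (fun n => ((D ^ s * (A * ‖U (σ n) - v‖ₑ ^ p)) ^ α + (A * ‖v‖ₑ ^ p) ^ α) + w n) atTop
        (𝓝 (((D ^ s * (A * ENNReal.ofReal ρ ^ p)) ^ α + (A * ‖v‖ₑ ^ p) ^ α) + 0)) := by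
      have h1 := ENNReal.tendsto_ofReal (hnorm'.comp hσ.tendsto_atTop)
      have h2 : Tendsto (fun n => ‖U (σ n) - v‖ₑ) atTop (𝓝 (ENNReal.ofReal ρ)) :=
        h1.congr fun n => by simp
      have h3 := ENNReal.Tendsto.const_mul (a := D ^ s) (ENNReal.Tendsto.const_mul (a := A)
        (h2.ennrpow_const p) (Or.inr hA)) (Or.inr hDs)
      exact ((h3.ennrpow_const α).add_const _).add hw0
    have h4 := le_of_tendsto_of_tendsto' hl1 hl2 fun n => by
      have h5 := hle n
      rw [add_sub_cancel] at h5
      refine h5.trans ?_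
      gcongr
      · exact energy_le hp0 _
      · exact energy_le hp0 _
    rw [add_zero] at h4
    have h6 : (D ^ s * (A * ENNReal.ofReal ρ ^ p)) ^ α + (A * ‖v‖ₑ ^ p) ^ α =
        A ^ α * ENNReal.ofReal ((1 + ε) ^ (s * α) * ρ ^ (p * α) + ‖v‖ ^ (p * α)) := by
      have hρ0 : 0 ≤ ρ := Real.sqrt_nonneg _
      rw [ENNReal.ofReal_add (by positivity) (by positivity), ENNReal.ofReal_mul (by positivity),
        ← ENNReal.ofReal_rpow_of_nonneg hρ0 (by positivity),
        ← ENNReal.ofReal_rpow_of_nonneg (by positivity : 0 ≤ 1 + ε) (by positivity),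
        ← ENNReal.ofReal_rpow_of_nonneg (norm_nonneg v) (by positivity), ofReal_norm,
        ENNReal.mul_rpow_of_nonneg _ _ hα.le, ENNReal.mul_rpow_of_nonneg _ _ hα.le,
        ENNReal.mul_rpow_of_nonneg _ _ hα.le, ENNReal.rpow_mul, ENNReal.rpow_mul, ENNReal.rpow_mul]
      ring
    rw [h6] at h4
    have h7 : 1 ≤ ENNReal.ofReal ((1 + ε) ^ (s * α) * ρ ^ (p * α) + ‖v‖ ^ (p * α)) := by
      rw [← ENNReal.mul_le_mul_iff_right hAα0 hAαt, mul_one]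
      exact h4
    rwa [ENNReal.one_le_ofReal] at h7
  -- The subsequence in `key` may depend on `ε`, but the inequality left after `n → ∞` does not
  -- involve it, so `ε → 0` is allowed.
  have hlim : 1 ≤ ρ ^ (p * α) + ‖v‖ ^ (p * α) := by
    have hc : ContinuousAt (fun ε : ℝ => (1 + ε) ^ (s * α) * ρ ^ (p * α) + ‖v‖ ^ (p * α)) 0 := by
      refine ((ContinuousAt.rpow_const (by fun_prop) (Or.inr (by positivity))).mul
        continuousAt_const).add continuousAt_const
    have h8 := ge_of_tendsto (hc.tendsto.mono_left (nhdsWithin_le_nhds (s := Set.Ioi 0)))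
      (eventually_mem_nhdsWithin.mono fun ε hε => key ε hε)
    simpa using h8
  -- Here `p * α = min p q`, so this is exactly `p > 2` and `q > 2`.
  have hκ : 1 < p * α / 2 := by
    have hpα : 2 < p * α := by
      rcases min_choice 1 (1 / s) with h | h
      · rw [hαdef, h]; linarith
      · rw [hαdef, h, hsdef]
        field_simp
        exact hq
    linarith
  have hv0 : 0 < ‖v‖ := norm_pos_iff.2 hv
  have hsq : ∀ x : ℝ, 0 ≤ x → x ^ (p * α) = (x ^ 2) ^ (p * α / 2) := fun x hx => by
    rw [← Real.rpow_natCast x 2, ← Real.rpow_mul hx]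
    congr 1; push_cast; ring
  rw [hsq ρ (Real.sqrt_nonneg _), hsq ‖v‖ hv0.le, hρ, Real.sq_sqrt (by linarith)] at hlim
  have := eq_one_of_one_le_rpow_add hκ (by positivity) hS1 hlim
  nlinarith

/-- Failure of weak vanishing gives a test function whose pairing stays above some `ε` along a
subsequence; a further weak limit inherits the bound and is nonzero. -/
theorem exists_profile {p q : ℝ} (h : bestConstStar p q < bestConst p q) {u : ℕ → L2}
    (hu : IsMaximizing p q u) :
    ∃ σ : ℕ → ℕ, StrictMono σ ∧ ∃ g : ℕ → L2 → L2, (∀ n, g n ∈ G) ∧ ∃ v : L2, v ≠ 0 ∧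
      ∀ w, Tendsto (fun n => inner ℂ w (g n (u (σ n)))) atTop (𝓝 (inner ℂ w v)) := by
  have hnot : ¬ WeakSymmZero u := fun hw => by
    have h1 : limsup (fun n => energy p q (u n)) atTop ≤ bestConstStar p q :=
      le_iSup_of_le u (le_iSup_of_le hu.1 (le_iSup_of_le hw le_rfl))
    rw [hu.2.limsup_eq] at h1
    exact absurd h (not_lt.2 h1)
  unfold WeakSymmZero at hnot
  push Not at hnot
  obtain ⟨g, hg, w, hw⟩ := hnot
  rw [Metric.tendsto_nhds] at hw
  push Not at hw
  obtain ⟨ε, hε, hfr⟩ := hw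
  obtain ⟨σ, hσ, hσε⟩ := extraction_of_frequently_atTop hfr
  obtain ⟨v, τ, hτ, hv⟩ := exists_subseq_tendsto_inner (x := fun n => g (σ n) (u (σ n))) (C := 1)
    fun n => by rw [norm_of_mem_G (hg _), hu.1]
  refine ⟨fun n => σ (τ n), hσ.comp hτ, fun n => g (σ (τ n)), fun n => hg _, v, ?_, hv⟩
  rintro rfl
  have h2 := (hv w).norm
  rw [inner_zero_right, norm_zero] at h2
  have h3 := ge_of_tendsto' h2 fun n => by
    have := hσε (τ n)
    simpa using this
  linarith

theorem precompact_of_star_lt {p q : ℝ} (hp : 2 < p) (hq : 2 < q) (hpq : 2 / p + 1 / q = 1 / 2)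
    (hA : bestConst p q ≠ ∞) (h : bestConstStar p q < bestConst p q) {u : ℕ → L2}
    (hu : IsMaximizing p q u) : PrecompactUpToSymm u := by
  obtain ⟨g, hg, htb⟩ := isIsometryGroup_G.exists_totallyBounded (u := u) fun φ hφ => by
    have hu' : IsMaximizing p q fun n => u (φ n) :=
      ⟨fun n => hu.1 _, hu.2.comp hφ.tendsto_atTop⟩
    obtain ⟨σ, hσ, g, hg, v, hv, hw⟩ := exists_profile h hu'
    refine ⟨σ, hσ, g, hg, v, ?_⟩
    have hmax : IsMaximizing p q fun n => g n (u (φ (σ n))) :=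
      ⟨fun n => by rw [norm_of_mem_G (hg n), hu.1], by
        refine (hu'.2.comp hσ.tendsto_atTop).congr fun n => ?_
        rw [energy_of_mem_G (by linarith) hq hpq (hg n)]
        rfl⟩
    have hv1 := norm_weakLimit_eq_one hp hq hA (ne_bot_of_gt h) hmax hv hw
    have h1 := norm_sub_sq_tendsto_of_tendsto_inner hmax.1 hw
    rw [hv1, one_pow, sub_self] at h1
    rw [tendsto_iff_norm_sub_tendsto_zero]
    have h2 := h1.sqrt
    rw [Real.sqrt_zero] at h2
    exact h2.congr fun n => Real.sqrt_sq (norm_nonneg _)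
  exact ⟨g, hg, htb.closure.isCompact_of_isClosed isClosed_closure⟩

/-! ### Infinite best constant and vanishing maximizing sequences -/

/-! ### Comparison of the two constants -/

theorem smul_of_mem_G {g : L2 → L2} (hg : g ∈ G) (c : ℂ) (u : L2) : g (c • u) = c • g u := by
  obtain ⟨t, x, l, hl, rfl⟩ := hg
  exact symm_smul t x hl c u

theorem enorm_eq_one_of_norm {u : L2} (hu : ‖u‖ = 1) : ‖u‖ₑ = 1 := by
  rw [← ofReal_norm, hu, ENNReal.ofReal_one]

theorem energy_le_bestConst {p q : ℝ} (hp : 0 < p) {u : L2} (hu : ‖u‖ = 1) :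
    energy p q u ≤ bestConst p q := by
  have h := energy_le (q := q) hp u
  rwa [enorm_eq_one_of_norm hu, ENNReal.one_rpow, mul_one] at h

theorem exists_lt_energy {p q : ℝ} (hp : 1 < p) (hq : 2 < q) {c : ℝ≥0∞} (hc : c < bestConst p q) :
    ∃ u : L2, ‖u‖ = 1 ∧ c < energy p q u := by
  obtain ⟨u, hu⟩ := lt_iSup_iff.1 hc
  obtain ⟨hu0, hu⟩ := lt_iSup_iff.1 hu
  have hn : ‖u‖ ≠ 0 := norm_ne_zero_iff.2 hu0
  refine ⟨((‖u‖⁻¹ : ℝ) : ℂ) • u, ?_, ?_⟩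
  · rw [norm_smul, Complex.norm_real, norm_inv, norm_norm, inv_mul_cancel₀ hn]
  · rw [energy_smul hp hq]
    have h1 : ‖((‖u‖⁻¹ : ℝ) : ℂ)‖ₑ = ‖u‖ₑ⁻¹ := by
      rw [← ofReal_norm, Complex.norm_real, norm_inv, norm_norm,
        ENNReal.ofReal_inv_of_pos (norm_pos_iff.2 hu0), ofReal_norm]
    rwa [h1, ENNReal.inv_rpow, mul_comm, ← div_eq_mul_inv]

theorem WeakSymmZero.of_norm_sub_le {v z : ℕ → L2} (hv : WeakSymmZero v) {c : ℕ → ℂ} {e : ℕ → ℝ}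
    (hc : ∀ n, ‖c n‖ ≤ 2) (he : Tendsto e atTop (𝓝 0)) (h : ∀ n, ‖z n - c n • v n‖ ≤ e n) :
    WeakSymmZero z := by
  rw [weakSymmZero_iff] at hv ⊢
  intro w ε hε
  have h1 : Tendsto (fun n => ‖w‖ * e n) atTop (𝓝 0) := by simpa using he.const_mul ‖w‖
  filter_upwards [hv w (ε / 4) (by positivity), h1.eventually_lt_const (half_pos hε)] with n h2 h3 g hg
  have h4 : g (z n) = g (z n - c n • v n) + c n • g (v n) := by
    rw [← smul_of_mem_G hg, ← add_of_mem_G hg, sub_add_cancel]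
  rw [h4, inner_add_right, inner_smul_right]
  refine (norm_add_le _ _).trans_lt ?_
  have h5 : ‖inner ℂ w (g (z n - c n • v n))‖ ≤ ‖w‖ * e n := by
    refine (norm_inner_le_norm _ _).trans ?_
    rw [norm_of_mem_G hg]
    exact mul_le_mul_of_nonneg_left (h n) (norm_nonneg _)
  have h6 : ‖c n * inner ℂ w (g (v n))‖ ≤ 2 * (ε / 4) := by
    rw [norm_mul]
    exact mul_le_mul (hc n) (h2 g hg).le (norm_nonneg _) zero_le_two
  linarith

/-- If all normalized vectors near multiples of `v` had energy below `N`, then `ε w`, as the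
difference of `v + ε w` and `v`, would have energy bounded uniformly over unit vectors `w`, making
`𝒜_p` finite. -/
theorem exists_le_energy_near {p q : ℝ} (hp : 1 < p) (hq : 2 < q) (hA : bestConst p q = ∞) {v : L2}
    (hv : ‖v‖ = 1) {N : ℝ≥0∞} (hN : N ≠ ∞) {ε : ℝ} (hε : 0 < ε) (hε2 : ε ≤ 1 / 2) :
    ∃ z : L2, ‖z‖ = 1 ∧ N ≤ energy p q z ∧ ∃ c : ℂ, ‖c‖ ≤ 2 ∧ ‖z - c • v‖ ≤ 2 * ε := by
  by_contra! hcon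
  have hlt : ∀ z : L2, ‖z‖ = 1 → ∀ c : ℂ, ‖c‖ ≤ 2 → ‖z - c • v‖ ≤ 2 * ε → energy p q z < N := by
    intro z hz c hc hzc
    by_contra! h
    exact absurd hzc (not_le.2 (hcon z hz h c hc))
  have hp0 : 0 < p := by linarith
  have hip : 0 ≤ 1 / p := by positivity
  have hvN : energy p q v ≤ N := (hlt v hv 1 (by simp) (by simp [hε.le])).le
  set K : ℝ≥0∞ := ((2 ^ p * N) ^ (1 / p) + N ^ (1 / p)) ^ p with hKdef
  have hK : K ≠ ∞ := by
    refine ENNReal.rpow_ne_top_of_nonneg hp0.le (ENNReal.add_ne_top.2 ⟨?_, ?_⟩)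
    · exact ENNReal.rpow_ne_top_of_nonneg hip
        (ENNReal.mul_ne_top (ENNReal.rpow_ne_top_of_nonneg hp0.le (by norm_num)) hN)
    · exact ENNReal.rpow_ne_top_of_nonneg hip hN
  have hεe : ‖(ε : ℂ)‖ₑ = ENNReal.ofReal ε := by
    rw [← ofReal_norm, Complex.norm_real, Real.norm_of_nonneg hε.le]
  have hε0 : ENNReal.ofReal ε ^ p ≠ 0 := by
    rw [Ne, ENNReal.rpow_eq_zero_iff_of_pos hp0, ENNReal.ofReal_eq_zero]
    exact not_le.2 hε
  have hbound : ∀ w : L2, ‖w‖ = 1 → ENNReal.ofReal ε ^ p * energy p q w ≤ K := by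
    intro w hw
    set x := v + (ε : ℂ) • w with hx
    have hεw : ‖(ε : ℂ) • w‖ = ε := by
      rw [norm_smul, Complex.norm_real, Real.norm_of_nonneg hε.le, hw, mul_one]
    have hx1 : 1 / 2 ≤ ‖x‖ := by
      have := norm_sub_le_norm_add v ((ε : ℂ) • w)
      rw [hv, hεw] at this
      linarith
    have hx2 : ‖x‖ ≤ 2 := by
      have := norm_add_le v ((ε : ℂ) • w)
      rw [hv, hεw] at this
      linarith
    have hx0 : ‖x‖ ≠ 0 := by linarith
    have hxi : ‖x‖⁻¹ ≤ 2 := by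
      rw [inv_le_comm₀ (by linarith) two_pos]
      linarith
    have hci : ‖((‖x‖⁻¹ : ℝ) : ℂ)‖ = ‖x‖⁻¹ := by
      rw [Complex.norm_real, norm_inv, norm_norm]
    have hz := hlt (((‖x‖⁻¹ : ℝ) : ℂ) • x) (by rw [norm_smul, hci, inv_mul_cancel₀ hx0])
      ((‖x‖⁻¹ : ℝ) : ℂ) (by rw [hci]; exact hxi) (by
        rw [← smul_sub, hx, add_sub_cancel_left, norm_smul, hεw, ← hx, hci]
        exact mul_le_mul_of_nonneg_right hxi hε.le)
    have hxe : energy p q x ≤ 2 ^ p * N := by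
      have h1 : x = (‖x‖ : ℂ) • ((‖x‖⁻¹ : ℝ) : ℂ) • x := by
        rw [smul_smul, ← Complex.ofReal_mul, mul_inv_cancel₀ hx0, Complex.ofReal_one, one_smul]
      rw [h1, energy_smul hp hq]
      refine mul_le_mul' (ENNReal.rpow_le_rpow ?_ hp0.le) hz.le
      rw [← ofReal_norm, Complex.norm_real, norm_norm]
      exact (ENNReal.ofReal_le_ofReal hx2).trans (by simp)
    have hw' : (ε : ℂ) • w = x + (-1 : ℂ) • v := by
      rw [hx, neg_one_smul]
      abel
    have h2 := energy_add_le hp hq x ((-1 : ℂ) • v)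
    rw [← hw', energy_smul hp hq (-1 : ℂ) v, enorm_neg, enorm_one, ENNReal.one_rpow, one_mul,
      energy_smul hp hq, hεe] at h2
    have h3 := ENNReal.rpow_le_rpow (h2.trans (add_le_add (ENNReal.rpow_le_rpow hxe hip)
      (ENNReal.rpow_le_rpow hvN hip))) hp0.le
    rwa [← ENNReal.rpow_mul, one_div_mul_cancel hp0.ne', ENNReal.rpow_one] at h3
  obtain ⟨w, hw, hlw⟩ := exists_lt_energy hp hq
    (show K / ENNReal.ofReal ε ^ p < bestConst p q by
      rw [hA]
      exact ENNReal.div_lt_top hK hε0)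
  rw [ENNReal.div_lt_iff (Or.inl hε0) (Or.inr hK), mul_comm] at hlw
  exact absurd (hbound w hw) (not_le.2 hlw)

/-- Perturbations of `freqBump n` of size `O(1/n)` with energy at least `n` still vanish weakly up
to symmetries. -/
theorem bestConstStar_eq_top {p q : ℝ} (hp : 1 < p) (hq : 2 < q) (hA : bestConst p q = ∞) :
    bestConstStar p q = ∞ := by
  have hex := fun n : ℕ => exists_le_energy_near hp hq hA (norm_freqBump n)
    (ENNReal.natCast_ne_top n) (ε := 1 / ((n : ℝ) + 2)) (by positivity)
    (one_div_le_one_div_of_le two_pos (by linarith [n.cast_nonneg (α := ℝ)]))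
  choose z hz1 hz2 c hc hzc using hex
  have he : Tendsto (fun n : ℕ => 2 * (1 / ((n : ℝ) + 2))) atTop (𝓝 0) := by
    have h : Tendsto (fun n : ℕ => (n : ℝ) + 2) atTop atTop :=
      tendsto_atTop_add_const_right _ _ tendsto_natCast_atTop_atTop
    simpa using h.inv_tendsto_atTop.const_mul 2
  have hw : WeakSymmZero z := weakSymmZero_freqBump.of_norm_sub_le hc he hzc
  have hlim : Tendsto (fun n => energy p q (z n)) atTop (𝓝 ∞) :=
    tendsto_nhds_top_mono' ENNReal.tendsto_nat_nhds_top hz2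
  rw [eq_top_iff, ← hlim.limsup_eq]
  exact le_iSup_of_le z (le_iSup_of_le hz1 (le_iSup_of_le hw le_rfl))

theorem not_weakSymmZero_of_precompact {z : ℕ → L2} (hz : ∀ n, ‖z n‖ = 1) (hw : WeakSymmZero z) :
    ¬ PrecompactUpToSymm z := by
  rintro ⟨g, hg, hcpt⟩
  obtain ⟨x, -, φ, hφ, hx⟩ := hcpt.tendsto_subseq (x := fun n => g n (z n))
    fun n => subset_closure (Set.mem_range_self n)
  have h1 : ‖x‖ = 1 := tendsto_nhds_unique hx.norm
    (tendsto_const_nhds.congr fun n => by simp [norm_of_mem_G (hg _), hz])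
  have h2 := tendsto_nhds_unique ((hw g hg x).comp hφ.tendsto_atTop)
    ((tendsto_const_nhds (x := x)).inner hx)
  have h3 : x = 0 := inner_self_eq_zero.1 h2.symm
  simp [h3] at h1

theorem exists_weakSymmZero_approx {p q : ℝ} {c : ℝ≥0∞} (hc : c < bestConstStar p q) {δ : ℝ}
    (hδ : 0 < δ) (w : ℕ → L2) (k : ℕ) :
    ∃ z : L2, ‖z‖ = 1 ∧ c < energy p q z ∧ ∀ j ≤ k, ∀ g ∈ G, ‖inner ℂ (w j) (g z)‖ < δ := by
  obtain ⟨u, hu⟩ := lt_iSup_iff.1 hc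
  obtain ⟨hu1, hu⟩ := lt_iSup_iff.1 hu
  obtain ⟨hw, hu⟩ := lt_iSup_iff.1 hu
  have hev : ∀ᶠ n in atTop, ∀ j ∈ Set.Iic k, ∀ g ∈ G, ‖inner ℂ (w j) (g (u n))‖ < δ :=
    (Set.finite_Iic k).eventually_all.2 fun j _ => weakSymmZero_iff.1 hw (w j) δ hδ
  obtain ⟨n, hn1, hn2⟩ := ((frequently_lt_of_lt_limsup (by isBoundedDefault) hu).and_eventually hev).exists
  exact ⟨u n, hu1 n, hn1, hn2⟩

/-- Since `G` preserves norms, smallness uniform over `G` passes from a dense sequence of test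
functions to all of them. -/
theorem weakSymmZero_of_denseRange {z : ℕ → L2} (hz : ∀ n, ‖z n‖ = 1) {d : ℕ → L2}
    (hd : DenseRange d)
    (h : ∀ k, ∀ j ≤ k, ∀ g ∈ G, ‖inner ℂ (d j) (g (z k))‖ < 1 / ((k : ℝ) + 1)) :
    WeakSymmZero z := by
  rw [weakSymmZero_iff]
  intro w ε hε
  obtain ⟨j, hj⟩ := hd.exists_dist_lt w (half_pos hε)
  filter_upwards [eventually_ge_atTop j,
    tendsto_one_div_add_atTop_nhds_zero_nat.eventually_lt_const (half_pos hε)] with k hk hk2 g hg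
  have h1 : w = (w - d j) + d j := by abel
  rw [h1, inner_add_left]
  refine (norm_add_le _ _).trans_lt ?_
  have h2 : ‖inner ℂ (w - d j) (g (z k))‖ ≤ dist w (d j) := by
    refine (norm_inner_le_norm _ _).trans ?_
    rw [norm_of_mem_G hg, hz, mul_one, dist_eq_norm]
  have h3 := h k j hk g hg
  linarith

theorem exists_maximizing_weakSymmZero {p q : ℝ} (hp : 1 < p)
    (h : bestConst p q ≤ bestConstStar p q) : ∃ z, IsMaximizing p q z ∧ WeakSymmZero z := by
  have hp0 : 0 < p := by linarith
  -- When `𝒜_p = 0` no `c` lies strictly below it, but then every normalized sequence is maximizing.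
  -- The other case also covers `𝒜_p = ∞`.
  rcases eq_or_ne (bestConst p q) 0 with hA | hA
  · refine ⟨freqBump, ⟨norm_freqBump, ?_⟩, weakSymmZero_freqBump⟩
    refine tendsto_const_nhds.congr fun n => (le_antisymm (energy_le_bestConst hp0 (norm_freqBump n)) ?_).symm
    rw [hA]
    exact zero_le
  · obtain ⟨c, -, hc, hlim⟩ := exists_seq_strictMono_tendsto' (pos_iff_ne_zero.2 hA)
    have hex := fun k : ℕ => exists_weakSymmZero_approx ((hc k).2.trans_le h)
      (δ := 1 / ((k : ℝ) + 1)) (by positivity) (TopologicalSpace.denseSeq L2) k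
    choose z hz1 hz2 hz3 using hex
    exact ⟨z, ⟨hz1, tendsto_of_tendsto_of_tendsto_of_le_of_le hlim tendsto_const_nhds
      (fun k => (hz2 k).le) fun k => energy_le_bestConst hp0 (hz1 k)⟩,
      weakSymmZero_of_denseRange hz1 (TopologicalSpace.denseRange_denseSeq L2) hz3⟩

end AiryStrichartz

end

theorem proposition2p2 (p q : ℝ) (hp : 4 < p) (hpq : 2 / p + 1 / q = 1 / 2) :
    (∀ u : ℕ → AiryStrichartz.L2,
        AiryStrichartz.IsMaximizing p q u → AiryStrichartz.PrecompactUpToSymm u) ↔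
      AiryStrichartz.bestConstStar p q < AiryStrichartz.bestConst p q := by
  have hp1 : 1 < p := by linarith
  constructor
  · intro h
    by_contra! hle
    obtain ⟨z, hz, hw⟩ := AiryStrichartz.exists_maximizing_weakSymmZero hp1 hle
    exact AiryStrichartz.not_weakSymmZero_of_precompact hz.1 hw (h z hz)
  · intro h u hu
    have hq : 2 < q := by
      have h1 : 2 / p < 1 / 2 := by
        rw [div_lt_div_iff₀ (by linarith) two_pos]
        linarith
      have h2 : 0 < 2 / p := by positivity
      have h3 : 0 < 1 / q := by linarith
      have hq0 : 0 < q := one_div_pos.1 h3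
      exact (one_div_lt_one_div hq0 two_pos).1 (by linarith)
    refine AiryStrichartz.precompact_of_star_lt (by linarith) hq hpq (fun hA => ?_) h hu
    rw [AiryStrichartz.bestConstStar_eq_top hp1 hq hA] at h
    exact not_top_lt h
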